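/- All graphs are finite and undirected, may have parallel edges, and have no loops. A $c$-pumpkin-model in a graph $G$ is a pair $\{A,B\}$ of disjoint sets of vertices, each inducing a connected (in particular non-empty) subgraph of $G$, such that at least $c$ edges of $G$ join $A$ and $B$; its size is $|A|+|B|$. A graph has a $c$-pumpkin-minor if it has a $c$-pumpkin-model. A block of $G$ is a maximal connected subgraph of $G$ without a cutvertex of its own. An outgrowth of $G$ is a triple $(C,u,v)$ where $u\neq v$ are vertices of $G$, $C$ is a connected component of $G\setminus\{u,v\}$ with at least two vertices, and each of $u$ and $v$ has a neighbour in $C$; $\Gamma(C,u,v)$ denotes the subgraph of $G$ induced by $V(C)\cup\{u,v\}$ with all edges between $u$ and $v$ removed. For an integer $c\ge 1$, rule Z1 can be applied to $G$ if $G$ has a vertex $v$ such that no block of $G$ containing $v$ has a $c$-pumpkin-minor. Rule Z2 can be applied to $G$ if Z1 cannot be applied to $G$ and $G$ has an outgrowth $(C,u,v)$ such that $\Gamma(C,u,v)$ has no $c$-pumpkin-minor. The graph $G$ is $c$-reduced if neither Z1 nor Z2 can be applied to it. **Lemma 4.9.** There is a function $f:\mathbb{N}\to\mathbb{R}$ such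 that for every integer $c\ge 1$ every $c$-reduced graph $G$ with $n\ge 1$ vertices contains a $c$-pumpkin-model of size at most $f(c)\cdot\log n$. Moreover, for every fixed $c\ge 1$, a $c$-pumpkin-model of size at most $f(c)\cdot\log n$ can be computed in time polynomial in the size of the graph: there are a program for a unit-cost random access machine (with addition and truncated subtraction but no multiplication) and a polynomial $p$, both depending only on $c$, such that on every $c$-reduced graph with vertex set $\{0,\dots,n-1\}$, $n\ge 1$, given by $n$ and the list of its $m$ edges, the program halts after at most $p(n+m)$ steps and outputs such a model. -/

import Mathlib

open scoped Graph

universe u v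

namespace Pumpkin

/-! ### Multigraphs

Graphs are Mathlib's `Graph α β` (vertex set `V(G) : Set α`, edge set `E(G) : Set β`, parallel
edges allowed); finiteness and the absence of loops are hypotheses of the theorem. -/

section Graphs

variable {α : Type u} {β : Type v}

/-- A graph is connected if it has a vertex and any two of its vertices are joined by a walk. -/
def Connected (G : Graph α β) : Prop :=
  V(G).Nonempty ∧ ∀ x ∈ V(G), ∀ y ∈ V(G), Relation.ReflTransGen G.Adj x y

/-- The set of edges of `G` with one end in `A` and the other end in `B`. -/
def edgesBetween (G : Graph α β) (A B : Set α) : Set β :=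
  {e | ∃ a ∈ A, ∃ b ∈ B, G.IsLink e a b}

/-- `{A, B}` is a `c`-pumpkin-model of `G`: two disjoint vertex sets, each inducing a connected
subgraph, with at least `c` edges between them. -/
structure IsPumpkinModel (c : ℕ) (G : Graph α β) (A B : Set α) : Prop where
  left_subset : A ⊆ V(G)
  right_subset : B ⊆ V(G)
  disjoint : Disjoint A B
  left_connected : Connected (G.induce A)
  right_connected : Connected (G.induce B)
  le_encard : (c : ℕ∞) ≤ (edgesBetween G A B).encard

/-- `G` has a `c`-pumpkin-minor, that is, a model of the `c`-pumpkin. -/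
def HasPumpkinMinor (c : ℕ) (G : Graph α β) : Prop :=
  ∃ A B : Set α, IsPumpkinModel c G A B

/-- `x` is a cutvertex of `G`: it separates two other vertices of the same component. -/
def IsCutvertex (G : Graph α β) (x : α) : Prop :=
  x ∈ V(G) ∧ ∃ y ∈ V(G), ∃ z ∈ V(G), y ≠ x ∧ z ≠ x ∧
    Relation.ReflTransGen G.Adj y z ∧ ¬ Relation.ReflTransGen (G.deleteVerts {x}).Adj y z

/-- A block of `G` is a maximal connected subgraph of `G` that has no cutvertex of its own
(so isolated vertices and bridges give blocks too). -/
def IsBlock (G B : Graph α β) : Prop :=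
  Maximal (fun H : Graph α β => H ≤ G ∧ Connected H ∧ ∀ x, ¬ IsCutvertex H x) B

/-- A connected component of `G` is a maximal connected subgraph of `G`. -/
def IsComponent (G C : Graph α β) : Prop :=
  Maximal (fun H : Graph α β => H ≤ G ∧ Connected H) C

/-- `(C, u, v)` is an outgrowth of `G`. -/
structure IsOutgrowth (G C : Graph α β) (u v : α) : Prop where
  left_mem : u ∈ V(G)
  right_mem : v ∈ V(G)
  ne : u ≠ v
  isComponent : IsComponent (G.deleteVerts {u, v}) C
  two_le_encard : 2 ≤ V(C).encard
  left_adj : ∃ x ∈ V(C), G.Adj u x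
  right_adj : ∃ x ∈ V(C), G.Adj v x

/-- The graph `Γ(C, u, v)`: the subgraph of `G` induced by `V(C) ∪ {u, v}`, with all the edges
between `u` and `v` removed. -/
def outgrowthGraph (G C : Graph α β) (u v : α) : Graph α β :=
  (G.induce (V(C) ∪ {u, v})).deleteEdges {e | G.IsLink e u v}

/-- The first reduction rule can be applied to `G` at the vertex `v`: no block of `G` containing
`v` has a `c`-pumpkin-minor. -/
def RuleZ1Applies (c : ℕ) (G : Graph α β) (v : α) : Prop :=
  v ∈ V(G) ∧ ∀ B : Graph α β, IsBlock G B → v ∈ V(B) → ¬ HasPumpkinMinor c B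

/-- The second reduction rule can be applied to `G` at the outgrowth `(C, u, v)`: the graph
`Γ(C, u, v)` has no `c`-pumpkin-minor, and the first rule cannot be applied anywhere. -/
def RuleZ2Applies (c : ℕ) (G C : Graph α β) (u v : α) : Prop :=
  IsOutgrowth G C u v ∧ ¬ HasPumpkinMinor c (outgrowthGraph G C u v) ∧
    ¬ ∃ w, RuleZ1Applies c G w

/-- `G` is `c`-reduced: neither reduction rule can be applied to it. -/
def IsReduced (c : ℕ) (G : Graph α β) : Prop :=
  (¬ ∃ v, RuleZ1Applies c G v) ∧ ¬ ∃ (C : Graph α β) (u v : α), RuleZ2Applies c G C u v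

end Graphs

/-! ### Random access machines with a step count

Programs are structured programs for a unit-cost random access machine: the memory consists of
scalar registers and of arrays of registers, each holding a natural number, and the operations are
addition, truncated subtraction, array access and branching on zero. There is no multiplication, so
that numbers have at most linearly many more bits than steps have been made, and polynomial time on
this machine is polynomial time on Turing machines. -/

/-- The memory of the machine. -/
structure State where
  /-- the scalar registers -/
  var : ℕ → ℕ
  /-- the arrays: `arr a i` is entry `i` of the array number `a` -/
  arr : ℕ → ℕ → ℕ

/-- Replace the content of the scalar register `x` by `k`. -/
def State.setVar (s : State) (x k : ℕ) : State :=
  { s with var := Function.update s.var x k }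

/-- Replace entry `i` of the array `a` by `k`. -/
def State.setArr (s : State) (a i k : ℕ) : State :=
  { s with arr := Function.update s.arr a (Function.update (s.arr a) i k) }

/-- Expressions of the programming language. -/
inductive Expr where
  | const (k : ℕ)
  | var (x : ℕ)
  | arr (a : ℕ) (i : Expr)
  | add (e₁ e₂ : Expr)
  | sub (e₁ e₂ : Expr)

/-- The value of an expression in a state. -/
def Expr.eval (s : State) : Expr → ℕ
  | .const k => k
  | .var x => s.var x
  | .arr a i => s.arr a (i.eval s)
  | .add e₁ e₂ => e₁.eval s + e₂.eval s
  | .sub e₁ e₂ => e₁.eval s - e₂.eval s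

/-- The number of steps for evaluating an expression: one for each node of its syntax tree. -/
def Expr.cost : Expr → ℕ
  | .const _ => 1
  | .var _ => 1
  | .arr _ i => i.cost + 1
  | .add e₁ e₂ => e₁.cost + e₂.cost + 1
  | .sub e₁ e₂ => e₁.cost + e₂.cost + 1

/-- Programs: do nothing, `x := e`, `a[i] := e`, sequential composition,
`if e ≠ 0 then p else q`, and `while e ≠ 0 do p`. -/
inductive Program where
  | skip
  | assign (x : ℕ) (e : Expr)
  | store (a : ℕ) (i e : Expr)
  | seq (p q : Program)
  | ite (e : Expr) (p q : Program)
  | loop (e : Expr) (p : Program)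

/-- `Runs p s t s'` : started in state `s`, the program `p` halts in state `s'` after exactly
`t` steps. -/
inductive Runs : Program → State → ℕ → State → Prop where
  | skip (s : State) : Runs .skip s 1 s
  | assign (x : ℕ) (e : Expr) (s : State) :
      Runs (.assign x e) s (e.cost + 1) (s.setVar x (e.eval s))
  | store (a : ℕ) (i e : Expr) (s : State) :
      Runs (.store a i e) s (i.cost + e.cost + 1) (s.setArr a (i.eval s) (e.eval s))
  | seq {p q : Program} {s s' s'' : State} {t t' : ℕ} :
      Runs p s t s' → Runs q s' t' s'' → Runs (.seq p q) s (t + t') s''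
  | ite_true {e : Expr} {p q : Program} {s s' : State} {t : ℕ} :
      e.eval s ≠ 0 → Runs p s t s' → Runs (.ite e p q) s (e.cost + 1 + t) s'
  | ite_false {e : Expr} {p q : Program} {s s' : State} {t : ℕ} :
      e.eval s = 0 → Runs q s t s' → Runs (.ite e p q) s (e.cost + 1 + t) s'
  | loop_true {e : Expr} {p : Program} {s s' s'' : State} {t t' : ℕ} :
      e.eval s ≠ 0 → Runs p s t s' → Runs (.loop e p) s' t' s'' →
      Runs (.loop e p) s (e.cost + 1 + t + t') s''
  | loop_false {e : Expr} {p : Program} {s : State} :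
      e.eval s = 0 → Runs (.loop e p) s (e.cost + 1) s

/-! ### Input and output of graph algorithms -/

/-- A finite loopless multigraph with vertices `0, …, n - 1`, given by the list of its `m` edges,
parallel edges being listed separately. -/
structure GraphInput where
  n : ℕ
  m : ℕ
  ends : Fin m → Fin n × Fin n
  loopless : ∀ e, (ends e).1 ≠ (ends e).2

/-- The graph that a `GraphInput` describes. -/
def GraphInput.toGraph (I : GraphInput) : Graph (Fin I.n) (Fin I.m) where
  vertexSet := Set.univ
  edgeSet := Set.univ
  IsLink e x y := I.ends e = (x, y) ∨ I.ends e = (y, x)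
  isLink_symm := fun _ _ => ⟨fun _ _ h => h.symm⟩
  eq_or_eq_of_isLink_of_isLink := by
    intro e x y z w h h'
    rcases h with h | h <;> rcases h' with h' | h' <;> rw [h, Prod.mk.injEq] at h' <;> tauto
  edge_mem_iff_exists_isLink := fun e =>
    ⟨fun _ => ⟨(I.ends e).1, (I.ends e).2, Or.inl rfl⟩, fun _ => Set.mem_univ e⟩
  left_mem_of_isLink := fun _ _ _ _ => Set.mem_univ _

/-- The initial state: scalar registers `0` and `1` hold the numbers of vertices and edges, entry
`e` of the arrays `0` and `1` holds the ends of the edge `e`, and everything else is zero. -/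
def GraphInput.initialState (I : GraphInput) : State where
  var x := if x = 0 then I.n else if x = 1 then I.m else 0
  arr a e := if h : e < I.m then
    (if a = 0 then ((I.ends ⟨e, h⟩).1 : ℕ) else if a = 1 then ((I.ends ⟨e, h⟩).2 : ℕ) else 0)
    else 0

/-- The output of a program: `markedSet I s k` consists of the vertices `i` for which entry `i`
of array `2` is `k`. -/
def GraphInput.markedSet (I : GraphInput) (s : State) (k : ℕ) : Set (Fin I.n) :=
  {i | s.arr 2 i = k}

end Pumpkin

/-!
# Small pumpkin-models in reduced graphs

**Existence.** All that is used about a `c`-reduced multigraph is collected in `IsPumpkinFamily`: in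
terms of the underlying simple graph, a connected set that is separated from the rest by one vertex,
or has at least two elements and is separated by two vertices, includes a `c`-pumpkin-model together
with these vertices (`IsReduced.exists_model`).

The first step is that a connected set `Y` without a `c`-pumpkin-model is bounded in terms of the
number of its vertices with neighbours outside `Y`
(`IsPumpkinFamily.card_le_pieceBound`). The degrees in `Y` are bounded, because every component that
is left by the deletion of a vertex `w` of `Y` reaches the frontier of `Y` and has fewer than `c`
edges to `w`. So if `Y` is large it has a long geodesic, and a long part of it is far from the
frontier in the sense that the components of the rest of `Y` that are attached to it (its bridges)
avoid the frontier. Fewer than `c` bridges pass over any position, and a chain of overlapping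
bridges would split the path into two interleaved connected sets with many edges between them.
Hence there are two positions over which no bridge passes, and the part between
them is an outgrowth without a pumpkin-model (`false_of_long_interval`), which a reduced graph does
not have.

The second step cuts the graph into clusters around disjoint connected cores of a constant size `s`
(`IsPumpkinFamily.exists_small`). If each cluster is adjacent to at least `2 * c + 4` others, then
the graph of clusters contains a vertex with `c` neighbours in a connected set of logarithmic size:
breadth-first search balls cannot keep doubling, and on a ball that does not double there are enough
edges outside the search tree (`exists_star_of_minDegree`). This is lifted back to the graph.
Otherwise some cluster has a bounded frontier; it is then of bounded size, and too large for
a set without a pumpkin-model by the first step. So there is always a model `{A, B}` in which `A`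
has bounded size and `B` has at most logarithmic size (`IsReduced.exists_small_model`).

**Algorithm.** Since `A` has bounded size, it is grown from one vertex by a bounded number of edges,
so all candidates for `A` can be tried. For each of them, and for all choices of a root and of `c`
further vertices, the program searches breadth-first from the root in the graph without `A`, and
takes as the second side the union of the paths in the search tree from the `c` vertices to the
root. If the choice consists of vertices of `B`, among them the ends of `c` edges between `A` and
`B`, then this union has at most `c * |B| + 1` elements. The smallest model that is found is
therefore of logarithmic size (`exists_program`). The program only uses counting loops over ranges
of at most `n + m + 1` numbers, nested to a depth that depends on `c` only, which makes its running
time polynomial (`Code.exists_runs`).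
-/

namespace Pumpkin

/-! ### Connected vertex sets of a finite simple graph -/

section Core

open scoped Classical
open Finset

variable {α : Type u}

/-- Adjacency in the subgraph of `S` induced by the finite set `X`. -/
def AdjIn (S : SimpleGraph α) (X : Finset α) (a b : α) : Prop := a ∈ X ∧ b ∈ X ∧ S.Adj a b

/-- The finite set `X` is non-empty and induces a connected subgraph of `S`. -/
def ConnOn (S : SimpleGraph α) (X : Finset α) : Prop :=
  X.Nonempty ∧ ∀ x ∈ X, ∀ y ∈ X, Relation.ReflTransGen (AdjIn S X) x y

/-- The vertex set of the component of `x` in the subgraph of `S` induced by `X`. -/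
noncomputable def comp (S : SimpleGraph α) (X : Finset α) (x : α) : Finset α :=
  X.filter fun y => Relation.ReflTransGen (AdjIn S X) x y

variable {S : SimpleGraph α} {X Y Z : Finset α} {a b x y z : α}

lemma AdjIn.mono (h : X ⊆ Y) (hab : AdjIn S X a b) : AdjIn S Y a b :=
  ⟨h hab.1, h hab.2.1, hab.2.2⟩

lemma AdjIn.symm (hab : AdjIn S X a b) : AdjIn S X b a := ⟨hab.2.1, hab.1, hab.2.2.symm⟩

lemma reach_mono (h : X ⊆ Y) (hab : Relation.ReflTransGen (AdjIn S X) a b) :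
    Relation.ReflTransGen (AdjIn S Y) a b :=
  Relation.ReflTransGen.mono (fun _ _ => AdjIn.mono h) _ _ hab

lemma reach_symm (hab : Relation.ReflTransGen (AdjIn S X) a b) :
    Relation.ReflTransGen (AdjIn S X) b a := by
  induction hab with
  | refl => exact .refl
  | tail _ h ih => exact .head h.symm ih

lemma connOn_of_root (hz : z ∈ X) (h : ∀ x ∈ X, Relation.ReflTransGen (AdjIn S X) z x) :
    ConnOn S X :=
  ⟨⟨z, hz⟩, fun x hx y hy => (reach_symm (h x hx)).trans (h y hy)⟩

lemma connOn_singleton (x : α) : ConnOn S {x} :=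
  connOn_of_root (mem_singleton_self x) fun y hy => by rw [mem_singleton.1 hy]

lemma ConnOn.union_of_adj (hX : ConnOn S X) (hY : ConnOn S Y) (hx : a ∈ X) (hy : b ∈ Y)
    (hab : S.Adj a b) : ConnOn S (X ∪ Y) := by
  have hab' : Relation.ReflTransGen (AdjIn S (X ∪ Y)) a b :=
    .single ⟨mem_union_left _ hx, mem_union_right _ hy, hab⟩
  refine connOn_of_root (z := a) (mem_union_left _ hx) fun w hw => ?_
  rcases mem_union.1 hw with hw | hw
  · exact reach_mono subset_union_left (hX.2 a hx w hw)
  · exact hab'.trans (reach_mono subset_union_right (hY.2 b hy w hw))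

lemma ConnOn.insert_of_adj (hX : ConnOn S X) (hx : a ∈ X) (hab : S.Adj a b) :
    ConnOn S (insert b X) := by
  have := hX.union_of_adj (connOn_singleton b) hx (mem_singleton_self b) hab
  rwa [union_comm, ← insert_eq] at this

/-- A union of connected sets, each of which meets or is joined to a connected set `X`. -/
lemma ConnOn.union_biUnion {ι : Type*} (hX : ConnOn S X) (I : Finset ι) (f : ι → Finset α)
    (h : ∀ i ∈ I, ConnOn S (X ∪ f i)) : ConnOn S (X ∪ I.biUnion f) := by
  obtain ⟨z, hz⟩ := hX.1
  refine connOn_of_root (z := z) (mem_union_left _ hz) fun w hw => ?_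
  rcases mem_union.1 hw with hw | hw
  · exact reach_mono subset_union_left (hX.2 z hz w hw)
  · obtain ⟨i, hi, hw⟩ := mem_biUnion.1 hw
    refine reach_mono ?_ ((h i hi).2 z (mem_union_left _ hz) w (mem_union_right _ hw))
    exact union_subset_union_right (subset_biUnion_of_mem f hi)

/-- A proper non-empty subset of a connected set is left by an edge. -/
lemma ConnOn.exists_adj_of_ssubset (hX : ConnOn S X) (hZ : Z.Nonempty) (hZX : Z ⊆ X)
    (hne : Z ≠ X) : ∃ a ∈ Z, ∃ b ∈ X, b ∉ Z ∧ S.Adj a b := by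
  obtain ⟨z, hz⟩ := hZ
  obtain ⟨w, hw, hwZ⟩ : ∃ w ∈ X, w ∉ Z := by
    by_contra! h
    exact hne (subset_antisymm hZX h)
  by_contra! h
  have : ∀ y, Relation.ReflTransGen (AdjIn S X) z y → y ∈ Z := by
    intro y hy
    induction hy with
    | refl => exact hz
    | @tail b c _ hbc ih =>
      by_contra hc
      exact h b ih c hbc.2.1 hc hbc.2.2
  exact hwZ (this w (hX.2 z (hZX hz) w hw))

/-- A property of connected subsets of a connected set that is inherited when a vertex is added
holds for some connected subset of every possible size. -/
lemma ConnOn.exists_subset_card (hX : ConnOn S X) {p : Finset α → Prop}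
    (h₁ : ∀ x ∈ X, p {x})
    (h₂ : ∀ Z ⊆ X, ConnOn S Z → p Z → ∀ a ∈ Z, ∀ b ∈ X, b ∉ Z → S.Adj a b → p (insert b Z))
    {m : ℕ} (hm : 1 ≤ m) (hmX : m ≤ X.card) :
    ∃ Z ⊆ X, ConnOn S Z ∧ Z.card = m ∧ p Z := by
  induction m, hm using Nat.le_induction with
  | base =>
    obtain ⟨x, hx⟩ := hX.1
    exact ⟨{x}, by simpa using hx, connOn_singleton x, by simp, h₁ x hx⟩
  | succ m hm ih =>
    obtain ⟨Z, hZX, hZ, hc, hp⟩ := ih (by omega)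
    obtain ⟨a, ha, b, hb, hbZ, hab⟩ := hX.exists_adj_of_ssubset hZ.1 hZX (by rintro rfl; omega)
    exact ⟨insert b Z, insert_subset hb hZX, hZ.insert_of_adj ha hab,
      by rw [card_insert_of_notMem hbZ, hc], h₂ Z hZX hZ hp a ha b hb hbZ hab⟩

lemma comp_subset : comp S X x ⊆ X := filter_subset _ _

lemma mem_comp_self (hx : x ∈ X) : x ∈ comp S X x := mem_filter.2 ⟨hx, .refl⟩

lemma mem_comp_of_adj (hy : y ∈ comp S X x) (hz : z ∈ X) (hyz : S.Adj y z) :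
    z ∈ comp S X x := by
  rw [comp, mem_filter] at *
  exact ⟨hz, hy.2.tail ⟨hy.1, hz, hyz⟩⟩

lemma connOn_comp (hx : x ∈ X) : ConnOn S (comp S X x) := by
  refine connOn_of_root (mem_comp_self hx) fun y hy => ?_
  have hy' := (mem_filter.1 hy).2
  clear hy
  induction hy' with
  | refl => exact .refl
  | @tail b c hb hbc ih =>
    exact ih.tail ⟨mem_filter.2 ⟨hbc.1, hb⟩, mem_filter.2 ⟨hbc.2.1, hb.tail hbc⟩, hbc.2.2⟩

lemma comp_eq_of_mem (hy : y ∈ comp S X x) : comp S X y = comp S X x := by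
  have h := (mem_filter.1 hy).2
  ext z
  simp only [comp, mem_filter, and_congr_right_iff]
  exact fun _ => ⟨fun hz => h.trans hz, fun hz => (reach_symm h).trans hz⟩

lemma comp_disjoint (h : comp S X x ≠ comp S X y) : Disjoint (comp S X x) (comp S X y) :=
  disjoint_left.2 fun _ hx hy => h ((comp_eq_of_mem hx).symm.trans (comp_eq_of_mem hy))

/-! ### Breadth-first search -/

/-- The ball of radius `r` around `v` in the subgraph of `S` induced by `Y`. -/
noncomputable def ball (S : SimpleGraph α) (Y : Finset α) (v : α) : ℕ → Finset α
  | 0 => {v}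
  | r + 1 => ball S Y v r ∪ Y.filter fun y => ∃ x ∈ ball S Y v r, S.Adj x y

/-- `y` has distance exactly `r` from `v` in the subgraph of `S` induced by `Y`. -/
def IsLevel (S : SimpleGraph α) (Y : Finset α) (v : α) (r : ℕ) (y : α) : Prop :=
  y ∈ ball S Y v r ∧ ∀ j < r, y ∉ ball S Y v j

variable {v : α} {r r' : ℕ}

lemma ball_subset_succ : ball S Y v r ⊆ ball S Y v (r + 1) := subset_union_left

lemma ball_mono (h : r ≤ r') : ball S Y v r ⊆ ball S Y v r' := by
  induction r', h using Nat.le_induction with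
  | base => exact subset_rfl
  | succ n _ ih => exact ih.trans ball_subset_succ

lemma ball_subset (hv : v ∈ Y) : ball S Y v r ⊆ Y := by
  induction r with
  | zero => simpa [ball] using hv
  | succ n ih => exact union_subset ih (filter_subset _ _)

lemma mem_ball_self : v ∈ ball S Y v r := ball_mono (Nat.zero_le r) (by simp [ball])

lemma mem_ball_of_adj (hx : x ∈ ball S Y v r) (hy : y ∈ Y) (hxy : S.Adj x y) :
    y ∈ ball S Y v (r + 1) :=
  mem_union_right _ (mem_filter.2 ⟨hy, x, hx, hxy⟩)

lemma exists_isLevel (hy : y ∈ ball S Y v r) : ∃ j ≤ r, IsLevel S Y v j y := by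
  have h : ∃ j, y ∈ ball S Y v j := ⟨r, hy⟩
  exact ⟨Nat.find h, Nat.find_min' h hy, Nat.find_spec h, fun j hj => Nat.find_min h hj⟩

lemma IsLevel.unique (h : IsLevel S Y v r y) (h' : IsLevel S Y v r' y) : r = r' := by
  by_contra hne
  rcases Nat.lt_or_gt_of_ne hne with hlt | hlt
  · exact h'.2 _ hlt h.1
  · exact h.2 _ hlt h'.1

lemma IsLevel.le_of_mem (h : IsLevel S Y v r y) (hy : y ∈ ball S Y v r') : r ≤ r' := by
  by_contra hlt
  exact h.2 r' (by omega) hy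

lemma IsLevel.le_succ_of_adj (h : IsLevel S Y v r y) (h' : IsLevel S Y v r' x) (hy : y ∈ Y)
    (hxy : S.Adj x y) : r ≤ r' + 1 :=
  h.le_of_mem (mem_ball_of_adj h'.1 hy hxy)

lemma IsLevel.eq_of_zero (h : IsLevel S Y v 0 y) : y = v := by simpa [ball] using h.1

/-- A vertex of level `r + 1` has a neighbour of level `r`. -/
lemma IsLevel.exists_pred (h : IsLevel S Y v (r + 1) y) :
    ∃ x, IsLevel S Y v r x ∧ S.Adj x y := by
  have hy := h.1
  rw [ball, mem_union] at hy
  rcases hy with hy | hy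
  · exact absurd hy (h.2 r (Nat.lt_succ_self r))
  · obtain ⟨hyY, x, hx, hxy⟩ := mem_filter.1 hy
    refine ⟨x, ⟨hx, fun j hj hxj => ?_⟩, hxy⟩
    exact h.2 (j + 1) (by omega) (mem_ball_of_adj hxj hyY hxy)

/-- The parent of `y` in a breadth-first search tree rooted at `v`. -/
noncomputable def parent (S : SimpleGraph α) (Y : Finset α) (v y : α) : α :=
  if h : ∃ x r, IsLevel S Y v (r + 1) y ∧ IsLevel S Y v r x ∧ S.Adj x y then h.choose else y

lemma IsLevel.parent (h : IsLevel S Y v (r + 1) y) :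
    IsLevel S Y v r (parent S Y v y) ∧ S.Adj (parent S Y v y) y := by
  have hex : ∃ x r, IsLevel S Y v (r + 1) y ∧ IsLevel S Y v r x ∧ S.Adj x y := by
    obtain ⟨x, hx⟩ := h.exists_pred
    exact ⟨x, r, h, hx⟩
  have hp : Pumpkin.parent S Y v y = hex.choose := dif_pos hex
  obtain ⟨r', h₁, h₂, h₃⟩ := hex.choose_spec
  rw [← hp] at h₂ h₃
  have := h₁.unique h
  exact ⟨by rwa [show r' = r by omega] at h₂, h₃⟩

/-- The path from the root `v` to `y` in the breadth-first search tree. Apart from `y` and its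
parent, its vertices lie at least two levels below `y`. -/
lemma IsLevel.exists_root_path (hv : v ∈ Y) (h : IsLevel S Y v r y) :
    ∃ C ⊆ Y, y ∈ C ∧ v ∈ C ∧ ConnOn S C ∧ C.card ≤ r + 1 ∧
      ∀ z ∈ C, z = y ∨ z = Pumpkin.parent S Y v y ∨ ∃ j, j + 1 < r ∧ IsLevel S Y v j z := by
  induction r generalizing y with
  | zero =>
    obtain rfl := h.eq_of_zero
    exact ⟨{y}, by simpa using hv, by simp, by simp, connOn_singleton y, by simp, by simp⟩
  | succ r ih =>
    obtain ⟨hp, hadj⟩ := h.parent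
    obtain ⟨C, hCY, hyC, hvC, hC, hcard, hlev⟩ := ih hp
    refine ⟨insert y C, insert_subset (ball_subset hv h.1) hCY, mem_insert_self _ _,
      mem_insert_of_mem hvC, hC.insert_of_adj hyC hadj,
      (card_insert_le _ _).trans (by omega), fun z hz => ?_⟩
    rcases mem_insert.1 hz with rfl | hz
    · exact .inl rfl
    · rcases hlev z hz with rfl | rfl | ⟨j, hj, hz⟩
      · exact .inr (.inl rfl)
      · cases r with
        | zero =>
          -- the root has no parent: the junk value of `parent` is the root itself
          obtain hv' := hp.eq_of_zero
          refine .inr (.inl ?_)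
          rw [Pumpkin.parent, dif_neg]
          rintro ⟨x, r', hr', -⟩
          exact absurd (hr'.unique hp) (by omega)
        | succ r => exact .inr (.inr ⟨r, by omega, hp.parent.1⟩)
      · exact .inr (.inr ⟨j, by omega, hz⟩)

/-- A vertex of level `r` is the end of a geodesic from the root. -/
lemma IsLevel.exists_geodesic (h : IsLevel S Y v r y) :
    ∃ p : ℕ → α, p r = y ∧ (∀ i ≤ r, IsLevel S Y v i (p i)) ∧
      ∀ i < r, S.Adj (p i) (p (i + 1)) := by
  induction r generalizing y with
  | zero => exact ⟨fun _ => y, rfl, fun i hi => by rwa [Nat.le_zero.1 hi], fun i hi => by omega⟩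
  | succ r ih =>
    obtain ⟨x, hx, hxy⟩ := h.exists_pred
    obtain ⟨p, rfl, hp, hadj⟩ := ih hx
    refine ⟨fun i => if i = r + 1 then y else p i, by simp, fun i hi => ?_, fun i hi => ?_⟩
    · by_cases h₁ : i = r + 1
      · subst h₁; simpa using h
      · simpa [h₁] using hp i (by omega)
    · by_cases h₁ : i = r
      · subst h₁; simpa using hxy
      · simpa [h₁, show i ≠ r + 1 by omega] using hadj i (by omega)

end Core

section Core

open scoped Classical
open Finset

/-! ### Dense graphs -/

/-- Some ball of radius at most `log₂ N` at most doubles when its radius is increased by one. -/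
lemma exists_ball_card_le {ι : Type u} [Fintype ι] (Q : SimpleGraph ι) (v : ι) :
    ∃ r ≤ Nat.log 2 (Fintype.card ι),
      (ball Q univ v (r + 1)).card ≤ 2 * (ball Q univ v r).card := by
  by_contra! h
  have hpow : ∀ r ≤ Nat.log 2 (Fintype.card ι) + 1, 2 ^ r ≤ (ball Q univ v r).card := by
    intro r
    induction r with
    | zero => intro _; simp [ball]
    | succ r ih =>
      intro hr
      have h₁ := ih (by omega)
      have h₂ := h r (by omega)
      rw [pow_succ]
      omega
  have h₁ := (hpow _ le_rfl).trans (card_le_univ _)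
  exact absurd h₁ (not_le.2 (Nat.lt_pow_succ_log_self (by norm_num) _))

/-- In a graph of minimum degree at least `2c + 4` some vertex `x` has `c` neighbours in a
connected set of logarithmic size that avoids `x`. Such an `x` is found in a ball whose radius is
logarithmic and on which the average degree is still at least `c + 2`: there some vertex `x` is on
`c` edges that are not in the breadth-first search tree, and the tree paths from the root to the
other ends of these edges avoid `x`. -/
lemma exists_star_of_minDegree {ι : Type u} [Fintype ι] [Nonempty ι] (Q : SimpleGraph ι) {c : ℕ}
    (hc : 1 ≤ c) (hdeg : ∀ x, 2 * c + 4 ≤ (univ.filter fun y => Q.Adj x y).card) :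
    ∃ x T, x ∉ T ∧ ConnOn Q T ∧ T.card ≤ c * (Nat.log 2 (Fintype.card ι) + 2) ∧
      c ≤ (T.filter fun y => Q.Adj x y).card := by
  obtain ⟨v⟩ := ‹Nonempty ι›
  obtain ⟨r, hr, hball⟩ := exists_ball_card_le Q v
  set B := ball Q univ v (r + 1) with hB
  have hBpos : 0 < B.card := card_pos.2 ⟨v, mem_ball_self⟩
  set par := parent Q univ v with hpar
  obtain ⟨x, hx, hxc⟩ : ∃ x ∈ B, c ≤ (B.filter fun y => Q.Adj x y ∧ y ≠ par x ∧ par y ≠ x).card := by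
    by_contra! h
    have hlow : (2 * c + 4) * (ball Q univ v r).card ≤
        ∑ x ∈ B, (B.filter fun y => Q.Adj x y).card := by
      calc (2 * c + 4) * (ball Q univ v r).card
          = ∑ x ∈ ball Q univ v r, (2 * c + 4) := by rw [sum_const, smul_eq_mul, mul_comm]
        _ ≤ ∑ x ∈ ball Q univ v r, (B.filter fun y => Q.Adj x y).card := by
            refine sum_le_sum fun x hx => (hdeg x).trans (card_le_card fun y hy => ?_)
            have hxy := (mem_filter.1 hy).2
            exact mem_filter.2 ⟨mem_ball_of_adj hx (mem_univ y) hxy, hxy⟩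
        _ ≤ _ := sum_le_sum_of_subset ball_subset_succ
    have hup : ∀ x ∈ B, (B.filter fun y => Q.Adj x y).card ≤
        c + (B.filter fun y => par y = x).card := by
      intro x hx
      have hsub : (B.filter fun y => Q.Adj x y) ⊆
          (B.filter fun y => Q.Adj x y ∧ y ≠ par x ∧ par y ≠ x) ∪
            ({par x} ∪ B.filter fun y => par y = x) := by
        intro y hy
        simp only [mem_union, mem_filter, mem_singleton] at hy ⊢
        tauto
      have h₁ := (card_le_card hsub).trans (card_union_le _ _)
      have h₂ := card_union_le {par x} (B.filter fun y => par y = x)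
      have h₃ := h x hx
      rw [card_singleton] at h₂
      omega
    have hfib : ∑ x ∈ B, (B.filter fun y => par y = x).card ≤ B.card := by
      rw [← card_biUnion]
      · exact card_le_card (biUnion_subset.2 fun x _ => filter_subset _ _)
      · intro a _ b _ hab
        refine disjoint_left.2 fun y hy hy' => hab ?_
        rw [← (mem_filter.1 hy).2, (mem_filter.1 hy').2]
    have hsum := hlow.trans (sum_le_sum hup)
    rw [sum_add_distrib, sum_const, smul_eq_mul] at hsum
    nlinarith
  obtain ⟨J, hJ, hJc⟩ := exists_subset_card_eq hxc
  have hpath : ∀ y ∈ J, ∃ C : Finset ι, y ∈ C ∧ v ∈ C ∧ ConnOn Q C ∧ C.card ≤ r + 2 ∧ x ∉ C := by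
    intro y hy
    obtain ⟨hyB, hxy, hy₁, hy₂⟩ := mem_filter.1 (hJ hy)
    obtain ⟨j, hj, hlev⟩ := exists_isLevel hyB
    obtain ⟨i, hi, hlevx⟩ := exists_isLevel hx
    obtain ⟨C, -, hyC, hvC, hC, hcard, hz⟩ := hlev.exists_root_path (mem_univ v)
    refine ⟨C, hyC, hvC, hC, by omega, fun hxC => ?_⟩
    rcases hz x hxC with h | h | ⟨k, hk, h⟩
    · exact hxy.ne h
    · exact hy₂ h.symm
    · have := hlev.le_succ_of_adj hlevx (mem_univ y) hxy
      have := hlevx.unique h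
      omega
  choose! C hyC hvC hC hcard hxC using hpath
  have hJne : J.Nonempty := card_pos.1 (by omega)
  refine ⟨x, J.biUnion C, ?_, ?_, ?_, ?_⟩
  · simp only [mem_biUnion, not_exists, not_and]
    exact hxC
  · obtain ⟨y, hy⟩ := hJne
    refine connOn_of_root (z := v) (mem_biUnion.2 ⟨y, hy, hvC y hy⟩) fun w hw => ?_
    obtain ⟨y, hy, hw⟩ := mem_biUnion.1 hw
    exact reach_mono (subset_biUnion_of_mem C hy) ((hC y hy).2 v (hvC y hy) w hw)
  · refine (card_biUnion_le_card_mul J C (r + 2) hcard).trans ?_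
    rw [hJc]
    exact Nat.mul_le_mul_left _ (by omega)
  · rw [← hJc]
    exact card_le_card fun y hy => mem_filter.2
      ⟨mem_biUnion.2 ⟨y, hy, hyC y hy⟩, (mem_filter.1 (hJ hy)).2.1⟩

/-! ### Paths with bridging components -/

/-- The length of an interval that suffices for finding another bridge, when a bridge without
attachments inside an interval of length `L` is known not to exist. -/
def bridgeStep (c L : ℕ) : ℕ := (2 * c + 8) * (c * L + 1) + 10

/-- Let bridges be attached to the positions of a path, fewer than `c` times each. If fewer than
`c` bridges pass over a gap (`hgap`), and there is no sequence of `c + 1` overlapping bridges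
(`hrail`), then a long interval contains `x` and `y` such that no bridge is attached both strictly
between `x` and `y` and outside the interval from `x` to `y` (`hsep`). -/
lemma false_of_long_interval {κ : Type u} {att : κ → ℕ → Prop} {c : ℕ} {lo hi : ℕ}
    (hfew : ∀ K, ∀ I : Finset ℕ, (∀ i ∈ I, att K i) → I.card < c)
    (hgap : ∀ t, ∀ D : Finset κ, (∀ K ∈ D, (∃ i ≤ t, att K i) ∧ ∃ i, t < i ∧ att K i) → D.card < c)
    (hrail : ∀ (r : ℕ → ℕ) (K : ℕ → κ), lo < r 0 → r (c + 1) < hi → (∀ i ≤ c, r i < r (i + 1)) →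
      (∀ i, 1 ≤ i → i ≤ c → att (K i) (r (i + 1)) ∧
        ∃ l, r (i - 1) ≤ l ∧ l < r i ∧ att (K i) l) →
      (∀ i j, 1 ≤ i → i < j → j ≤ c → K i ≠ K j) → False)
    (hsep : ∀ x y, lo ≤ x → x + 3 ≤ y → y ≤ hi →
      ∃ K, (∃ i, x < i ∧ i < y ∧ att K i) ∧ ∃ j, (j < x ∨ y < j) ∧ att K j)
    (hlong : lo + (bridgeStep c)^[c] 1 ≤ hi) : False := by
  -- on every interval that is long enough, `c - e` bridges pass over it without being attached
  -- inside; a further such bridge is found on a subinterval until there are `c` of them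
  suffices h : ∀ e, ∀ x₀ y₀ : ℕ, lo ≤ x₀ → x₀ + (bridgeStep c)^[e] 1 ≤ y₀ → y₀ ≤ hi →
      ∀ D : Finset κ, D.card + e = c → (∀ K ∈ D, (∃ i ≤ x₀, att K i) ∧ (∃ i, y₀ ≤ i ∧ att K i) ∧
        ∀ i, x₀ < i → i < y₀ → ¬ att K i) → False by
    exact h c lo hi le_rfl hlong le_rfl ∅ (by simp) (by simp)
  intro e
  induction e with
  | zero =>
    intro x₀ y₀ _ hxy _ D hD hspan
    have hxy' : x₀ + 1 ≤ y₀ := hxy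
    refine absurd (hgap x₀ D fun K hK => ?_) (by omega)
    obtain ⟨h₁, ⟨i, hi, h₂⟩, -⟩ := hspan K hK
    exact ⟨h₁, i, by omega, h₂⟩
  | succ e ih =>
    intro x₀ y₀ hlo hxy hhi D hD hspan
    rw [Function.iterate_succ_apply'] at hxy
    set L := (bridgeStep c)^[e] 1 with hL
    clear_value L
    have hinside : ∀ K, (∃ i, x₀ < i ∧ i < y₀ ∧ att K i) → ∀ x y, x₀ ≤ x → x + L ≤ y → y ≤ y₀ →
        (∃ i ≤ x, att K i) → (∃ i, y ≤ i ∧ att K i) → ∃ i, x < i ∧ i < y ∧ att K i := by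
      rintro K ⟨i₀, hi₀, hi₀', hatt⟩ x y hx hxy' hy h₁ h₂
      by_contra! hno
      have hKD : K ∉ D := fun hK => (hspan K hK).2.2 i₀ hi₀ hi₀' hatt
      refine ih x y (by omega) hxy' (by omega) (insert K D)
        (by rw [card_insert_of_notMem hKD]; omega) fun K' hK' => ?_
      rcases mem_insert.1 hK' with rfl | hK'
      · exact ⟨h₁, h₂, hno⟩
      · obtain ⟨⟨i, hi, hi'⟩, ⟨j, hj, hj'⟩, hn⟩ := hspan K' hK'
        exact ⟨⟨i, by omega, hi'⟩, ⟨j, by omega, hj'⟩, fun k hk hk' => hn k (by omega) (by omega)⟩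
    -- hence a bridge has no attachments far to the right of another one
    have hshort : ∀ K, (∃ i, x₀ < i ∧ i < y₀ ∧ att K i) → ∀ t, x₀ ≤ t → t + c * L ≤ y₀ →
        (∃ i ≤ t, att K i) → ∀ i, att K i → i < t + c * L := by
      intro K hK t ht hty h₁ r hr
      by_contra! hle
      have hwin : ∀ j < c, ∃ i, t + j * L < i ∧ i < t + (j + 1) * L ∧ att K i := by
        intro j hj
        have hjc : (j + 1) * L ≤ c * L := Nat.mul_le_mul_right _ hj
        obtain ⟨i, hi, hi'⟩ := h₁
        exact hinside K hK (t + j * L) (t + (j + 1) * L) (by omega) (by rw [add_mul]; omega)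
          (by omega) ⟨i, by omega, hi'⟩ ⟨r, by omega, hr⟩
      choose! f hf₁ hf₂ hf₃ using hwin
      have hinj : Set.InjOn f (range c : Set ℕ) := by
        have hlt : ∀ j j', j < j' → j' < c → f j < f j' := by
          intro j j' hjj' hj'
          have h₁ := hf₂ j (by omega)
          have h₂ := hf₁ j' hj'
          have h₃ : (j + 1) * L ≤ j' * L := Nat.mul_le_mul_right _ hjj'
          omega
        intro j hj j' hj' hjj
        simp only [coe_range, Set.mem_Iio] at hj hj'
        by_contra hne
        rcases Nat.lt_or_gt_of_ne hne with h | h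
        · exact absurd hjj (hlt j j' h hj').ne
        · exact absurd hjj (hlt j' j h hj).ne'
      refine absurd (hfew K ((range c).image f) ?_) ?_
      · intro i hi
        obtain ⟨j, hj, rfl⟩ := mem_image.1 hi
        exact hf₃ j (mem_range.1 hj)
      · rw [card_image_of_injOn hinj, card_range]
        omega
    set q := c * L + 1 with hq
    have hstep : bridgeStep c L = (2 * c + 8) * q + 10 := rfl
    rw [hstep] at hxy
    -- a window of length `(c + 2) * q` contains a position that no bridge passes over
    have hcut : ∀ x₁, x₀ < x₁ → x₁ + (c + 2) * q < y₀ → ∃ t, x₁ ≤ t ∧ t ≤ x₁ + (c + 2) * q ∧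
        ∀ K, (∃ i, x₀ < i ∧ i < y₀ ∧ att K i) → (∃ i < t, att K i) →
          (∃ i, t < i ∧ att K i) → False := by
      intro x₁ hx₁ hx₁'
      by_contra! hun
      have : Nonempty κ := ⟨(hun x₁ le_rfl (by omega)).choose⟩
      have hnext : ∀ t, x₁ ≤ t → t ≤ x₁ + (c + 1) * q → ∃ K e, t < e ∧ e ≤ t + q ∧ att K e ∧
          (∃ i < t, att K i) ∧
          (∀ K', (∃ i, x₀ < i ∧ i < y₀ ∧ att K' i) → (∃ i < t, att K' i) →
            (∃ i, t < i ∧ att K' i) → ∀ i, att K' i → i ≤ e) ∧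
          ∃ i, x₀ < i ∧ i < y₀ ∧ att K i := by
        intro t ht ht'
        have hmul : (c + 2) * q = (c + 1) * q + q := by ring
        obtain ⟨K, hK, hK₁, ⟨k, hk, hKk⟩, -⟩ := hun t ht (by omega)
        let p : ℕ → Prop := fun e => ∃ K, (∃ i, x₀ < i ∧ i < y₀ ∧ att K i) ∧ (∃ i < t, att K i) ∧
          (∃ i, t < i ∧ att K i) ∧ att K e
        have hbound : ∀ K, (∃ i, x₀ < i ∧ i < y₀ ∧ att K i) → (∃ i < t, att K i) →
            ∀ i, att K i → i ≤ t + q := by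
          rintro K hK ⟨j, hj, hj'⟩ i hi
          have := hshort K hK t (by omega) (by omega) ⟨j, by omega, hj'⟩ i hi
          omega
        have hpk : p k := ⟨K, hK, hK₁, ⟨k, hk, hKk⟩, hKk⟩
        have hspec : p (Nat.findGreatest p (t + q)) :=
          Nat.findGreatest_spec (hbound K hK hK₁ k hKk) hpk
        obtain ⟨K', hK', hl, hr, hatt⟩ := hspec
        refine ⟨K', _, ?_, hbound K' hK' hl _ hatt, hatt, hl, fun K'' h₁ h₂ h₃ i hi => ?_, hK'⟩
        · exact lt_of_lt_of_le hk (Nat.le_findGreatest (hbound K hK hK₁ k hKk) hpk)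
        · exact Nat.le_findGreatest (hbound K'' h₁ h₂ i hi) ⟨K'', h₁, h₂, h₃, hi⟩
      choose! K e he₁ he₂ he₃ he₄ he₅ he₆ using hnext
      have hr : ∀ i, i ≤ c + 1 → x₁ ≤ e^[i] x₁ ∧ e^[i] x₁ ≤ x₁ + i * q := by
        intro i
        induction i with
        | zero => simp
        | succ i ihi =>
          intro hi
          obtain ⟨h₁, h₂⟩ := ihi (by omega)
          have h₃ : i * q ≤ (c + 1) * q := Nat.mul_le_mul_right _ (by omega)
          have h₄ := he₁ (e^[i] x₁) h₁ (by omega)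
          have h₅ := he₂ (e^[i] x₁) h₁ (by omega)
          rw [Function.iterate_succ_apply', add_mul]
          omega
      have hr' : ∀ i, i ≤ c + 1 → x₁ ≤ e^[i] x₁ ∧ e^[i] x₁ ≤ x₁ + (c + 1) * q := by
        intro i hi
        have h₃ : i * q ≤ (c + 1) * q := Nat.mul_le_mul_right _ (by omega)
        have := hr i hi
        omega
      have hlt : ∀ i, i ≤ c + 1 → e^[i] x₁ < e^[i + 1] x₁ := by
        intro i hi
        rw [Function.iterate_succ_apply']
        exact he₁ _ (hr' i hi).1 (hr' i hi).2
      have hlt' : ∀ i j, i < j → j ≤ c + 2 → e^[i] x₁ < e^[j] x₁ := by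
        intro i j hij
        induction j, hij using Nat.le_induction with
        | base => intro h; exact hlt i (by omega)
        | succ j hij ihj => intro h; exact (ihj (by omega)).trans (hlt j (by omega))
      have hmul : (c + 2) * q = (c + 1) * q + q := by ring
      refine hrail (fun i => e^[i] x₁) (fun i => K (e^[i] x₁)) (by simp; omega)
        (by have := (hr' (c + 1) le_rfl).2; omega) (fun i hi => hlt i (by omega))
        (fun i hi hic => ?_) (fun i j hi hij hj hK => ?_)
      · have hri := hr' i (by omega)
        simp only [Function.iterate_succ_apply']
        refine ⟨he₃ _ hri.1 hri.2, ?_⟩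
        obtain ⟨l, hl, hatt⟩ := he₄ _ hri.1 hri.2
        refine ⟨l, ?_, hl, hatt⟩
        by_contra! hlt''
        have hrp := hr' (i - 1) (by omega)
        have h₁ := hlt' (i - 1) i (by omega) (by omega)
        have h₂ := he₁ _ hri.1 hri.2
        have h₃ := he₅ _ hrp.1 hrp.2 _ (he₆ _ hri.1 hri.2) ⟨l, hlt'', hatt⟩
          ⟨_, h₁.trans h₂, he₃ _ hri.1 hri.2⟩ _ (he₃ _ hri.1 hri.2)
        rw [← Function.iterate_succ_apply' e (i - 1), show (i - 1).succ = i by omega] at h₃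
        omega
      · have hri := hr' i (by omega)
        have hrj := hr' j (by omega)
        have h₁ := he₃ _ hrj.1 hrj.2
        rw [← hK] at h₁
        have h₂ := he₅ _ hri.1 hri.2 _ (he₆ _ hri.1 hri.2) (he₄ _ hri.1 hri.2)
          ⟨_, he₁ _ hri.1 hri.2, he₃ _ hri.1 hri.2⟩ _ h₁
        simp only [← Function.iterate_succ_apply' e] at h₂
        have h₃ := hlt' (i + 1) (j + 1) (by omega) (by omega)
        simp only [Nat.succ_eq_add_one] at h₂
        omega
    have hmul : (2 * c + 8) * q = 2 * ((c + 2) * q) + 4 * q := by ring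
    obtain ⟨t, ht₁, ht₂, ht⟩ := hcut (x₀ + 1) (by omega) (by omega)
    obtain ⟨t', ht₁', ht₂', ht'⟩ := hcut (x₀ + 1 + (c + 2) * q + 3) (by omega) (by omega)
    obtain ⟨K, ⟨i, hi₁, hi₂, hi⟩, j, hj, hatt⟩ := hsep t t' (by omega) (by omega) (by omega)
    have hK : ∃ i, x₀ < i ∧ i < y₀ ∧ att K i := ⟨i, by omega, by omega, hi⟩
    rcases hj with hj | hj
    · exact ht K hK ⟨j, hj, hatt⟩ ⟨i, hi₁, hi⟩
    · exact ht' K hK ⟨i, hi₂, hi⟩ ⟨j, hj, hatt⟩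

end Core

section Core

open scoped Classical
open Finset

variable {α : Type u} {S : SimpleGraph α} {c : ℕ} {P : Finset α → Prop}

/-! ### Pumpkin-free pieces of reduced graphs -/

/-- A `c`-pumpkin-model of a simple graph: two disjoint connected sets with at least `c` adjacent
pairs of vertices between them. -/
structure IsSimplePumpkin (S : SimpleGraph α) (c : ℕ) (A B : Finset α) : Prop where
  disjoint : Disjoint A B
  left_conn : ConnOn S A
  right_conn : ConnOn S B
  exists_edges : ∃ E : Finset (α × α), c ≤ E.card ∧ ∀ e ∈ E, e.1 ∈ A ∧ e.2 ∈ B ∧ S.Adj e.1 e.2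

/-- What is used about the family `P` of those vertex sets of a `c`-reduced multigraph, with
underlying simple graph `S`, that include a `c`-pumpkin-model. The last condition says that neither
reduction rule applies: a connected set that is separated from the rest by one vertex, or has at
least two elements and is separated by two vertices, includes a `c`-pumpkin-model together with
these vertices. -/
structure IsPumpkinFamily (S : SimpleGraph α) (c : ℕ) (P : Finset α → Prop) : Prop where
  mono : ∀ {X Y}, P X → X ⊆ Y → P Y
  of_pumpkin : ∀ {A B}, IsSimplePumpkin S c A B → P (A ∪ B)
  of_separation : ∀ {W : Finset α} {u v : α}, ConnOn S W →
    (∀ w ∈ W, ∀ y, S.Adj w y → y ∈ W ∨ y = u ∨ y = v) → (u = v ∨ 2 ≤ W.card) → P (W ∪ {u, v})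

/-- The vertices of `Y` that have a neighbour outside `Y`. -/
noncomputable def frontier (S : SimpleGraph α) (Y : Finset α) : Finset α :=
  Y.filter fun y => ∃ z, z ∉ Y ∧ S.Adj y z

lemma mem_frontier {Y : Finset α} {y : α} :
    y ∈ frontier S Y ↔ y ∈ Y ∧ ∃ z, z ∉ Y ∧ S.Adj y z := mem_filter

lemma mem_of_adj_of_notMem_frontier {Y : Finset α} {y z : α} (hy : y ∈ Y)
    (hf : y ∉ frontier S Y) (h : S.Adj y z) : z ∈ Y := by
  by_contra hz
  exact hf (mem_filter.2 ⟨hy, z, hz, h⟩)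

/-- An indexed version of `IsSimplePumpkin`. -/
lemma isSimplePumpkin_of_injOn {ι : Type*} {A B : Finset α} (hAB : Disjoint A B)
    (hA : ConnOn S A) (hB : ConnOn S B) (I : Finset ι) (hI : c ≤ I.card) (f g : ι → α)
    (hinj : Set.InjOn (fun i => (f i, g i)) (I : Set ι))
    (h : ∀ i ∈ I, f i ∈ A ∧ g i ∈ B ∧ S.Adj (f i) (g i)) : IsSimplePumpkin S c A B := by
  refine ⟨hAB, hA, hB, I.image fun i => (f i, g i), ?_, fun e he => ?_⟩
  · rwa [card_image_of_injOn hinj]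
  · obtain ⟨i, hi, rfl⟩ := mem_image.1 he
    exact h i hi

variable (hP : IsPumpkinFamily S c P) {Y : Finset α} {k : ℕ}

include hP

/-- Every component left by the deletion of a vertex `w` of `Y` contains a vertex of the frontier,
and has fewer than `c` edges to `w`. -/
lemma IsPumpkinFamily.degree_le (hPY : ¬ P Y) (hk : (frontier S Y).card ≤ k) {w : α}
    (hw : w ∈ Y) : (Y.filter fun y => S.Adj w y).card ≤ k * c := by
  have hsub : (Y.filter fun y => S.Adj w y) ⊆ ((frontier S Y).erase w).biUnion fun z =>
      (comp S (Y.erase w) z).filter fun y => S.Adj w y := by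
    intro y hy
    obtain ⟨hyY, hwy⟩ := mem_filter.1 hy
    have hyX : y ∈ Y.erase w := mem_erase.2 ⟨hwy.ne', hyY⟩
    obtain ⟨z, hz, hzf⟩ : ∃ z ∈ comp S (Y.erase w) y, z ∈ frontier S Y := by
      by_contra! h
      refine hPY (hP.mono (hP.of_separation (u := w) (v := w) (connOn_comp hyX) ?_ (.inl rfl)) ?_)
      · intro a ha b hab
        have haY := comp_subset ha
        have hbY := mem_of_adj_of_notMem_frontier (mem_of_mem_erase haY) (h a ha) hab
        by_cases hbw : b = w
        · exact .inr (.inl hbw)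
        · exact .inl (mem_comp_of_adj ha (mem_erase.2 ⟨hbw, hbY⟩) hab)
      · intro a ha
        simp only [mem_union, mem_insert, mem_singleton, or_self] at ha
        rcases ha with ha | rfl
        · exact mem_of_mem_erase (comp_subset ha)
        · exact hw
    refine mem_biUnion.2 ⟨z, mem_erase.2 ⟨?_, hzf⟩, mem_filter.2 ⟨?_, hwy⟩⟩
    · exact (mem_erase.1 (comp_subset hz)).1
    · rw [comp_eq_of_mem hz]
      exact mem_comp_self hyX
  refine (card_le_card hsub).trans ((card_biUnion_le_card_mul _ _ c fun z hz => ?_).trans ?_)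
  · by_contra! hlt
    obtain ⟨hzw, hzf⟩ := mem_erase.1 hz
    have hzX : z ∈ Y.erase w := mem_erase.2 ⟨hzw, (mem_filter.1 hzf).1⟩
    refine hPY (hP.mono (hP.of_pumpkin (isSimplePumpkin_of_injOn (A := {w}) ?_
      (connOn_singleton w) (connOn_comp hzX) _ hlt.le (fun _ => w) id ?_ ?_)) ?_)
    · exact disjoint_singleton_left.2 fun h => (mem_erase.1 (comp_subset h)).1 rfl
    · intro a _ b _ hab
      exact (Prod.mk.inj hab).2
    · intro y hy
      obtain ⟨hy, hwy⟩ := mem_filter.1 hy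
      exact ⟨mem_singleton_self w, hy, hwy⟩
    · exact union_subset (singleton_subset_iff.2 hw) (comp_subset.trans (erase_subset _ _))
  · exact Nat.mul_le_mul_right _ ((card_le_card (erase_subset _ _)).trans hk)

omit hP in
/-- A ball in a graph of bounded degree has bounded size. -/
lemma card_ball_le {d : ℕ} {v : α} (hv : v ∈ Y)
    (hd : ∀ w ∈ Y, (Y.filter fun y => S.Adj w y).card ≤ d) (r : ℕ) :
    (ball S Y v r).card ≤ (d + 1) ^ r := by
  induction r with
  | zero => simp [ball]
  | succ r ih =>
    have hsub : (Y.filter fun y => ∃ x ∈ ball S Y v r, S.Adj x y) ⊆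
        (ball S Y v r).biUnion fun x => Y.filter fun y => S.Adj x y := by
      intro y hy
      obtain ⟨hy, x, hx, hxy⟩ := mem_filter.1 hy
      exact mem_biUnion.2 ⟨x, hx, mem_filter.2 ⟨hy, hxy⟩⟩
    have h₁ := (card_le_card hsub).trans
      (card_biUnion_le_card_mul _ _ d fun x hx => hd x (ball_subset hv hx))
    calc (ball S Y v (r + 1)).card ≤ (ball S Y v r).card + (ball S Y v r).card * d :=
          (card_union_le _ _).trans (Nat.add_le_add_left h₁ _)
      _ = (ball S Y v r).card * (d + 1) := by ring
      _ ≤ (d + 1) ^ r * (d + 1) := Nat.mul_le_mul_right _ ih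
      _ = _ := (pow_succ _ _).symm

omit hP in
lemma connOn_segment {p : ℕ → α} {ℓ : ℕ} (hadj : ∀ i < ℓ, S.Adj (p i) (p (i + 1))) {a b : ℕ}
    (hab : a < b) (hb : b ≤ ℓ + 1) : ConnOn S ((Ico a b).image p) := by
  induction b, hab using Nat.le_induction with
  | base =>
    have : Ico a a.succ = {a} := by ext i; simp only [mem_Ico, mem_singleton]; omega
    rw [this, image_singleton]
    exact connOn_singleton _
  | succ b hab ih =>
    have : Ico a (b + 1) = insert b (Ico a b) := by
      ext i; simp only [mem_Ico, mem_insert]; omega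
    rw [this, image_insert]
    have h := hadj (b - 1) (by omega)
    rw [show b - 1 + 1 = b by omega] at h
    exact (ih (by omega)).insert_of_adj
      (mem_image_of_mem p (mem_Ico.2 ⟨by omega, by omega⟩)) h

/-- In a pumpkin-free set, each long subpath of a geodesic has an inner vertex that belongs to the
frontier or is adjacent to a component off the geodesic that meets the frontier. Otherwise the
components off the geodesic are bridges that satisfy the assumptions of `false_of_long_interval`:
each assumption fails only if there is a pumpkin, or if the part between two positions violates one
of the reduction rules. -/
lemma IsPumpkinFamily.false_of_geodesic (hc : 1 ≤ c) (hPY : ¬ P Y) {p : ℕ → α} {v : α} {ℓ lo hi : ℕ}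
    (hv : v ∈ Y) (hp : ∀ i ≤ ℓ, IsLevel S Y v i (p i)) (hadj : ∀ i < ℓ, S.Adj (p i) (p (i + 1)))
    (hhi : hi ≤ ℓ) (hlong : lo + (bridgeStep c)^[c] 1 ≤ hi)
    (hgood : ∀ i, lo < i → i < hi → p i ∉ frontier S Y ∧
      ∀ z ∈ Y \ (Ico 0 (ℓ + 1)).image p, S.Adj z (p i) →
        Disjoint (comp S (Y \ (Ico 0 (ℓ + 1)).image p) z) (frontier S Y)) : False := by
  have : Nonempty α := ⟨v⟩
  set X := Y \ (Ico 0 (ℓ + 1)).image p with hX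
  have hpY : ∀ i ≤ ℓ, p i ∈ Y := fun i hi => ball_subset hv (hp i hi).1
  have hinj : ∀ i j, i ≤ ℓ → j ≤ ℓ → p i = p j → i = j := fun i j hi hj hij =>
    (hp i hi).unique (hij ▸ hp j hj)
  have hseg : ∀ a b, b ≤ ℓ + 1 → (Ico a b).image p ⊆ Y := by
    intro a b hb z hz
    obtain ⟨i, hi, rfl⟩ := mem_image.1 hz
    exact hpY i (by have := mem_Ico.1 hi; omega)
  have hpX : ∀ i ≤ ℓ, p i ∉ X := fun i hi h =>
    (mem_sdiff.1 h).2 (mem_image_of_mem p (mem_Ico.2 ⟨by omega, by omega⟩))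
  have hXY : X ⊆ Y := sdiff_subset
  -- the bridges are the components `K` of the subgraph induced by `X`
  let att : Finset α → ℕ → Prop := fun K i =>
    (∃ x ∈ X, K = comp S X x) ∧ i ≤ ℓ ∧ ∃ z ∈ K, S.Adj z (p i)
  have hKX : ∀ K i, att K i → K ⊆ X := by
    rintro K i ⟨⟨x, -, rfl⟩, -⟩
    exact comp_subset
  have hKc : ∀ K i, att K i → ConnOn S K := by
    rintro K i ⟨⟨x, hx, rfl⟩, -⟩
    exact connOn_comp hx
  have hKd : ∀ K K' i i', att K i → att K' i' → K ≠ K' → Disjoint K K' := by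
    rintro K K' i i' ⟨⟨x, hx, rfl⟩, -⟩ ⟨⟨x', hx', rfl⟩, -⟩ hne
    exact comp_disjoint hne
  have hsegK : ∀ a b K i, b ≤ ℓ + 1 → att K i → Disjoint ((Ico a b).image p) K := by
    intro a b K i hb hK
    refine disjoint_left.2 fun z hz hzK => ?_
    obtain ⟨j, hj, rfl⟩ := mem_image.1 hz
    exact hpX j (by have := mem_Ico.1 hj; omega) (hKX K i hK hzK)
  have hsegd : ∀ a b a' b', b ≤ ℓ + 1 → b' ≤ ℓ + 1 → b ≤ a' →
      Disjoint ((Ico a b).image p) ((Ico a' b').image p) := by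
    intro a b a' b' hb hb' hba
    refine disjoint_left.2 fun z hz hz' => ?_
    obtain ⟨i, hi, rfl⟩ := mem_image.1 hz
    obtain ⟨j, hj, hij⟩ := mem_image.1 hz'
    rw [mem_Ico] at hi hj
    have := hinj j i (by omega) (by omega) hij
    omega
  have hKs : ∀ a b K i, a ≤ i → i < b → b ≤ ℓ + 1 → att K i →
      ConnOn S ((Ico a b).image p ∪ K) := by
    rintro a b K i hai hib hb hK
    obtain ⟨-, -, z, hz, hzi⟩ := id hK
    exact (connOn_segment hadj (by omega) hb).union_of_adj (hKc K i hK)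
      (mem_image_of_mem p (mem_Ico.2 ⟨hai, hib⟩)) hz hzi.symm
  refine false_of_long_interval (att := att) (c := c) (lo := lo) (hi := hi) ?_ ?_ ?_ ?_ hlong
  · -- a bridge and the whole path
    intro K I hI
    by_contra! hcI
    obtain ⟨i₀, hi₀⟩ : I.Nonempty := card_pos.1 (by omega)
    have hK := hI i₀ hi₀
    have hz : ∀ i ∈ I, ∃ z ∈ K, S.Adj z (p i) := fun i hi => (hI i hi).2.2
    choose! f hf hfi using hz
    refine hPY (hP.mono (hP.of_pumpkin (isSimplePumpkin_of_injOn (A := K)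
      (B := (Ico 0 (ℓ + 1)).image p) (hsegK _ _ K i₀ le_rfl hK).symm (hKc K i₀ hK)
      (connOn_segment hadj (by omega) le_rfl) I hcI f p ?_ ?_)) ?_)
    · intro i hi j hj hij
      exact hinj i j (hI i hi).2.1 (hI j hj).2.1 (Prod.mk.inj hij).2
    · intro i hi
      have := (hI i hi).2.1
      exact ⟨hf i hi, mem_image_of_mem p (mem_Ico.2 ⟨by omega, by omega⟩), hfi i hi⟩
    · exact union_subset ((hKX K i₀ hK).trans hXY) (hseg _ _ le_rfl)
  · -- the part of the path up to `t` and the bridges over `t`, and the rest of the path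
    intro t D hD
    by_contra! hcD
    have h₁ : ∀ K ∈ D, ∃ i, t < i ∧ att K i := fun K hK => (hD K hK).2
    choose! r hr hKr using h₁
    have hz : ∀ K ∈ D, ∃ z ∈ K, S.Adj z (p (r K)) := fun K hK => (hKr K hK).2.2
    choose! f hf hfr using hz
    obtain ⟨K₀, hK₀⟩ : D.Nonempty := card_pos.1 (by omega)
    have ht : t + 1 ≤ ℓ := (hr K₀ hK₀).trans_le (hKr K₀ hK₀).2.1
    refine hPY (hP.mono (hP.of_pumpkin (isSimplePumpkin_of_injOn
      (A := (Ico 0 (t + 1)).image p ∪ D.biUnion id) (B := (Ico (t + 1) (ℓ + 1)).image p)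
      ?_ ?_ (connOn_segment hadj (by omega) le_rfl) D hcD f (fun K => p (r K)) ?_ ?_)) ?_)
    · rw [disjoint_union_left, disjoint_biUnion_left]
      exact ⟨hsegd _ _ _ _ (by omega) le_rfl le_rfl,
        fun K hK => (hsegK _ _ K _ le_rfl (hKr K hK)).symm⟩
    · refine (connOn_segment hadj (by omega) (by omega)).union_biUnion D id fun K hK => ?_
      obtain ⟨i, hi, hKi⟩ := (hD K hK).1
      exact hKs _ _ K i (by omega) (by omega) (by omega) hKi
    · intro K hK K' hK' hKK
      by_contra hne
      have h₁ := hf K hK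
      rw [(Prod.mk.inj hKK).1] at h₁
      exact disjoint_left.1 (hKd K K' _ _ (hKr K hK) (hKr K' hK') hne) h₁ (hf K' hK')
    · intro K hK
      have := (hKr K hK).2.1
      have := hr K hK
      exact ⟨mem_union_right _ (mem_biUnion.2 ⟨K, hK, hf K hK⟩),
        mem_image_of_mem p (mem_Ico.2 ⟨by omega, by omega⟩), hfr K hK⟩
    · exact union_subset (union_subset (hseg _ _ (by omega))
        (biUnion_subset.2 fun K hK => (hKX K _ (hKr K hK)).trans hXY)) (hseg _ _ le_rfl)
  · -- overlapping bridges join the even segments to each other, and the odd ones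
    intro r K hr₀ hrc hr hK hKne
    have hrmono : ∀ i j, i < j → j ≤ c + 1 → r i < r j := by
      intro i j hij
      induction j, hij using Nat.le_induction with
      | base => intro h; exact hr i (by omega)
      | succ j hij ihj => intro h; exact (ihj (by omega)).trans (hr j (by omega))
    have hrmono' : ∀ i j, i ≤ j → j ≤ c + 1 → r i ≤ r j := by
      intro i j hij hj
      rcases hij.eq_or_lt with rfl | hij
      · exact le_rfl
      · exact (hrmono i j hij hj).le
    have hrℓ : ∀ i, i ≤ c + 1 → r i ≤ ℓ := fun i hi =>
      (hrmono' i (c + 1) hi le_rfl).trans (by omega)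
    let seg : ℕ → Finset α := fun i => (Ico (r i) (r (i + 1))).image p
    let T : ℕ → Finset α := fun m => ((range (m + 1)).filter fun i => i % 2 = m % 2).biUnion seg ∪
      ((Ico 1 m).filter fun i => (i + 1) % 2 = m % 2).biUnion K
    have hTsucc : ∀ m, T (m + 2) = (T m ∪ K (m + 1)) ∪ seg (m + 2) := by
      intro m
      ext z
      simp only [T, mem_union, mem_biUnion, mem_filter, mem_range, mem_Ico]
      constructor
      · rintro (⟨i, ⟨hi, hi'⟩, hz⟩ | ⟨i, ⟨hi, hi'⟩, hz⟩)
        · rcases Nat.lt_or_ge i (m + 2) with h | h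
          · exact .inl (.inl (.inl ⟨i, ⟨by omega, by omega⟩, hz⟩))
          · exact .inr (by rwa [show m + 2 = i by omega])
        · rcases Nat.lt_or_ge i (m + 1) with h | h
          · exact .inl (.inl (.inr ⟨i, ⟨by omega, by omega⟩, hz⟩))
          · exact .inl (.inr (by rwa [show m + 1 = i by omega]))
      · rintro (((⟨i, ⟨hi, hi'⟩, hz⟩ | ⟨i, ⟨hi, hi'⟩, hz⟩) | hz) | hz)
        · exact .inl ⟨i, ⟨by omega, by omega⟩, hz⟩
        · exact .inr ⟨i, ⟨by omega, by omega⟩, hz⟩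
        · exact .inr ⟨m + 1, ⟨by omega, by omega⟩, hz⟩
        · exact .inl ⟨m + 2, ⟨by omega, by omega⟩, hz⟩
    have hsegT : ∀ m i, i ≤ m → i % 2 = m % 2 → seg i ⊆ T m := fun m i him hi z hz =>
      mem_union_left _ (mem_biUnion.2 ⟨i, mem_filter.2 ⟨mem_range.2 (by omega), hi⟩, hz⟩)
    have hsegc : ∀ i ≤ c, ConnOn S (seg i) := fun i hi =>
      connOn_segment hadj (hr i hi) ((hrℓ (i + 1) (by omega)).trans (by omega))
    have hTconn : ∀ m ≤ c, ConnOn S (T m) := by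
      intro m
      induction m using Nat.strong_induction_on with
      | _ m ih =>
        intro hm
        match m, ih, hm with
        | 0, _, hm =>
          have : T 0 = seg 0 := by
            ext z; simp [T]
          rw [this]
          exact hsegc 0 hm
        | 1, _, hm =>
          have : T 1 = seg 1 := by
            ext z
            simp only [T, mem_union, mem_biUnion, mem_filter, mem_range, mem_Ico]
            constructor
            · rintro (⟨i, ⟨hi, hi'⟩, hz⟩ | ⟨i, ⟨hi, hi'⟩, hz⟩)
              · rwa [show 1 = i by omega]
              · omega
            · exact fun hz => .inl ⟨1, ⟨by omega, by omega⟩, hz⟩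
          rw [this]
          exact hsegc 1 hm
        | m + 2, ih, hm =>
          rw [hTsucc]
          obtain ⟨h₁, l, hl, hl', h₂⟩ := hK (m + 1) (by omega) (by omega)
          obtain ⟨-, -, z, hz, hza⟩ := id h₁
          obtain ⟨-, -, w, hw, hwa⟩ := id h₂
          have h₃ := (ih m (by omega) (by omega)).union_of_adj (hKc _ _ h₁)
            (hsegT m m le_rfl rfl (mem_image_of_mem p (mem_Ico.2 ⟨hl, hl'⟩))) hw hwa.symm
          exact h₃.union_of_adj (hsegc (m + 2) hm) (mem_union_right _ hz)
            (mem_image_of_mem p (mem_Ico.2 ⟨le_rfl, hr (m + 2) (by omega)⟩)) hza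
    have hTY : ∀ m ≤ c, T m ⊆ Y := by
      intro m hm z hz
      rcases mem_union.1 hz with hz | hz
      · obtain ⟨i, hi, hz⟩ := mem_biUnion.1 hz
        have hi := mem_range.1 (mem_filter.1 hi).1
        exact hseg _ _ ((hrℓ (i + 1) (by omega)).trans (by omega)) hz
      · obtain ⟨i, hi, hz⟩ := mem_biUnion.1 hz
        have hi := mem_Ico.1 (mem_filter.1 hi).1
        exact hXY (hKX _ _ (hK i (by omega) (by omega)).1 hz)
    have hdisj : Disjoint (T c) (T (c - 1)) := by
      have hss : ∀ i j, i ≤ c → j ≤ c → i ≠ j → Disjoint (seg i) (seg j) := by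
        intro i j hi hj hij
        rcases Nat.lt_or_gt_of_ne hij with h | h
        · exact hsegd _ _ _ _ ((hrℓ _ (by omega)).trans (by omega))
            ((hrℓ _ (by omega)).trans (by omega)) (hrmono' _ _ (by omega) (by omega))
        · exact (hsegd _ _ _ _ ((hrℓ _ (by omega)).trans (by omega))
            ((hrℓ _ (by omega)).trans (by omega)) (hrmono' _ _ (by omega) (by omega))).symm
      have hsK : ∀ i j, i ≤ c → 1 ≤ j → j ≤ c → Disjoint (seg i) (K j) := fun i j hi hj hj' =>
        hsegK _ _ _ _ ((hrℓ _ (by omega)).trans (by omega)) (hK j hj hj').1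
      have hKK : ∀ i j, 1 ≤ i → i ≤ c → 1 ≤ j → j ≤ c → i ≠ j → Disjoint (K i) (K j) := by
        intro i j hi hi' hj hj' hij
        refine hKd _ _ _ _ (hK i hi hi').1 (hK j hj hj').1 ?_
        rcases Nat.lt_or_gt_of_ne hij with h | h
        · exact hKne i j hi h hj'
        · exact (hKne j i hj h hi').symm
      simp only [T, disjoint_union_left, disjoint_union_right, disjoint_biUnion_left,
        disjoint_biUnion_right, mem_filter, mem_range, mem_Ico]
      refine ⟨fun j hj => ⟨fun i hi => ?_, fun i hi => ?_⟩,
        fun j hj => ⟨fun i hi => ?_, fun i hi => ?_⟩⟩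
      · exact hss _ _ (by omega) (by omega) (by omega)
      · exact (hsK _ _ (by omega) (by omega) (by omega)).symm
      · exact hsK _ _ (by omega) (by omega) (by omega)
      · exact hKK _ _ (by omega) (by omega) (by omega) (by omega) (by omega)
    have hpred : ∀ i < c, p (r (i + 1) - 1) ∈ seg i ∧ p (r (i + 1)) ∈ seg (i + 1) ∧
        S.Adj (p (r (i + 1) - 1)) (p (r (i + 1))) := by
      intro i hi
      have h₁ := hr i (by omega)
      have h₂ := hr (i + 1) (by omega)
      have h₃ := hrℓ (i + 1) (by omega)
      refine ⟨mem_image_of_mem p (mem_Ico.2 ⟨by omega, by omega⟩),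
        mem_image_of_mem p (mem_Ico.2 ⟨le_rfl, h₂⟩), ?_⟩
      have h := hadj (r (i + 1) - 1) (by omega)
      rwa [show r (i + 1) - 1 + 1 = r (i + 1) by omega] at h
    refine hPY (hP.mono (hP.of_pumpkin (isSimplePumpkin_of_injOn hdisj (hTconn c le_rfl)
      (hTconn (c - 1) (by omega)) (range c) (by simp)
      (fun i => if i % 2 = c % 2 then p (r (i + 1) - 1) else p (r (i + 1)))
      (fun i => if i % 2 = c % 2 then p (r (i + 1)) else p (r (i + 1) - 1)) ?_ ?_))
      (union_subset (hTY c le_rfl) (hTY (c - 1) (by omega))))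
    · intro i hi j hj hij
      simp only [coe_range, Set.mem_Iio] at hi hj
      have hi₁ := hrℓ (i + 1) (by omega)
      have hj₁ := hrℓ (j + 1) (by omega)
      have hi₀ := hr i (by omega)
      have hj₀ := hr j (by omega)
      have hr_inj : r (i + 1) = r (j + 1) → i = j := by
        intro h
        by_contra hne
        rcases Nat.lt_or_gt_of_ne hne with h' | h'
        · exact absurd h (hrmono (i + 1) (j + 1) (by omega) (by omega)).ne
        · exact absurd h (hrmono (j + 1) (i + 1) (by omega) (by omega)).ne'
      simp only [Prod.mk.injEq] at hij
      obtain ⟨h₁, h₂⟩ := hij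
      split_ifs at h₁ h₂
      · exact hr_inj (hinj _ _ hi₁ hj₁ h₂)
      · have := hinj _ _ (by omega) hj₁ h₁
        have := hinj _ _ hi₁ (by omega) h₂
        omega
      · have := hinj _ _ hi₁ (by omega) h₁
        have := hinj _ _ (by omega) hj₁ h₂
        omega
      · exact hr_inj (hinj _ _ hi₁ hj₁ h₁)
    · intro i hi
      have hic := mem_range.1 hi
      obtain ⟨h₁, h₂, h₃⟩ := hpred i hic
      by_cases hpar : i % 2 = c % 2
      · simp only [if_pos hpar]
        exact ⟨hsegT c i (by omega) hpar h₁, hsegT (c - 1) (i + 1) (by omega) (by omega) h₂, h₃⟩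
      · simp only [if_neg hpar]
        exact ⟨hsegT c (i + 1) (by omega) (by omega) h₂,
          hsegT (c - 1) i (by omega) (by omega) h₁, h₃.symm⟩
  · -- the second reduction rule
    intro x y hx hxy hy
    by_contra! hno
    have hKf : ∀ K i, x < i → i < y → att K i → Disjoint K (frontier S Y) := by
      rintro K i hxi hiy ⟨⟨w, hw, rfl⟩, hi, z, hz, hza⟩
      rw [← comp_eq_of_mem hz]
      exact (hgood i (by omega) (by omega)).2 z (comp_subset hz) hza
    let D : Finset (Finset α) := (X.image (comp S X)).filter fun K => ∃ i, x < i ∧ i < y ∧ att K i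
    have hDmem : ∀ z ∈ X, ∀ i, x < i → i < y → S.Adj z (p i) → comp S X z ∈ D :=
      fun z hz i hxi hiy hzi => mem_filter.2 ⟨mem_image_of_mem _ hz, i, hxi, hiy,
        ⟨z, hz, rfl⟩, by omega, z, mem_comp_self hz, hzi⟩
    have hseg₁ : ConnOn S ((Ico (x + 1) y).image p) :=
      connOn_segment hadj (by omega) (by omega)
    have hW : ConnOn S ((Ico (x + 1) y).image p ∪ D.biUnion id) := by
      refine hseg₁.union_biUnion D id fun K hK => ?_
      obtain ⟨i, hxi, hiy, hKi⟩ := (mem_filter.1 hK).2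
      exact hKs _ _ K i (by omega) hiy (by omega) hKi
    refine hPY (hP.mono (hP.of_separation (u := p x) (v := p y) hW ?_ (.inr ?_)) ?_)
    · intro w hw b hwb
      rcases mem_union.1 hw with hw | hw
      · obtain ⟨i, hi, rfl⟩ := mem_image.1 hw
        rw [mem_Ico] at hi
        have hbY := mem_of_adj_of_notMem_frontier (hpY i (by omega))
          (hgood i (by omega) (by omega)).1 hwb
        by_cases hbX : b ∈ X
        · exact .inl (mem_union_right _ (mem_biUnion.2
            ⟨_, hDmem b hbX i (by omega) (by omega) hwb.symm, mem_comp_self hbX⟩))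
        · have hbp : b ∈ (Ico 0 (ℓ + 1)).image p := by
            by_contra h
            exact hbX (mem_sdiff.2 ⟨hbY, h⟩)
          obtain ⟨j, hj, rfl⟩ := mem_image.1 hbp
          rw [mem_Ico] at hj
          have h₁ := (hp i (by omega)).le_succ_of_adj (hp j (by omega)) (hpY i (by omega)) hwb.symm
          have h₂ := (hp j (by omega)).le_succ_of_adj (hp i (by omega)) (hpY j (by omega)) hwb
          by_cases hjx : j = x
          · exact .inr (.inl (by rw [hjx]))
          by_cases hjy : j = y
          · exact .inr (.inr (by rw [hjy]))
          exact .inl (mem_union_left _ (mem_image_of_mem p (mem_Ico.2 ⟨by omega, by omega⟩)))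
      · obtain ⟨K, hK, hw⟩ := mem_biUnion.1 hw
        obtain ⟨i, hxi, hiy, hKi⟩ := (mem_filter.1 hK).2
        have hwX : w ∈ X := hKX K i hKi hw
        have hbY := mem_of_adj_of_notMem_frontier (hXY hwX)
          (disjoint_left.1 (hKf K i hxi hiy hKi) hw) hwb
        by_cases hbX : b ∈ X
        · obtain ⟨⟨w', hw', rfl⟩, -⟩ := id hKi
          exact .inl (mem_union_right _ (mem_biUnion.2 ⟨_, hK, mem_comp_of_adj hw hbX hwb⟩))
        · have hbp : b ∈ (Ico 0 (ℓ + 1)).image p := by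
            by_contra h
            exact hbX (mem_sdiff.2 ⟨hbY, h⟩)
          obtain ⟨j, hj, rfl⟩ := mem_image.1 hbp
          rw [mem_Ico] at hj
          have hKj : att K j := ⟨hKi.1, by omega, w, hw, hwb⟩
          have h₁ := hno K ⟨i, hxi, hiy, hKi⟩ j
          by_cases hjx : j = x
          · exact .inr (.inl (by rw [hjx]))
          by_cases hjy : j = y
          · exact .inr (.inr (by rw [hjy]))
          refine .inl (mem_union_left _ (mem_image_of_mem p (mem_Ico.2 ?_)))
          by_contra hout
          exact h₁ (by omega) hKj
    · refine le_trans ?_ (card_le_card subset_union_left)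
      rw [card_image_of_injOn]
      · rw [Nat.card_Ico]
        omega
      · intro i hi j hj hij
        simp only [coe_Ico, Set.mem_Ico] at hi hj
        exact hinj i j (by omega) (by omega) hij
    · refine union_subset (union_subset (hseg _ _ (by omega))
        (biUnion_subset.2 fun K hK => ?_)) ?_
      · obtain ⟨i, -, -, hKi⟩ := (mem_filter.1 hK).2
        exact (hKX K i hKi).trans hXY
      · intro z hz
        simp only [mem_insert, mem_singleton] at hz
        rcases hz with rfl | rfl
        · exact hpY _ (by omega)
        · exact hpY _ (by omega)

/-- A bound for the length of a geodesic in a pumpkin-free set with a frontier of size `k`. -/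
def geodesicBound (c k : ℕ) : ℕ := (k * (c + 1) + 1) * (bridgeStep c)^[c] 1

/-- A bound for the size of a pumpkin-free connected set with a frontier of size `k`. -/
def pieceBound (c k : ℕ) : ℕ := (k * c + 1) ^ geodesicBound c k

/-- In a reduced graph, a pumpkin-free connected set is bounded in terms of its frontier. -/
lemma IsPumpkinFamily.card_le_pieceBound (hc : 1 ≤ c) (hY : ConnOn S Y) (hPY : ¬ P Y)
    (hk : (frontier S Y).card ≤ k) : Y.card ≤ pieceBound c k := by
  obtain ⟨v, hv⟩ := hY.1
  have : Nonempty α := ⟨v⟩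
  have hball := card_ball_le hv (fun w hw => hP.degree_le hPY hk hw) (geodesicBound c k)
  by_cases hb : ball S Y v (geodesicBound c k) = Y
  · rwa [hb] at hball
  exfalso
  obtain ⟨a, ha, b, hb, hb', hab⟩ := hY.exists_adj_of_ssubset ⟨v, mem_ball_self⟩
    (ball_subset hv) hb
  have hlev : IsLevel S Y v (geodesicBound c k + 1) b :=
    ⟨mem_ball_of_adj ha hb hab, fun j hj h => hb' (ball_mono (by omega) h)⟩
  obtain ⟨p, -, hp, hadj⟩ := hlev.exists_geodesic
  set ℓ := geodesicBound c k + 1 with hℓ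
  set X := Y \ (Ico 0 (ℓ + 1)).image p with hX
  set L := (bridgeStep c)^[c] 1 with hL
  have hinj : ∀ i j, i ≤ ℓ → j ≤ ℓ → p i = p j → i = j := fun i j hi hj hij =>
    (hp i hi).unique (hij ▸ hp j hj)
  have hseg : (Ico 0 (ℓ + 1)).image p ⊆ Y := by
    intro z hz
    obtain ⟨i, hi, rfl⟩ := mem_image.1 hz
    exact ball_subset hv (hp i (by have := mem_Ico.1 hi; omega)).1
  -- the bad positions of the geodesic are few, so some long interval avoids them
  let bad : Finset ℕ := ((range (ℓ + 1)).filter fun i => p i ∈ frontier S Y) ∪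
    (frontier S Y ∩ X).biUnion fun z =>
      (range (ℓ + 1)).filter fun i => ∃ w ∈ comp S X z, S.Adj w (p i)
  have hbad : bad.card ≤ k * (c + 1) := by
    have h₁ : ((range (ℓ + 1)).filter fun i => p i ∈ frontier S Y).card ≤ k := by
      refine (card_le_card_of_injOn p (fun i hi => (mem_filter.1 hi).2) ?_).trans hk
      intro i hi j hj hij
      have hi := mem_range.1 (mem_filter.1 hi).1
      have hj := mem_range.1 (mem_filter.1 hj).1
      exact hinj i j (by omega) (by omega) hij
    have h₂ : ((frontier S Y ∩ X).biUnion fun z =>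
        (range (ℓ + 1)).filter fun i => ∃ w ∈ comp S X z, S.Adj w (p i)).card ≤ k * c := by
      refine (card_biUnion_le_card_mul _ _ c fun z hz => ?_).trans
        (Nat.mul_le_mul_right _ ((card_le_card inter_subset_left).trans hk))
      by_contra! hlt
      have hzX := (mem_inter.1 hz).2
      set I := (range (ℓ + 1)).filter fun i => ∃ w ∈ comp S X z, S.Adj w (p i) with hI
      have hw : ∀ i ∈ I, ∃ w ∈ comp S X z, S.Adj w (p i) := fun i hi => (mem_filter.1 hi).2
      have hr : ∀ i ∈ I, i < ℓ + 1 := fun i hi => mem_range.1 (mem_filter.1 hi).1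
      choose! f hf hfi using hw
      refine hPY (hP.mono (hP.of_pumpkin (isSimplePumpkin_of_injOn (A := comp S X z)
        (B := (Ico 0 (ℓ + 1)).image p) ?_ (connOn_comp hzX)
        (connOn_segment hadj (by omega) le_rfl) I hlt.le f p ?_ ?_)) ?_)
      · exact disjoint_left.2 fun w hw hw' => (mem_sdiff.1 (comp_subset hw)).2 hw'
      · intro i hi j hj hij
        have := hr i hi
        have := hr j hj
        exact hinj i j (by omega) (by omega) (Prod.mk.inj hij).2
      · intro i hi
        exact ⟨hf i hi, mem_image_of_mem p (mem_Ico.2 ⟨by omega, hr i hi⟩), hfi i hi⟩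
      · exact union_subset (comp_subset.trans sdiff_subset) hseg
    calc bad.card ≤ k + k * c := (card_union_le _ _).trans (add_le_add h₁ h₂)
      _ = k * (c + 1) := by ring
  obtain ⟨j, hj, hjgood⟩ : ∃ j ≤ k * (c + 1), ∀ i, j * L < i → i < (j + 1) * L → i ∉ bad := by
    by_contra! h
    choose! f hf₁ hf₂ hf₃ using h
    have hlt : ∀ j j', j < j' → j' ≤ k * (c + 1) → f j < f j' := by
      intro j j' hjj' hj'
      have h₁ := hf₂ j (by omega)
      have h₂ := hf₁ j' hj'
      have h₃ : (j + 1) * L ≤ j' * L := Nat.mul_le_mul_right _ hjj'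
      omega
    have hcard := card_le_card_of_injOn (s := range (k * (c + 1) + 1)) (t := bad) f
      (fun j hj => hf₃ j (by have := mem_range.1 hj; omega)) (by
        intro j hj j' hj' hjj
        simp only [coe_range, Set.mem_Iio] at hj hj'
        by_contra hne
        rcases Nat.lt_or_gt_of_ne hne with h | h
        · exact absurd hjj (hlt j j' h (by omega)).ne
        · exact absurd hjj (hlt j' j h (by omega)).ne')
    rw [card_range] at hcard
    omega
  have hjL : (j + 1) * L ≤ ℓ := by
    have : (j + 1) * L ≤ (k * (c + 1) + 1) * L := Nat.mul_le_mul_right _ (by omega)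
    exact this.trans (Nat.le_succ _)
  refine hP.false_of_geodesic hc hPY hv hp hadj (lo := j * L) (hi := (j + 1) * L) hjL
    (by rw [add_mul, one_mul]) fun i hi hi' => ?_
  have hib := hjgood i hi hi'
  simp only [bad, mem_union, mem_filter, mem_biUnion, mem_inter, mem_range, not_or, not_exists,
    not_and] at hib
  refine ⟨hib.1 (by omega), fun z hz hza => disjoint_left.2 fun w hw hwf => ?_⟩
  refine hib.2 w ⟨hwf, comp_subset hw⟩ (by omega) z ?_ hza
  rw [comp_eq_of_mem hw]
  exact mem_comp_self hz

end Core

section Core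

open scoped Classical
open Finset

/-! ### Clusters -/

section Clusters

variable {α : Type u} {ι : Type v} {S : SimpleGraph α}

/-- The graph obtained from `S` by contracting the fibres of `cl`. -/
def clusterGraph (S : SimpleGraph α) (cl : α → ι) : SimpleGraph ι where
  Adj i j := i ≠ j ∧ ∃ a b, cl a = i ∧ cl b = j ∧ S.Adj a b
  symm := ⟨fun _ _ ⟨hne, a, b, ha, hb, hab⟩ => ⟨hne.symm, b, a, hb, ha, hab.symm⟩⟩
  loopless := ⟨fun _ h => h.1 rfl⟩

/-- The fibres of `cl` are non-empty, and any set `Z` of vertices of a fibre is covered by a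
connected subset of this fibre of size at most `s * (1 + |Z|)`. -/
def HasSmallConnectors (S : SimpleGraph α) (cl : α → ι) (s : ℕ) : Prop :=
  ∀ i, ∀ Z : Finset α, (∀ z ∈ Z, cl z = i) →
    ∃ T : Finset α, Z ⊆ T ∧ ConnOn S T ∧ (∀ t ∈ T, cl t = i) ∧ T.card ≤ s * (1 + Z.card)

variable {cl : α → ι} {s : ℕ}

/-- Small connectors for the fibres give small connectors for connected sets of fibres. -/
lemma HasSmallConnectors.exists_lift (h : HasSmallConnectors S cl s) {T : Finset ι}
    (hT : ConnOn (clusterGraph S cl) T) (Z : Finset α) (hZ : ∀ z ∈ Z, cl z ∈ T) :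
    ∃ T' : Finset α, Z ⊆ T' ∧ ConnOn S T' ∧ (∀ t ∈ T', cl t ∈ T) ∧
      T'.card ≤ s * (3 * T.card + Z.card) := by
  suffices hU : ∃ U ⊆ T, ConnOn (clusterGraph S cl) U ∧ U.card = T.card ∧ ∀ Z : Finset α,
      (∀ z ∈ Z, cl z ∈ U) → ∃ T' : Finset α, Z ⊆ T' ∧ ConnOn S T' ∧ (∀ t ∈ T', cl t ∈ U) ∧
        T'.card ≤ s * (3 * U.card + Z.card) by
    obtain ⟨U, hUT, -, hUc, hU⟩ := hU
    obtain rfl := eq_of_subset_of_card_le hUT hUc.ge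
    exact hU Z hZ
  refine hT.exists_subset_card ?_ ?_ (card_pos.2 hT.1) le_rfl
  · intro i _ Z hZ
    obtain ⟨T', h₁, h₂, h₃, h₄⟩ := h i Z fun z hz => mem_singleton.1 (hZ z hz)
    refine ⟨T', h₁, h₂, fun t ht => mem_singleton.2 (h₃ t ht), h₄.trans ?_⟩
    rw [card_singleton]
    exact Nat.mul_le_mul_left _ (by omega)
  · rintro U - - hpU a ha b - hbU ⟨-, x, y, hxa, hyb, hxy⟩ Z hZ
    obtain ⟨T₁, h₁, h₂, h₃, h₄⟩ := hpU (insert x (Z.filter fun z => cl z ∈ U)) fun z hz => by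
      rcases mem_insert.1 hz with rfl | hz
      · rwa [hxa]
      · exact (mem_filter.1 hz).2
    obtain ⟨T₂, h₁', h₂', h₃', h₄'⟩ := h b (insert y (Z.filter fun z => ¬ cl z ∈ U)) fun z hz => by
      rcases mem_insert.1 hz with rfl | hz
      · exact hyb
      · obtain ⟨hz, hzU⟩ := mem_filter.1 hz
        exact (mem_insert.1 (hZ z hz)).resolve_right hzU
    refine ⟨T₁ ∪ T₂, fun z hz => ?_, h₂.union_of_adj h₂' (h₁ (mem_insert_self _ _))
      (h₁' (mem_insert_self _ _)) hxy, fun t ht => ?_, ?_⟩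
    · by_cases hzU : cl z ∈ U
      · exact mem_union_left _ (h₁ (mem_insert_of_mem (mem_filter.2 ⟨hz, hzU⟩)))
      · exact mem_union_right _ (h₁' (mem_insert_of_mem (mem_filter.2 ⟨hz, hzU⟩)))
    · rcases mem_union.1 ht with ht | ht
      · exact mem_insert_of_mem (h₃ t ht)
      · exact mem_insert.2 (.inl (h₃' t ht))
    · have e₁ := card_insert_le x (Z.filter fun z => cl z ∈ U)
      have e₂ := card_insert_le y (Z.filter fun z => ¬ cl z ∈ U)
      have e₃ := card_filter_add_card_filter_not (s := Z) (fun z => cl z ∈ U)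
      calc (T₁ ∪ T₂).card ≤ T₁.card + T₂.card := card_union_le _ _
        _ ≤ s * (3 * U.card + (insert x (Z.filter fun z => cl z ∈ U)).card) +
              s * (1 + (insert y (Z.filter fun z => ¬ cl z ∈ U)).card) := add_le_add h₄ h₄'
        _ = s * (3 * U.card + (insert x (Z.filter fun z => cl z ∈ U)).card +
              (1 + (insert y (Z.filter fun z => ¬ cl z ∈ U)).card)) := by ring
        _ ≤ s * (3 * (insert b U).card + Z.card) := by
          rw [card_insert_of_notMem hbU]
          exact Nat.mul_le_mul_left _ (by omega)

/-- If every fibre is adjacent to many others, there is a pumpkin with one side of bounded and one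
side of logarithmic size. -/
lemma HasSmallConnectors.exists_isSimplePumpkin [Fintype ι] [Nonempty ι]
    (h : HasSmallConnectors S cl s) {c : ℕ} (hc : 1 ≤ c)
    (hdeg : ∀ i, 2 * c + 4 ≤ (univ.filter fun j => (clusterGraph S cl).Adj i j).card) :
    ∃ A B, IsSimplePumpkin S c A B ∧ A.card ≤ s * (1 + c) ∧
      B.card ≤ s * (3 * (c * (Nat.log 2 (Fintype.card ι) + 2)) + c) := by
  obtain ⟨x, T, hxT, hT, hTc, hcT⟩ := exists_star_of_minDegree _ hc hdeg
  obtain ⟨J, hJ, hJc⟩ := exists_subset_card_eq hcT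
  have hadj : ∀ j ∈ J, ∃ a b, cl a = x ∧ cl b = j ∧ S.Adj a b := fun j hj =>
    (mem_filter.1 (hJ hj)).2.2
  obtain ⟨T₀, -, hT₀, -⟩ := h x ∅ (by simp)
  have : Nonempty α := ⟨hT₀.1.choose⟩
  choose! a b ha hb hab using hadj
  obtain ⟨A, hA₁, hA₂, hA₃, hA₄⟩ := h x (J.image a) fun z hz => by
    obtain ⟨j, hj, rfl⟩ := mem_image.1 hz
    exact ha j hj
  obtain ⟨B, hB₁, hB₂, hB₃, hB₄⟩ := h.exists_lift hT (J.image b) fun z hz => by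
    obtain ⟨j, hj, rfl⟩ := mem_image.1 hz
    rw [hb j hj]
    exact (mem_filter.1 (hJ hj)).1
  refine ⟨A, B, isSimplePumpkin_of_injOn ?_ hA₂ hB₂ J hJc.ge a b ?_ ?_, hA₄.trans ?_,
    hB₄.trans ?_⟩
  · exact disjoint_left.2 fun z hz hz' => hxT (hA₃ z hz ▸ hB₃ z hz')
  · intro i hi j hj hij
    rw [← hb i hi, ← hb j hj, (Prod.mk.inj hij).2]
  · exact fun j hj => ⟨hA₁ (mem_image_of_mem a hj), hB₁ (mem_image_of_mem b hj), hab j hj⟩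
  · have := card_image_le (s := J) (f := a)
    exact Nat.mul_le_mul_left _ (by omega)
  · have := card_image_le (s := J) (f := b)
    exact Nat.mul_le_mul_left _ (by omega)

end Clusters

/-- The size of the frontier of a cluster with few neighbouring clusters. -/
def frontierBound (c : ℕ) : ℕ := (2 * c + 4) * c

/-- The size of the cores of the clusters; it exceeds the size of a pumpkin-free connected set with
a frontier of size `frontierBound c`. -/
def coreSize (c : ℕ) : ℕ := pieceBound c (frontierBound c) + 1

/-- The bound for the small side of a pumpkin, and the factor of the logarithm in the bound for
the other side. -/
def sizeBound (c : ℕ) : ℕ :=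
  coreSize c + (frontierBound c + c * coreSize c ^ 2) * coreSize c + 10 * (coreSize c * (c + 1))

section

variable {α : Type u} {S : SimpleGraph α} {c : ℕ} {P : Finset α → Prop}

/-- The graph is cut into clusters, each of which consists of a connected core of constant size and
of small components of the graph without the cores. If all clusters are adjacent to many others,
then there is a pumpkin of logarithmic size. Otherwise some cluster has a frontier of bounded size.
As there are few small components that are attached to a given core only, this cluster has bounded
size, so it includes a small pumpkin, because it is too large for a pumpkin-free one. -/
theorem IsPumpkinFamily.exists_small [Fintype α] [Nonempty α] (hP : IsPumpkinFamily S c P)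
    (hc : 1 ≤ c) :
    (∃ X, P X ∧ X.card ≤ sizeBound c) ∨
      ∃ A B, IsSimplePumpkin S c A B ∧ A.card ≤ sizeBound c ∧
        B.card ≤ sizeBound c * (Nat.log 2 (Fintype.card α) + 1) := by
  by_contra! hcon
  obtain ⟨hX, hAB⟩ := hcon
  have hAB' : ∀ A B, IsSimplePumpkin S c A B → A.card ≤ sizeBound c → B.card ≤ sizeBound c →
      False := fun A B h hA hB =>
    absurd (hAB A B h hA) (not_lt.2 (hB.trans (Nat.le_mul_of_pos_right _ (Nat.succ_pos _))))
  set s := coreSize c with hs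
  have hspos : 0 < s := Nat.succ_pos _
  have hM : s + (frontierBound c + c * s ^ 2) * s + 10 * (s * (c + 1)) = sizeBound c := rfl
  have hsc : s * (c + 1) = s * c + s := by ring
  have hsc' : s * (1 + c) = s * c + s := by ring
  have hcs : c * s = s * c := mul_comm _ _
  -- the cores
  obtain ⟨F, hF, hFmax⟩ := exists_max_image (univ.filter fun F : Finset (Finset α) =>
    (∀ X ∈ F, ConnOn S X ∧ X.card = s) ∧ ∀ X ∈ F, ∀ X' ∈ F, X ≠ X' → Disjoint X X') card
    ⟨∅, by simp⟩
  simp only [mem_filter, mem_univ, true_and] at hF hFmax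
  obtain ⟨hFs, hFd⟩ := hF
  set R := univ \ F.biUnion id with hR
  have hFR : ∀ X ∈ F, ∀ x ∈ X, x ∉ R := fun X hX x hx h =>
    (mem_sdiff.1 h).2 (mem_biUnion.2 ⟨X, hX, hx⟩)
  have hsmall : ∀ x ∈ R, (comp S R x).card < s := by
    intro x hx
    by_contra! hle
    obtain ⟨Z, hZ, hZc, hZs, -⟩ := (connOn_comp hx).exists_subset_card (p := fun _ => True)
      (fun _ _ => trivial) (fun _ _ _ _ _ _ _ _ _ _ => trivial) hspos hle
    have hZd : ∀ X ∈ F, Disjoint Z X := fun X hX =>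
      disjoint_left.2 fun z hz hzX => hFR X hX z hzX (comp_subset (hZ hz))
    have hZF : Z ∉ F := fun h => by
      obtain ⟨z, hz⟩ := hZc.1
      exact disjoint_left.1 (hZd Z h) hz hz
    have := hFmax (insert Z F) ⟨fun X hX => ?_, fun X hX X' hX' hne => ?_⟩
    · rw [card_insert_of_notMem hZF] at this
      omega
    · rcases mem_insert.1 hX with rfl | hX
      · exact ⟨hZc, hZs⟩
      · exact hFs X hX
    · rcases mem_insert.1 hX with hX₁ | hX₁ <;> rcases mem_insert.1 hX' with hX₂ | hX₂
      · exact absurd (hX₁.trans hX₂.symm) hne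
      · exact hX₁ ▸ hZd _ hX₂
      · exact hX₂ ▸ (hZd _ hX₁).symm
      · exact hFd _ hX₁ _ hX₂ hne
  -- each component off the cores is adjacent to a core
  have hcore : ∀ C ∈ R.image (comp S R), ∃ X ∈ F, ∃ a ∈ C, ∃ b ∈ X, S.Adj a b := by
    intro C hC
    obtain ⟨x, hx, rfl⟩ := mem_image.1 hC
    by_contra! h
    -- nothing is adjacent to this component, so its own vertex `x` serves as a separating vertex
    refine absurd (hX _ (hP.of_separation (u := x) (v := x) (connOn_comp hx)
      (fun a ha b hab => .inl (mem_comp_of_adj ha ?_ hab)) (.inl rfl))) (not_lt.2 ?_)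
    · by_contra hbR
      rw [hR, mem_sdiff, not_and, not_not] at hbR
      obtain ⟨X, hX, hbX⟩ := mem_biUnion.1 (hbR (mem_univ b))
      exact h X hX a ha b hbX hab
    · have h₁ := card_union_le (comp S R x) {x, x}
      have h₂ := card_le_two (a := x) (b := x)
      have h₃ := hsmall x hx
      omega
  have hcov : ∀ x, x ∉ R → ∃ X ∈ F, x ∈ X := by
    intro x hx
    rw [hR, mem_sdiff, not_and, not_not] at hx
    exact mem_biUnion.1 (hx (mem_univ x))
  choose! g hgF hga using hcore
  choose! h hhF hhx using hcov
  let cl₀ : α → Finset α := fun x => if x ∈ R then g (comp S R x) else h x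
  have hcl₀ : ∀ x, cl₀ x ∈ F := by
    intro x
    by_cases hx : x ∈ R
    · simp only [cl₀, if_pos hx]
      exact hgF _ (mem_image_of_mem _ hx)
    · simp only [cl₀, if_neg hx]
      exact hhF x hx
  let cl : α → F := fun x => ⟨cl₀ x, hcl₀ x⟩
  have hclR : ∀ x ∈ R, (cl x : Finset α) = g (comp S R x) := fun x hx => if_pos hx
  have hcl_core : ∀ X : F, ∀ x ∈ (X : Finset α), cl x = X := by
    rintro ⟨X, hXF⟩ x hx
    have hxR := hFR X hXF x hx
    refine Subtype.ext ?_
    change cl₀ x = X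
    simp only [cl₀, if_neg hxR]
    by_contra hne
    exact disjoint_left.1 (hFd _ (hhF x hxR) _ hXF hne) (hhx x hxR) hx
  have hcl_notR : ∀ x, x ∉ R → x ∈ (cl x : Finset α) := by
    intro x hx
    change x ∈ cl₀ x
    simp only [cl₀, if_neg hx]
    exact hhx x hx
  have hcl_comp : ∀ x ∈ R, ∀ y ∈ comp S R x, cl y = cl x := by
    intro x hx y hy
    refine Subtype.ext ?_
    rw [hclR y (comp_subset hy), hclR x hx, comp_eq_of_mem hy]
  have hcl_conn : ∀ X : F, ∀ x ∈ R, cl x = X → ConnOn S ((X : Finset α) ∪ comp S R x) := by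
    rintro X x hx rfl
    obtain ⟨a, ha, b, hb, hab⟩ := hga _ (mem_image_of_mem _ hx)
    rw [hclR x hx]
    exact (hFs _ (hgF _ (mem_image_of_mem _ hx))).1.union_of_adj (connOn_comp hx) hb ha hab.symm
  have hconn : HasSmallConnectors S cl s := by
    intro X Z hZ
    refine ⟨X ∪ (Z.filter fun z => z ∈ R).biUnion (comp S R), fun z hz => ?_, ?_, fun t ht => ?_, ?_⟩
    · by_cases hzR : z ∈ R
      · exact mem_union_right _ (mem_biUnion.2 ⟨z, mem_filter.2 ⟨hz, hzR⟩, mem_comp_self hzR⟩)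
      · refine mem_union_left _ ?_
        rw [← hZ z hz]
        exact hcl_notR z hzR
    · refine (hFs X X.2).1.union_biUnion _ _ fun z hz => ?_
      obtain ⟨hz, hzR⟩ := mem_filter.1 hz
      exact hcl_conn X z hzR (hZ z hz)
    · rcases mem_union.1 ht with ht | ht
      · exact hcl_core X t ht
      · obtain ⟨z, hz, ht⟩ := mem_biUnion.1 ht
        obtain ⟨hz, hzR⟩ := mem_filter.1 hz
        rw [hcl_comp z hzR t ht, hZ z hz]
    · have h₁ : ((Z.filter fun z => z ∈ R).biUnion (comp S R)).card ≤ Z.card * s :=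
        (card_biUnion_le_card_mul _ _ s fun z hz => (hsmall z (mem_filter.1 hz).2).le).trans
          (Nat.mul_le_mul_right _ (card_filter_le _ _))
      refine (card_union_le _ _).trans ?_
      rw [(hFs X X.2).2, mul_add, mul_one, mul_comm s Z.card]
      omega
  have : Nonempty F := ⟨cl (Classical.arbitrary α)⟩
  -- a cluster with few neighbouring clusters
  obtain ⟨X, hXdeg⟩ : ∃ X, (univ.filter fun j => (clusterGraph S cl).Adj X j).card < 2 * c + 4 := by
    by_contra! hdeg
    obtain ⟨A, B, hABp, hA, hB⟩ := hconn.exists_isSimplePumpkin hc hdeg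
    refine absurd (hAB A B hABp (by omega)) (not_lt.2 (hB.trans ?_))
    have hcard : Fintype.card F ≤ Fintype.card α := by
      have hinj : Function.Injective fun X : F => (hFs X X.2).1.1.choose := by
        intro X X' hXX
        have h₁ := hcl_core X _ (hFs X X.2).1.1.choose_spec
        have h₂ := hcl_core X' _ (hFs X' X'.2).1.1.choose_spec
        rw [← h₁, ← h₂]
        exact congrArg cl hXX
      exact Fintype.card_le_of_injective _ hinj
    have hlog : Nat.log 2 (Fintype.card F) ≤ Nat.log 2 (Fintype.card α) := Nat.log_mono_right hcard
    calc s * (3 * (c * (Nat.log 2 (Fintype.card F) + 2)) + c)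
        ≤ s * (3 * (c * (Nat.log 2 (Fintype.card α) + 2)) + c) := by gcongr
      _ ≤ s * (10 * (c + 1) * (Nat.log 2 (Fintype.card α) + 1)) := by
          gcongr
          nlinarith [Nat.zero_le (c * Nat.log 2 (Fintype.card α))]
      _ = 10 * (s * (c + 1)) * (Nat.log 2 (Fintype.card α) + 1) := by ring
      _ ≤ _ := Nat.mul_le_mul_right _ (by omega)
  set Y := univ.filter fun y => cl y = X with hY
  have hYmem : ∀ y, y ∈ Y ↔ cl y = X := fun y => by simp [hY]
  have hfr : (frontier S Y).card ≤ frontierBound c := by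
    have hsub : frontier S Y ⊆ (univ.filter fun j => (clusterGraph S cl).Adj X j).biUnion fun j =>
        Y.filter fun y => ∃ z, cl z = j ∧ S.Adj y z := by
      intro y hy
      obtain ⟨hyY, z, hz, hyz⟩ := mem_frontier.1 hy
      rw [hYmem] at hyY hz
      refine mem_biUnion.2 ⟨cl z, mem_filter.2 ⟨mem_univ _, fun h => hz h.symm, y, z, hyY, rfl, hyz⟩,
        mem_filter.2 ⟨(hYmem y).2 hyY, z, rfl, hyz⟩⟩
    refine (card_le_card hsub).trans ((card_biUnion_le_card_mul _ _ c fun j hj => ?_).trans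
      (Nat.mul_le_mul_right _ hXdeg.le))
    by_contra! hlt
    obtain ⟨I, hI, hIc⟩ := exists_subset_card_eq hlt.le
    have hz : ∀ y ∈ I, ∃ z, cl z = j ∧ S.Adj y z := fun y hy => (mem_filter.1 (hI hy)).2
    choose! z hzj hyz using hz
    obtain ⟨A, hA₁, hA₂, hA₃, hA₄⟩ := hconn X I fun y hy =>
      (hYmem y).1 (mem_filter.1 (hI hy)).1
    obtain ⟨B, hB₁, hB₂, hB₃, hB₄⟩ := hconn j (I.image z) fun w hw => by
      obtain ⟨y, hy, rfl⟩ := mem_image.1 hw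
      exact hzj y hy
    have hne := (mem_filter.1 hj).2.ne
    have hIz := card_image_le (s := I) (f := z)
    have hIz' : s * (1 + (I.image z).card) ≤ s * (1 + c) := Nat.mul_le_mul_left _ (by omega)
    rw [hIc] at hA₄
    refine hAB' A B (isSimplePumpkin_of_injOn ?_ hA₂ hB₂ I hIc.ge id z ?_ ?_) (by omega) (by omega)
    · exact disjoint_left.2 fun w hw hw' => hne ((hA₃ w hw).symm.trans (hB₃ w hw'))
    · exact fun y _ y' _ hyy => (Prod.mk.inj hyy).1
    · exact fun y hy => ⟨hA₁ hy, hB₁ (mem_image_of_mem z hy), hyz y hy⟩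
  have hYconn : ConnOn S Y := by
    obtain ⟨T, hT₁, hT₂, hT₃, -⟩ := hconn X Y fun y hy => (hYmem y).1 hy
    rwa [subset_antisymm hT₁ fun t ht => (hYmem t).2 (hT₃ t ht)]
  have hXY : (X : Finset α) ⊆ Y := fun x hx => (hYmem x).2 (hcl_core X x hx)
  -- the components in the cluster that have no neighbour outside the cluster
  set D := ((Y ∩ R).image (comp S R)).filter fun C => Disjoint C (frontier S Y) with hD
  have hDtwo : ∀ C ∈ D, ∃ u ∈ (X : Finset α), ∃ v ∈ (X : Finset α), u ≠ v ∧ (∃ a ∈ C, S.Adj u a) ∧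
      ∃ a ∈ C, S.Adj v a := by
    intro C hC
    obtain ⟨hC, hCf⟩ := mem_filter.1 hC
    obtain ⟨x, hx, rfl⟩ := mem_image.1 hC
    obtain ⟨hxY, hxR⟩ := mem_inter.1 hx
    rw [hYmem] at hxY
    obtain ⟨a, ha, u, hu, hau⟩ := hga _ (mem_image_of_mem _ hxR)
    rw [← hclR x hxR, hxY] at hu
    by_contra! hno
    refine absurd (hX _ (hP.of_separation (u := u) (v := u) (connOn_comp hxR)
      (fun w hw b hwb => ?_) (.inl rfl))) (not_lt.2 ?_)
    · have hwY : w ∈ Y := by rw [hYmem, hcl_comp x hxR w hw, hxY]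
      have hbY := mem_of_adj_of_notMem_frontier hwY (disjoint_left.1 hCf hw) hwb
      by_cases hbR : b ∈ R
      · exact .inl (mem_comp_of_adj hw hbR hwb)
      · have hbX := hcl_notR b hbR
        rw [(hYmem b).1 hbY] at hbX
        refine .inr (.inl ?_)
        by_contra hbu
        exact hno u hu b hbX (Ne.symm hbu) ⟨a, ha, hau.symm⟩ w hw hwb.symm
    · have h₁ := card_union_le (comp S R x) {u, u}
      have h₂ := card_le_two (a := u) (b := u)
      have h₃ := hsmall x hxR
      omega
  choose! f₁ hf₁ f₂ hf₂ hf hf₁' hf₂' using hDtwo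
  have hDR : ∀ C ∈ D, ∃ x ∈ R, C = comp S R x := by
    intro C hC
    obtain ⟨x, hx, rfl⟩ := mem_image.1 (mem_filter.1 hC).1
    exact ⟨x, (mem_inter.1 hx).2, rfl⟩
  have hDc : D.card ≤ c * s ^ 2 := by
    have := card_le_mul_card_image_of_maps_to (s := D)
      (t := (X : Finset α) ×ˢ (X : Finset α)) (f := fun C => (f₁ C, f₂ C))
      (fun C hC => mem_product.2 ⟨hf₁ C hC, hf₂ C hC⟩) c ?_
    · rwa [card_product, (hFs X X.2).2, ← pow_two] at this
    rintro ⟨u, v⟩ -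
    by_contra! hlt
    obtain ⟨I, hI, hIc⟩ := exists_subset_card_eq hlt.le
    have hI₁ : ∀ C ∈ I, C ∈ D ∧ f₁ C = u ∧ f₂ C = v := fun C hC => by
      obtain ⟨h₁, h₂⟩ := mem_filter.1 (hI hC)
      exact ⟨h₁, Prod.mk.inj h₂⟩
    obtain ⟨C₀, hC₀⟩ : I.Nonempty := card_pos.1 (by omega)
    have huX : u ∈ (X : Finset α) := by
      obtain ⟨h₁, h₂, -⟩ := hI₁ C₀ hC₀
      rw [← h₂]; exact hf₁ C₀ h₁
    have huv : u ≠ v := by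
      obtain ⟨h₁, h₂, h₃⟩ := hI₁ C₀ hC₀
      rw [← h₂, ← h₃]; exact hf C₀ h₁
    have hz : ∀ C ∈ I, ∃ a ∈ C, S.Adj u a := fun C hC => by
      obtain ⟨h₁, h₂, -⟩ := hI₁ C hC
      rw [← h₂]; exact hf₁' C h₁
    choose! z hzC huz using hz
    refine hAB' {u} ({v} ∪ I.biUnion id) (isSimplePumpkin_of_injOn ?_ (connOn_singleton u) ?_ I
      hIc.ge (fun _ => u) z ?_ ?_) ?_ ?_
    · simp only [disjoint_singleton_left, mem_union, mem_singleton, mem_biUnion, id, not_or,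
        not_exists, not_and]
      refine ⟨huv, fun C hC huC => ?_⟩
      obtain ⟨x, hx, rfl⟩ := hDR C (hI₁ C hC).1
      exact hFR X X.2 u huX (comp_subset huC)
    · refine (connOn_singleton v).union_biUnion I id fun C hC => ?_
      obtain ⟨h₁, -, h₃⟩ := hI₁ C hC
      obtain ⟨a, ha, hva⟩ := hf₂' C h₁
      rw [h₃] at hva
      obtain ⟨x, hx, rfl⟩ := hDR C h₁
      exact (connOn_singleton v).union_of_adj (connOn_comp hx) (mem_singleton_self v) ha hva
    · intro C hC C' hC' hCC
      obtain ⟨x, hx, hCx⟩ := hDR C (hI₁ C hC).1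
      obtain ⟨x', hx', hCx'⟩ := hDR C' (hI₁ C' hC').1
      have h₁ : z C ∈ comp S R x := hCx ▸ hzC C hC
      have h₂ : z C' ∈ comp S R x' := hCx' ▸ hzC C' hC'
      rw [← show z C = z C' from (Prod.mk.inj hCC).2] at h₂
      rw [hCx, hCx', ← comp_eq_of_mem h₁, comp_eq_of_mem h₂]
    · exact fun C hC => ⟨mem_singleton_self u,
        mem_union_right _ (mem_biUnion.2 ⟨C, hC, hzC C hC⟩), huz C hC⟩
    · rw [card_singleton]
      omega
    · have h₁ := card_union_le {v} (I.biUnion id)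
      have h₂ := card_biUnion_le_card_mul I id s fun C hC => by
        obtain ⟨x, hx, rfl⟩ := hDR C (hI₁ C hC).1
        exact (hsmall x hx).le
      rw [card_singleton] at h₁
      rw [hIc] at h₂
      omega
  have hYc : Y.card ≤ sizeBound c := by
    have hsub : Y ⊆ (X : Finset α) ∪ ((frontier S Y ∩ R).image (comp S R) ∪ D).biUnion id := by
      intro y hy
      by_cases hyR : y ∈ R
      · refine mem_union_right _ (mem_biUnion.2 ⟨comp S R y, ?_, mem_comp_self hyR⟩)
        by_cases hd : Disjoint (comp S R y) (frontier S Y)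
        · exact mem_union_right _
            (mem_filter.2 ⟨mem_image_of_mem _ (mem_inter.2 ⟨hy, hyR⟩), hd⟩)
        · obtain ⟨w, hw, hwf⟩ := not_disjoint_iff.1 hd
          rw [← comp_eq_of_mem hw]
          exact mem_union_left _
            (mem_image_of_mem _ (mem_inter.2 ⟨hwf, comp_subset hw⟩))
      · refine mem_union_left _ ?_
        rw [← (hYmem y).1 hy]
        exact hcl_notR y hyR
    have h₁ := card_biUnion_le_card_mul ((frontier S Y ∩ R).image (comp S R) ∪ D) id s
      fun C hC => by
        rcases mem_union.1 hC with hC | hC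
        · obtain ⟨x, hx, rfl⟩ := mem_image.1 hC
          exact (hsmall x (mem_inter.1 hx).2).le
        · obtain ⟨x, hx, rfl⟩ := hDR C hC
          exact (hsmall x hx).le
    have h₂ : ((frontier S Y ∩ R).image (comp S R) ∪ D).card ≤ frontierBound c + c * s ^ 2 :=
      (card_union_le _ _).trans (add_le_add (card_image_le.trans
        ((card_le_card inter_subset_left).trans hfr)) hDc)
    have h₃ := (card_le_card hsub).trans (card_union_le _ _)
    rw [(hFs X X.2).2] at h₃
    have h₄ := h₁.trans (Nat.mul_le_mul_right s h₂)
    omega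
  have hYP : ¬ P Y := fun h => absurd (hX Y h) (not_lt.2 hYc)
  have hlow := card_le_card hXY
  rw [(hFs X X.2).2] at hlow
  have hup := hP.card_le_pieceBound hc hYconn hYP hfr
  have hs' : s = pieceBound c (frontierBound c) + 1 := rfl
  omega

end

end Core

/-! ### Reduced multigraphs -/

section Reduced

variable {α : Type u} {β : Type v} {G H : Graph α β} {c : ℕ} {A B W X : Set α} {a b x y z : α}

lemma induce_adj : (G.induce X).Adj a b ↔ a ∈ X ∧ b ∈ X ∧ G.Adj a b :=
  ⟨fun ⟨e, h⟩ => ⟨h.2.1, h.2.2, e, h.1⟩, fun ⟨ha, hb, e, h⟩ => ⟨e, h, ha, hb⟩⟩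

lemma deleteVerts_adj : (G.deleteVerts X).Adj a b ↔ a ∉ X ∧ b ∉ X ∧ G.Adj a b := by
  rw [Graph.deleteVerts, induce_adj]
  exact ⟨fun ⟨h₁, h₂, h₃⟩ => ⟨h₁.2, h₂.2, h₃⟩,
    fun ⟨h₁, h₂, h₃⟩ => ⟨⟨h₃.left_mem, h₁⟩, ⟨h₃.right_mem, h₂⟩, h₃⟩⟩

lemma connected_induce_mono (h : H ≤ G) (hA : Connected (H.induce A)) : Connected (G.induce A) := by
  refine ⟨hA.1, fun x hx y hy => Relation.ReflTransGen.mono ?_ _ _ (hA.2 x hx y hy)⟩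
  intro a b hab
  obtain ⟨h₁, h₂, h₃⟩ := induce_adj.1 hab
  exact induce_adj.2 ⟨h₁, h₂, h₃.mono h⟩

lemma IsPumpkinModel.mono (h : H ≤ G) (hAB : IsPumpkinModel c H A B) : IsPumpkinModel c G A B where
  left_subset := hAB.left_subset.trans h.vertexSet_mono
  right_subset := hAB.right_subset.trans h.vertexSet_mono
  disjoint := hAB.disjoint
  left_connected := connected_induce_mono h hAB.left_connected
  right_connected := connected_induce_mono h hAB.right_connected
  le_encard := hAB.le_encard.trans (Set.encard_le_encard
    fun _ ⟨a, ha, b, hb, hl⟩ => ⟨a, ha, b, hb, hl.mono h⟩)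

lemma mem_of_reach_of_closed {r : α → α → Prop} (hcl : ∀ w ∈ W, ∀ y, r w y → y ∈ W) (hx : x ∈ W)
    (h : Relation.ReflTransGen r x y) : y ∈ W := by
  induction h with
  | refl => exact hx
  | tail _ hbc ih => exact hcl _ ih _ hbc

/-- If the first rule does not apply, then a set that is separated from the rest of the graph by a
vertex includes a pumpkin-model together with this vertex: a block that meets the set cannot leave
it except through this vertex, which would be a cutvertex of the block. -/
lemma exists_model_of_closed (hG : ¬ ∃ v, RuleZ1Applies c G v) (hx : x ∈ W) (hxG : x ∈ V(G))
    (hcl : ∀ w ∈ W, ∀ y, G.Adj w y → y ∈ W ∨ y = z) :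
    ∃ A B, IsPumpkinModel c G A B ∧ A ⊆ insert z W ∧ B ⊆ insert z W := by
  simp only [RuleZ1Applies, not_exists, not_and, not_forall, not_not] at hG
  obtain ⟨K, ⟨⟨hKG, hKc, hKcut⟩, -⟩, hxK, A, B, hAB⟩ := hG x hxG
  suffices hK : V(K) ⊆ insert z W from
    ⟨A, B, hAB.mono hKG, hAB.left_subset.trans hK, hAB.right_subset.trans hK⟩
  intro y hy
  by_contra hyW
  have hyz : y ≠ z := fun h => hyW (.inl h)
  have hyW' : y ∉ W := fun h => hyW (.inr h)
  have hxy := hKc.2 x hxK y hy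
  by_cases hz : z ∈ V(K) ∧ z ∉ W
  · refine hKcut z ⟨hz.1, x, hxK, y, hy, fun h => hz.2 (h ▸ hx), hyz, hxy, fun h => hyW' ?_⟩
    refine mem_of_reach_of_closed (fun w hw y' hwy => ?_) hx h
    obtain ⟨-, h₂, h₃⟩ := deleteVerts_adj.1 hwy
    exact (hcl w hw y' (h₃.mono hKG)).resolve_right h₂
  · refine hyW' (mem_of_reach_of_closed (fun w hw y' hwy => ?_) hx hxy)
    rcases hcl w hw y' (hwy.mono hKG) with h | rfl
    · exact h
    · by_contra h
      exact hz ⟨hwy.right_mem, h⟩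

/-- If no rule applies, then a connected set that is separated from the rest of the graph by one
vertex, or has at least two elements and is separated by two vertices, includes a pumpkin-model
together with these vertices. -/
lemma IsReduced.exists_model (hG : IsReduced c G) (hWG : W ⊆ V(G)) (hW : Connected (G.induce W))
    {u v : α} (hcl : ∀ w ∈ W, ∀ y, G.Adj w y → y ∈ W ∨ y = u ∨ y = v)
    (huv : u = v ∨ 2 ≤ W.encard) :
    ∃ A B, IsPumpkinModel c G A B ∧ A ⊆ W ∪ {u, v} ∧ B ⊆ W ∪ {u, v} := by
  obtain ⟨x, hx⟩ := hW.1
  have hx : x ∈ W := hx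
  -- if one vertex suffices, then the first rule is used
  have hone : ∀ z, (z = u ∨ z = v) → (∀ w ∈ W, ∀ y, G.Adj w y → y ∈ W ∨ y = z) →
      ∃ A B, IsPumpkinModel c G A B ∧ A ⊆ W ∪ {u, v} ∧ B ⊆ W ∪ {u, v} := by
    intro z hz hclz
    obtain ⟨A, B, h, hA, hB⟩ := exists_model_of_closed hG.1 hx (hWG hx) hclz
    have hsub : insert z W ⊆ W ∪ {u, v} := by
      rintro y (rfl | hy)
      · exact .inr hz
      · exact .inl hy
    exact ⟨A, B, h, hA.trans hsub, hB.trans hsub⟩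
  by_cases hu : u ∉ W ∧ ∃ w ∈ W, G.Adj u w
  swap
  · refine hone v (.inr rfl) fun w hw y hwy => ?_
    rcases hcl w hw y hwy with h | rfl | h
    · exact .inl h
    · by_contra! h
      exact hu ⟨h.1, w, hw, hwy.symm⟩
    · exact .inr h
  by_cases hv : v ∉ W ∧ ∃ w ∈ W, G.Adj v w
  swap
  · refine hone u (.inl rfl) fun w hw y hwy => ?_
    rcases hcl w hw y hwy with h | h | rfl
    · exact .inl h
    · exact .inr h
    · by_contra! h
      exact hv ⟨h.1, w, hw, hwy.symm⟩
  by_cases huv' : u = v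
  · subst huv'
    exact hone u (.inl rfl) fun w hw y hwy => by simpa using hcl w hw y hwy
  have h2 : 2 ≤ W.encard := huv.resolve_left huv'
  have hWdel : G.induce W ≤ G.deleteVerts {u, v} := by
    refine ⟨fun w hw => ⟨hWG hw, ?_⟩, fun e a b hab => ?_⟩
    · rintro (rfl | rfl)
      · exact hu.1 hw
      · exact hv.1 hw
    · obtain ⟨h₁, h₂, h₃⟩ := hab
      refine ⟨h₁, ⟨hWG h₂, ?_⟩, hWG h₃, ?_⟩
      · rintro (rfl | rfl)
        · exact hu.1 h₂
        · exact hv.1 h₂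
      · rintro (rfl | rfl)
        · exact hu.1 h₃
        · exact hv.1 h₃
  have hout : IsOutgrowth G (G.induce W) u v := by
    obtain ⟨wu, hwu, hu'⟩ := hu.2
    obtain ⟨wv, hwv, hv'⟩ := hv.2
    refine ⟨hu'.left_mem, hv'.left_mem, huv', ⟨⟨hWdel, hW⟩, ?_⟩, h2, ⟨wu, hwu, hu'⟩, ⟨wv, hwv, hv'⟩⟩
    rintro K ⟨hK, hKc⟩ hWK
    have hKW : V(K) ⊆ W := by
      intro y hy
      refine mem_of_reach_of_closed (fun w hw y' hwy => ?_) hx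
        (hKc.2 x (hWK.vertexSet_mono hx) y hy)
      obtain ⟨-, h₂, h₃⟩ := deleteVerts_adj.1 (hwy.mono hK)
      rcases hcl w hw y' h₃ with h | rfl | rfl
      · exact h
      · exact absurd (.inl rfl) h₂
      · exact absurd (.inr rfl) h₂
    exact ⟨hKW, fun e a b hab =>
      ⟨(hab.mono hK).1, hKW hab.left_mem, hKW hab.right_mem⟩⟩
  have hmod : HasPumpkinMinor c (outgrowthGraph G (G.induce W) u v) := by
    by_contra hno
    exact hG.2 ⟨_, u, v, hout, hno, hG.1⟩
  obtain ⟨A, B, hAB⟩ := hmod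
  have hle : outgrowthGraph G (G.induce W) u v ≤ G.induce (W ∪ {u, v}) := Graph.deleteEdges_le
  have hsub : W ∪ {u, v} ⊆ V(G) := by
    rintro y (hy | rfl | rfl)
    · exact hWG hy
    · exact hout.left_mem
    · exact hout.right_mem
  exact ⟨A, B, hAB.mono (hle.trans (Graph.induce_le hsub)),
    hAB.left_subset.trans hle.vertexSet_mono, hAB.right_subset.trans hle.vertexSet_mono⟩

/-- The simple graph that underlies a loopless multigraph. -/
def underlying (G : Graph α β) (hG : G.Loopless) : SimpleGraph V(G) where
  Adj x y := G.Adj x y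
  symm := ⟨fun _ _ h => h.symm⟩
  loopless := ⟨fun x ⟨e, h⟩ => hG.not_isLoopAt e x h⟩

lemma connected_induce_image_iff {hG : G.Loopless} {X : Finset V(G)} :
    Connected (G.induce (Subtype.val '' (X : Set V(G)))) ↔ ConnOn (underlying G hG) X := by
  constructor
  · rintro ⟨⟨x, hx⟩, h⟩
    obtain ⟨x, hx, rfl⟩ := hx
    refine connOn_of_root hx fun y hy => ?_
    have hxy := h x ⟨x, hx, rfl⟩ y ⟨y, hy, rfl⟩
    generalize hz : (y : α) = z at hxy
    clear hy
    induction hxy generalizing y with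
    | refl => rw [Subtype.ext hz]
    | @tail b c _ hbc ih =>
      obtain ⟨⟨b, hb, rfl⟩, ⟨c', hc', hcc⟩, hadj⟩ := induce_adj.1 hbc
      obtain rfl : c' = y := Subtype.ext (hcc.trans hz.symm)
      rw [← hz] at hadj
      exact (ih b rfl).tail ⟨hb, hc', hadj⟩
  · rintro ⟨⟨x, hx⟩, h⟩
    refine ⟨⟨x, x, hx, rfl⟩, ?_⟩
    rintro _ ⟨x, hx, rfl⟩ _ ⟨y, hy, rfl⟩
    have hxy := h x hx y hy
    clear hy
    induction hxy with
    | refl => exact .refl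
    | @tail b c _ hbc ih =>
      exact ih.tail (induce_adj.2 ⟨⟨b, hbc.1, rfl⟩, ⟨c, hbc.2.1, rfl⟩, hbc.2.2⟩)

lemma isPumpkinModel_image {hG : G.Loopless} {A B : Finset V(G)}
    (h : IsSimplePumpkin (underlying G hG) c A B) :
    IsPumpkinModel c G (Subtype.val '' (A : Set V(G))) (Subtype.val '' (B : Set V(G))) where
  left_subset := by rintro _ ⟨x, -, rfl⟩; exact x.2
  right_subset := by rintro _ ⟨x, -, rfl⟩; exact x.2
  disjoint := by
    rw [Set.disjoint_image_iff Subtype.val_injective]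
    exact_mod_cast h.disjoint
  left_connected := connected_induce_image_iff.2 h.left_conn
  right_connected := connected_induce_image_iff.2 h.right_conn
  le_encard := by
    obtain ⟨E, hE, hadj⟩ := h.exists_edges
    rcases E.eq_empty_or_nonempty with rfl | ⟨e₀, he₀⟩
    · have : c = 0 := by simpa using hE
      simp [this]
    have hlink : ∀ p ∈ E, ∃ e, G.IsLink e p.1 p.2 := fun p hp => (hadj p hp).2.2
    have : Nonempty β := ⟨(hlink e₀ he₀).choose⟩
    choose! f hf using hlink
    have hmaps : f '' (E : Set (V(G) × V(G))) ⊆ edgesBetween G (Subtype.val '' (A : Set V(G)))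
        (Subtype.val '' (B : Set V(G))) := by
      rintro _ ⟨p, hp, rfl⟩
      obtain ⟨hA, hB, -⟩ := hadj p hp
      exact ⟨p.1, ⟨p.1, hA, rfl⟩, p.2, ⟨p.2, hB, rfl⟩, hf p hp⟩
    have hinj : Set.InjOn f (E : Set (V(G) × V(G))) := by
      intro p hp q hq hpq
      have h₁ := hf p hp
      rw [hpq] at h₁
      rcases h₁.eq_and_eq_or_eq_and_eq (hf q hq) with ⟨h₂, h₃⟩ | ⟨h₂, -⟩
      · exact Prod.ext (Subtype.ext h₂) (Subtype.ext h₃)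
      · refine absurd (hadj q hq).2.1 ?_
        rw [← Subtype.ext h₂]
        exact Finset.disjoint_left.1 h.disjoint (hadj p hp).1
    refine le_trans ?_ (Set.encard_le_encard hmaps)
    rw [hinj.encard_image, Set.encard_coe_eq_coe_finsetCard]
    exact_mod_cast hE

open scoped Classical in
lemma IsReduced.isPumpkinFamily (hG : IsReduced c G) (hl : G.Loopless) :
    IsPumpkinFamily (underlying G hl) c fun X => ∃ A B, IsPumpkinModel c G A B ∧
      A ⊆ Subtype.val '' (X : Set V(G)) ∧ B ⊆ Subtype.val '' (X : Set V(G)) where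
  mono := fun ⟨A, B, h, hA, hB⟩ hXY =>
    ⟨A, B, h, hA.trans (Set.image_mono (by exact_mod_cast hXY)),
      hB.trans (Set.image_mono (by exact_mod_cast hXY))⟩
  of_pumpkin := fun h => ⟨_, _, isPumpkinModel_image h,
    Set.image_mono (by simp), Set.image_mono (by simp)⟩
  of_separation := by
    intro W u v hW hcl huv
    have hcl' : ∀ w ∈ Subtype.val '' (W : Set V(G)), ∀ y, G.Adj w y →
        y ∈ Subtype.val '' (W : Set V(G)) ∨ y = u ∨ y = v := by
      rintro _ ⟨w, hw, rfl⟩ y hwy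
      rcases hcl w hw ⟨y, hwy.right_mem⟩ hwy with h | h | h
      · exact .inl ⟨_, h, rfl⟩
      · exact .inr (.inl (congrArg Subtype.val h))
      · exact .inr (.inr (congrArg Subtype.val h))
    have huv' : (u : α) = v ∨ 2 ≤ (Subtype.val '' (W : Set V(G))).encard := by
      refine huv.imp (congrArg Subtype.val) fun h => ?_
      rw [Subtype.val_injective.encard_image, Set.encard_coe_eq_coe_finsetCard]
      exact_mod_cast h
    obtain ⟨A, B, h, hA, hB⟩ := hG.exists_model
      (by rintro _ ⟨x, -, rfl⟩; exact x.2) (connected_induce_image_iff.2 hW) hcl' huv'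
    refine ⟨A, B, h, hA.trans ?_, hB.trans ?_⟩ <;>
    · rintro _ (⟨x, hx, rfl⟩ | rfl | rfl)
      · exact ⟨x, by simp [Finset.mem_coe.1 hx], rfl⟩
      · exact ⟨u, by simp, rfl⟩
      · exact ⟨v, by simp, rfl⟩

/-- A reduced graph has a pumpkin-model with one side of bounded and one side of logarithmic
size. -/
theorem IsReduced.exists_small_model (hG : IsReduced c G) (hc : 1 ≤ c) (hV : V(G).Finite)
    (hl : G.Loopless) (hne : V(G).Nonempty) :
    ∃ A B, IsPumpkinModel c G A B ∧ A.ncard ≤ sizeBound c ∧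
      B.ncard ≤ sizeBound c * (Nat.log 2 V(G).ncard + 1) := by
  have : Fintype V(G) := hV.fintype
  have : Nonempty V(G) := hne.to_subtype
  have hcard : ∀ X : Finset V(G), (Subtype.val '' (X : Set V(G))).ncard = X.card := fun X => by
    rw [Set.ncard_image_of_injective _ Subtype.val_injective, Set.ncard_coe_finset]
  rcases (hG.isPumpkinFamily hl).exists_small hc with ⟨X, ⟨A, B, h, hA, hB⟩, hX⟩ | ⟨A, B, h, hA, hB⟩
  · have hfin : (Subtype.val '' (X : Set V(G))).Finite := X.finite_toSet.image _
    refine ⟨A, B, h, ?_, ?_⟩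
    · exact (Set.ncard_le_ncard hA hfin).trans ((hcard X).trans_le hX)
    · refine (Set.ncard_le_ncard hB hfin).trans ((hcard X).trans_le (hX.trans ?_))
      exact Nat.le_mul_of_pos_right _ (Nat.succ_pos _)
  · refine ⟨_, _, isPumpkinModel_image h, (hcard A).trans_le hA, (hcard B).trans_le ?_⟩
    rwa [← Nat.card_coe_set_eq, Nat.card_eq_fintype_card]

end Reduced

/-! ### Programs with counting loops -/

/-- Programs all of whose loops are counting loops: `count x b p` runs `p` for the values
`0, …, k - 1` of the register `x`, where `k` is the content of the register `b`. -/
inductive Code where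
  | skip
  | assign (x : ℕ) (e : Expr)
  | store (a : ℕ) (i e : Expr)
  | seq (p q : Code)
  | ite (e : Expr) (p q : Code)
  | count (x b : ℕ) (p : Code)

namespace Code

/-- Iterate the step of a counting loop. -/
def iterate (x : ℕ) (f : State → State) : ℕ → State → State
  | 0, s => s.setVar x 0
  | i + 1, s => (f (iterate x f i s)).setVar x (i + 1)

/-- The final state of a program. -/
def run : Code → State → State
  | skip, s => s
  | assign x e, s => s.setVar x (e.eval s)
  | store a i e, s => s.setArr a (i.eval s) (e.eval s)
  | seq p q, s => q.run (p.run s)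
  | ite e p q, s => if e.eval s ≠ 0 then p.run s else q.run s
  | count x b p, s => iterate x p.run (s.var b) s

/-- Counting loops as `while` loops. -/
def toProgram : Code → Program
  | skip => .skip
  | assign x e => .assign x e
  | store a i e => .store a i e
  | seq p q => .seq p.toProgram q.toProgram
  | ite e p q => .ite e p.toProgram q.toProgram
  | count x b p => .seq (.assign x (.const 0))
      (.loop (.sub (.var b) (.var x)) (.seq p.toProgram (.assign x (.add (.var x) (.const 1)))))

/-- The program may change the scalar register `y`. -/
def WritesVar : Code → ℕ → Prop
  | skip, _ => False
  | assign x _, y => y = x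
  | store _ _ _, _ => False
  | seq p q, y => p.WritesVar y ∨ q.WritesVar y
  | ite _ p q, y => p.WritesVar y ∨ q.WritesVar y
  | count x _ p, y => y = x ∨ p.WritesVar y

/-- The program may change the array `y`. -/
def WritesArr : Code → ℕ → Prop
  | skip, _ => False
  | assign _ _, _ => False
  | store a _ _, y => y = a
  | seq p q, y => p.WritesArr y ∨ q.WritesArr y
  | ite _ p q, y => p.WritesArr y ∨ q.WritesArr y
  | count _ _ p, y => p.WritesArr y

/-- The registers `0`, `1` and `2` are not changed and are the only ones that bound loops, and the
body of a loop does not change the register of the loop. -/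
def IsSafe : Code → Prop
  | skip => True
  | assign x _ => 3 ≤ x
  | store _ _ _ => True
  | seq p q => p.IsSafe ∧ q.IsSafe
  | ite _ p q => p.IsSafe ∧ q.IsSafe
  | count x b p => 3 ≤ x ∧ b < 3 ∧ p.IsSafe ∧ ¬ p.WritesVar x

end Code

@[simp] lemma State.setVar_var (s : State) (x k y : ℕ) :
    (s.setVar x k).var y = if y = x then k else s.var y := by
  simp [State.setVar, Function.update_apply]

@[simp] lemma State.setVar_arr (s : State) (x k : ℕ) : (s.setVar x k).arr = s.arr := rfl

@[simp] lemma State.setArr_var (s : State) (a i k : ℕ) : (s.setArr a i k).var = s.var := rfl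

@[simp] lemma State.setArr_arr (s : State) (a i k b : ℕ) :
    (s.setArr a i k).arr b = if b = a then Function.update (s.arr a) i k else s.arr b := by
  by_cases h : b = a
  · subst h; simp [State.setArr]
  · simp [State.setArr, h]

namespace Code

lemma IsSafe.three_le {p : Code} (hp : p.IsSafe) {y : ℕ} (hy : p.WritesVar y) : 3 ≤ y := by
  induction p with
  | skip => exact hy.elim
  | assign x e => exact hy ▸ hp
  | store => exact hy.elim
  | seq p q ihp ihq => exact hy.elim (ihp hp.1) (ihq hp.2)
  | ite e p q ihp ihq => exact hy.elim (ihp hp.1) (ihq hp.2)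
  | count x b p ih => exact hy.elim (fun h => h ▸ hp.1) (ih hp.2.2.1)

lemma run_var (p : Code) {y : ℕ} (hy : ¬ p.WritesVar y) (s : State) :
    (p.run s).var y = s.var y := by
  induction p generalizing s with
  | skip => rfl
  | assign x e => simp [run, show y ≠ x from hy]
  | store => rfl
  | seq p q ihp ihq =>
    rw [WritesVar, not_or] at hy
    rw [run, ihq hy.2, ihp hy.1]
  | ite e p q ihp ihq =>
    rw [WritesVar, not_or] at hy
    rw [run]
    split_ifs
    · exact ihp hy.1 s
    · exact ihq hy.2 s
  | count x b p ih =>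
    rw [WritesVar, not_or] at hy
    rw [run]
    induction s.var b with
    | zero => simp [iterate, hy.1]
    | succ i ihi => rw [iterate, State.setVar_var, if_neg hy.1, ih hy.2, ihi]

lemma run_arr (p : Code) {y : ℕ} (hy : ¬ p.WritesArr y) (s : State) :
    (p.run s).arr y = s.arr y := by
  induction p generalizing s with
  | skip => rfl
  | assign x e => rfl
  | store a i e => simp [run, show y ≠ a from hy]
  | seq p q ihp ihq =>
    rw [WritesArr, not_or] at hy
    rw [run, ihq hy.2, ihp hy.1]
  | ite e p q ihp ihq =>
    rw [WritesArr, not_or] at hy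
    rw [run]
    split_ifs
    · exact ihp hy.1 s
    · exact ihq hy.2 s
  | count x b p ih =>
    rw [run]
    induction s.var b with
    | zero => rfl
    | succ i ihi => rw [iterate, State.setVar_arr, ih hy, ihi]

lemma iterate_var_self (x : ℕ) (f : State → State) (i : ℕ) (s : State) :
    (iterate x f i s).var x = i := by
  cases i <;> simp [iterate]

/-- The invariant rule for counting loops. -/
lemma run_count_induction {x b : ℕ} {p : Code} {s : State} (I : ℕ → State → Prop)
    (h₀ : I 0 (s.setVar x 0))
    (h₁ : ∀ i < s.var b, ∀ s', s'.var x = i → I i s' → I (i + 1) ((p.run s').setVar x (i + 1))) :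
    I (s.var b) ((count x b p).run s) := by
  have : ∀ i ≤ s.var b, I i (iterate x p.run i s) := by
    intro i
    induction i with
    | zero => exact fun _ => h₀
    | succ i ih => exact fun hi => h₁ i hi _ (iterate_var_self ..) (ih (by omega))
  exact this _ le_rfl

/-- A program with counting loops over the numbers below `N` halts, after a number of steps that
is polynomial in `N`. -/
theorem exists_runs {p : Code} (hp : p.IsSafe) : ∃ P : Polynomial ℕ, ∀ (N : ℕ) (s : State),
    (∀ b < 3, s.var b ≤ N) → ∃ t ≤ P.eval N, Runs p.toProgram s t (p.run s) := by
  induction p with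
  | skip => exact ⟨1, fun N s _ => ⟨1, by simp, .skip s⟩⟩
  | assign x e => exact ⟨.C (e.cost + 1), fun N s _ => ⟨e.cost + 1, by simp, .assign x e s⟩⟩
  | store a i e =>
    exact ⟨.C (i.cost + e.cost + 1), fun N s _ => ⟨i.cost + e.cost + 1, by simp, .store a i e s⟩⟩
  | seq p q ihp ihq =>
    obtain ⟨P, hP⟩ := ihp hp.1
    obtain ⟨Q, hQ⟩ := ihq hp.2
    refine ⟨P + Q, fun N s hs => ?_⟩
    obtain ⟨t, ht, hr⟩ := hP N s hs
    obtain ⟨t', ht', hr'⟩ := hQ N (p.run s) fun b hb => by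
      rw [run_var p (fun h => absurd (hp.1.three_le h) (by omega))]
      exact hs b hb
    exact ⟨t + t', by rw [Polynomial.eval_add]; omega, hr.seq hr'⟩
  | ite e p q ihp ihq =>
    obtain ⟨P, hP⟩ := ihp hp.1
    obtain ⟨Q, hQ⟩ := ihq hp.2
    refine ⟨.C (e.cost + 1) + (P + Q), fun N s hs => ?_⟩
    rw [Polynomial.eval_add, Polynomial.eval_add, Polynomial.eval_C, run]
    split_ifs with h
    · obtain ⟨t, ht, hr⟩ := hP N s hs
      exact ⟨_, by omega, .ite_true h hr⟩
    · obtain ⟨t, ht, hr⟩ := hQ N s hs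
      exact ⟨_, by omega, .ite_false (not_not.1 h) hr⟩
  | count x b p ih =>
    obtain ⟨hx, hb, hp, hpx⟩ := hp
    obtain ⟨P, hP⟩ := ih hp
    refine ⟨.X * (P + 8) + 6, fun N s hs => ?_⟩
    have hfix : ∀ i, ∀ b < 3, (iterate x p.run i s).var b = s.var b := by
      intro i b hb
      induction i with
      | zero => simp [iterate, show b ≠ x by omega]
      | succ i ih =>
        rw [iterate, State.setVar_var, if_neg (by omega),
          run_var p (fun h => absurd (hp.three_le h) (by omega)), ih]
    have hloop : ∀ k i, i + k = s.var b → ∃ t ≤ k * (P.eval N + 8) + 4,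
        Runs (.loop (.sub (.var b) (.var x))
          (.seq p.toProgram (.assign x (.add (.var x) (.const 1))))) (iterate x p.run i s) t
          (iterate x p.run (s.var b) s) := by
      intro k
      induction k with
      | zero =>
        rintro i rfl
        refine ⟨4, by omega, .loop_false ?_⟩
        simp [Expr.eval, iterate_var_self, hfix _ b hb]
      | succ k ihk =>
        intro i hi
        obtain ⟨t, ht, hr⟩ := hP N (iterate x p.run i s) fun b hb => by
          rw [hfix i b hb]; exact hs b hb
        obtain ⟨t', ht', hr'⟩ := ihk (i + 1) (by omega)
        have hstep : Runs (.assign x (.add (.var x) (.const 1))) (p.run (iterate x p.run i s)) 4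
            (iterate x p.run (i + 1) s) := by
          have h := Runs.assign x (.add (.var x) (.const 1)) (p.run (iterate x p.run i s))
          simp only [Expr.eval, run_var p hpx, iterate_var_self] at h
          exact h
        refine ⟨3 + 1 + (t + 4) + t', by rw [add_mul]; omega, .loop_true ?_ (hr.seq hstep) hr'⟩
        simp only [Expr.eval, iterate_var_self, hfix _ b hb]
        omega
    obtain ⟨t, ht, hr⟩ := hloop (s.var b) 0 (by omega)
    refine ⟨2 + t, ?_, .seq (.assign x (.const 0) s) hr⟩
    have h₁ : s.var b * (P.eval N + 8) ≤ N * (P.eval N + 8) := Nat.mul_le_mul_right _ (hs b hb)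
    have h₂ : (Polynomial.X * (P + 8) + 6 : Polynomial ℕ).eval N = N * (P.eval N + 8) + 6 := by
      simp
    omega

/-- Nested counting loops; the list consists of the registers of the loops and the registers that
bound them. -/
def nest : List (ℕ × ℕ) → Code → Code
  | [], p => p
  | (x, b) :: l, p => count x b (nest l p)

lemma writesVar_nest {l : List (ℕ × ℕ)} {p : Code} {y : ℕ} :
    (nest l p).WritesVar y ↔ y ∈ l.map Prod.fst ∨ p.WritesVar y := by
  induction l with
  | nil => simp [nest]
  | cons a l ih => simp [nest, WritesVar, ih, or_assoc]

lemma isSafe_nest {l : List (ℕ × ℕ)} {p : Code} (hp : p.IsSafe) (hl : ∀ a ∈ l, 3 ≤ a.1 ∧ a.2 < 3)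
    (hnd : (l.map Prod.fst).Nodup) (hpl : ∀ a ∈ l, ¬ p.WritesVar a.1) : (nest l p).IsSafe := by
  induction l with
  | nil => exact hp
  | cons a l ih =>
    rw [List.map_cons, List.nodup_cons] at hnd
    refine ⟨(hl a (by simp)).1, (hl a (by simp)).2, ih (fun a ha => hl a (by simp [ha])) hnd.2
      fun a ha => hpl a (by simp [ha]), ?_⟩
    rw [writesVar_nest, not_or]
    exact ⟨hnd.1, hpl a (by simp)⟩

/-- Nested counting loops run their body for all values of the registers of the loops. Here `L` is
the list of all loops, split into the outer loops `O`, whose registers are fixed, and the inner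
loops `l`; `I` is an invariant, and `Q f` is what running the body with the values `f` of the
registers achieves and what later runs preserve. -/
lemma run_nest {L : List (ℕ × ℕ)} {p : Code} {I : State → Prop} {Q : (ℕ → ℕ) → State → Prop}
    {bound : ℕ → ℕ} (hbound : ∀ s, I s → ∀ a ∈ L, s.var a.2 = bound a.2)
    (hI : ∀ s k, I s → ∀ a ∈ L, I (s.setVar a.1 k))
    (hQ : ∀ f s k, Q f s → ∀ a ∈ L, Q f (s.setVar a.1 k))
    (hQf : ∀ f g s, Q f s → (∀ a ∈ L, f a.1 = g a.1) → Q g s)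
    (hpL : ∀ a ∈ L, ¬ p.WritesVar a.1)
    (hp : ∀ s, I s → (∀ a ∈ L, s.var a.1 < bound a.2) →
      I (p.run s) ∧ (∀ f, Q f s → Q f (p.run s)) ∧ Q s.var (p.run s))
    (l : List (ℕ × ℕ)) : ∀ O : List (ℕ × ℕ), (∀ a ∈ L, a ∈ O ∨ a ∈ l) → (∀ a ∈ O, a ∈ L) →
      (∀ a ∈ l, a ∈ L) → (l.map Prod.fst).Nodup → (∀ a ∈ O, a.1 ∉ l.map Prod.fst) →
      ∀ s, I s → (∀ a ∈ O, s.var a.1 < bound a.2) →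
      I ((nest l p).run s) ∧ (∀ f, Q f s → Q f ((nest l p).run s)) ∧
        ∀ f : ℕ → ℕ, (∀ a ∈ O, f a.1 = s.var a.1) → (∀ a ∈ l, f a.1 < bound a.2) →
          Q f ((nest l p).run s) := by
  induction l with
  | nil =>
    intro O hLO hOL _ _ _ s hs hb
    have hLO' : ∀ a ∈ L, a ∈ O := fun a ha => (hLO a ha).resolve_right (by simp)
    obtain ⟨h₁, h₂, h₃⟩ := hp s hs fun a ha => hb a (hLO' a ha)
    exact ⟨h₁, h₂, fun f hf _ => hQf _ _ _ h₃ fun a ha => (hf a (hLO' a ha)).symm⟩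
  | cons a l ih =>
    intro O hLO hOL hlL hnd hOl s hs hb
    obtain ⟨x, b⟩ := a
    rw [List.map_cons, List.nodup_cons] at hnd
    have haL : (x, b) ∈ L := hlL _ (by simp)
    have hOx : ∀ a ∈ O, a.1 ≠ x ∧ a.1 ∉ l.map Prod.fst := fun a ha => by
      have := hOl a ha
      rw [List.map_cons, List.mem_cons, not_or] at this
      exact this
    have hbb := hbound s hs _ haL
    have key := run_count_induction (x := x) (b := b) (p := nest l p) (s := s) (fun i s' =>
      I s' ∧ (∀ f, Q f s → Q f s') ∧ (∀ a ∈ O, s'.var a.1 = s.var a.1) ∧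
      ∀ f : ℕ → ℕ, (∀ a ∈ O, f a.1 = s.var a.1) → (∀ a ∈ l, f a.1 < bound a.2) → f x < i → Q f s')
      ⟨hI s 0 hs _ haL, fun f hf => hQ f s 0 hf _ haL,
        fun a ha => by rw [State.setVar_var, if_neg (hOx a ha).1], fun f _ _ h => by omega⟩ ?_
    · obtain ⟨h₁, h₂, -, h₃⟩ := key
      refine ⟨h₁, h₂, fun f hf hfl => h₃ f hf (fun a ha => hfl a (by simp [ha])) ?_⟩
      rw [hbb]
      exact hfl (x, b) (by simp)
    · rintro i hi s' hx ⟨h₁, h₂, h₃, h₄⟩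
      have hO' : ∀ a ∈ (x, b) :: O, s'.var a.1 < bound a.2 := by
        intro a ha
        rcases List.mem_cons.1 ha with rfl | ha
        · rw [hx, ← hbb]
          exact hi
        · rw [h₃ a ha]
          exact hb a ha
      obtain ⟨e₁, e₂, e₃⟩ := ih ((x, b) :: O)
        (fun a ha => by
          rcases hLO a ha with h | h
          · exact .inl (by simp [h])
          · rcases List.mem_cons.1 h with h | h
            · exact .inl (by simp [h])
            · exact .inr h)
        (fun a ha => by
          rcases List.mem_cons.1 ha with rfl | ha
          · exact haL
          · exact hOL a ha)
        (fun a ha => hlL a (by simp [ha])) hnd.2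
        (fun a ha => by
          rcases List.mem_cons.1 ha with rfl | ha
          · exact hnd.1
          · exact (hOx a ha).2) s' h₁ hO'
      refine ⟨hI _ _ e₁ _ haL, fun f hf => hQ _ _ _ (e₂ f (h₂ f hf)) _ haL, fun a ha => ?_,
        fun f hf hfl hfx => hQ _ _ _ ?_ _ haL⟩
      · rw [State.setVar_var, if_neg (hOx a ha).1, run_var _ ?_, h₃ a ha]
        rw [writesVar_nest, not_or]
        exact ⟨(hOx a ha).2, hpL a (hOL a ha)⟩
      · rcases Nat.lt_succ_iff_lt_or_eq.1 hfx with h | h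
        · exact e₂ f (h₄ f hf hfl h)
        · refine e₃ f (fun a ha => ?_) hfl
          rcases List.mem_cons.1 ha with rfl | ha
          · rw [hx, h]
          · rw [hf a ha, h₃ a ha]

end Code

/-! ### The input on the machine -/

namespace GraphInput

variable (I : GraphInput)

/-- The first end of the edge `e`, as stored in the memory. -/
def fst (e : ℕ) : ℕ := if h : e < I.m then ((I.ends ⟨e, h⟩).1 : ℕ) else 0

/-- The second end of the edge `e`, as stored in the memory. -/
def snd (e : ℕ) : ℕ := if h : e < I.m then ((I.ends ⟨e, h⟩).2 : ℕ) else 0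

/-- The edge `e` joins `a` and `b`, as stored in the memory. -/
def Joins (e a b : ℕ) : Prop := I.fst e = a ∧ I.snd e = b ∨ I.fst e = b ∧ I.snd e = a

variable {I} {e a b : ℕ}

lemma fst_of_lt (h : e < I.m) : I.fst e = (I.ends ⟨e, h⟩).1 := dif_pos h

lemma snd_of_lt (h : e < I.m) : I.snd e = (I.ends ⟨e, h⟩).2 := dif_pos h

lemma fst_of_le (h : I.m ≤ e) : I.fst e = 0 := dif_neg (by omega)

lemma snd_of_le (h : I.m ≤ e) : I.snd e = 0 := dif_neg (by omega)

lemma fst_ne_snd (h : e < I.m) : I.fst e ≠ I.snd e := by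
  rw [fst_of_lt h, snd_of_lt h]
  exact fun h' => I.loopless _ (Fin.ext h')

lemma fst_lt (h : 0 < I.n) : I.fst e < I.n := by
  by_cases he : e < I.m
  · rw [fst_of_lt he]; exact Fin.is_lt _
  · rwa [fst_of_le (by omega)]

lemma snd_lt (h : 0 < I.n) : I.snd e < I.n := by
  by_cases he : e < I.m
  · rw [snd_of_lt he]; exact Fin.is_lt _
  · rwa [snd_of_le (by omega)]

lemma Joins.symm (h : I.Joins e a b) : I.Joins e b a := Or.symm h

variable (I) in
/-- The simple graph on the natural numbers that underlies the input graph. -/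
def natGraph : SimpleGraph ℕ where
  Adj a b := ∃ e < I.m, I.Joins e a b
  symm := ⟨fun _ _ ⟨e, he, h⟩ => ⟨e, he, h.symm⟩⟩
  loopless := ⟨fun _ ⟨_, he, h⟩ => fst_ne_snd he (h.elim (fun h => h.1.trans h.2.symm)
    fun h => h.1.trans h.2.symm)⟩

variable (I) in
/-- The registers and arrays that hold the input have not been changed; moreover the register `2`
holds the number of edges plus one.

The other registers of the program are: `3` the size of the best model so far, `4` the level of the
search, `5` the current edge, `6` the current vertex of a walk, `7` the number of edges between the
two sides, `8` the size of the candidate, `9` the current vertex in other loops, and `20, 21, …` the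
choices that determine the candidate. The other arrays are: `2` the best model so far, `3` and `4`
the marks of the two sides of the candidate, `5` the levels and `6` the parents in the search
tree. -/
structure IsStored (s : State) : Prop where
  var_zero : s.var 0 = I.n
  var_one : s.var 1 = I.m
  var_two : s.var 2 = I.m + 1
  arr_zero : s.arr 0 = I.fst
  arr_one : s.arr 1 = I.snd

lemma IsStored.run {s : State} (h : I.IsStored s) {p : Code} (hv : ∀ y < 3, ¬ p.WritesVar y)
    (ha : ∀ y < 2, ¬ p.WritesArr y) : I.IsStored (p.run s) where
  var_zero := by rw [p.run_var (hv 0 (by omega)), h.var_zero]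
  var_one := by rw [p.run_var (hv 1 (by omega)), h.var_one]
  var_two := by rw [p.run_var (hv 2 (by omega)), h.var_two]
  arr_zero := by rw [p.run_arr (ha 0 (by omega)), h.arr_zero]
  arr_one := by rw [p.run_arr (ha 1 (by omega)), h.arr_one]

lemma IsStored.setVar {s : State} (h : I.IsStored s) {x k : ℕ} (hx : 3 ≤ x) :
    I.IsStored (s.setVar x k) where
  var_zero := by rw [State.setVar_var, if_neg (by omega), h.var_zero]
  var_one := by rw [State.setVar_var, if_neg (by omega), h.var_one]
  var_two := by rw [State.setVar_var, if_neg (by omega), h.var_two]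
  arr_zero := h.arr_zero
  arr_one := h.arr_one

lemma IsStored.setArr {s : State} (h : I.IsStored s) {a i k : ℕ} (ha : 2 ≤ a) :
    I.IsStored (s.setArr a i k) where
  var_zero := h.var_zero
  var_one := h.var_one
  var_two := h.var_two
  arr_zero := by rw [State.setArr_arr, if_neg (by omega), h.arr_zero]
  arr_one := by rw [State.setArr_arr, if_neg (by omega), h.arr_one]

end GraphInput

/-- The array that marks the elements of `X`. -/
def ind (X : Finset ℕ) (v : ℕ) : ℕ := if v ∈ X then 1 else 0

lemma update_ind (X : Finset ℕ) (v : ℕ) : Function.update (ind X) v 1 = ind (insert v X) := by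
  funext w
  by_cases h : w = v
  · subst h; simp [ind]
  · simp [ind, h]

lemma ind_empty : ind ∅ = fun _ => 0 := by funext v; simp [ind]

/-! ### Growing the first side -/

section Stages

open Code

variable {I : GraphInput} {s : State}

/-- Clear the marks of both sides and the distances. -/
def clearCode : Code :=
  .count 9 0 (.seq (.store 3 (.var 9) (.const 0))
    (.seq (.store 4 (.var 9) (.const 0)) (.store 5 (.var 9) (.const 0))))

lemma run_clearCode (h : I.IsStored s)
    (h₀ : ∀ v, I.n ≤ v → s.arr 3 v = 0 ∧ s.arr 4 v = 0 ∧ s.arr 5 v = 0) :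
    (clearCode.run s).arr 3 = ind ∅ ∧ (clearCode.run s).arr 4 = ind ∅ ∧
      (clearCode.run s).arr 5 = fun _ => 0 := by
  have key := run_count_induction (x := 9) (b := 0) (s := s)
    (p := .seq (.store 3 (.var 9) (.const 0))
      (.seq (.store 4 (.var 9) (.const 0)) (.store 5 (.var 9) (.const 0))))
    (fun i s' => ∀ v, v < i ∨ I.n ≤ v → s'.arr 3 v = 0 ∧ s'.arr 4 v = 0 ∧ s'.arr 5 v = 0)
    (fun v hv => h₀ v (by omega)) ?_
  · rw [h.var_zero] at key
    have key' := fun v => key v (by omega)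
    rw [ind_empty]
    exact ⟨funext fun v => (key' v).1, funext fun v => (key' v).2.1, funext fun v => (key' v).2.2⟩
  · intro i _ s' hi hs v hv
    by_cases hvi : v = i
    · simp [run, Expr.eval, hi, hvi]
    · simpa [run, Expr.eval, hi, Function.update_of_ne hvi] using hs v (by omega)

/-- The set that is obtained from `{x}` by adding, for each of the edges `g 0, …, g (j - 1)` in
turn, the ends of this edge if one of them is already in the set. -/
def growSet (I : GraphInput) (x : ℕ) (g : ℕ → ℕ) : ℕ → Finset ℕ
  | 0 => {x}
  | j + 1 =>
    if I.fst (g j) ∈ growSet I x g j ∨ I.snd (g j) ∈ growSet I x g j then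
      insert (I.snd (g j)) (insert (I.fst (g j)) (growSet I x g j))
    else growSet I x g j

/-- Compute `growSet`; the registers `20` and `22, 24, …` hold the vertex and the edges. -/
def growCode : ℕ → Code
  | 0 => .store 3 (.var 20) (.const 1)
  | j + 1 => .seq (growCode j)
      (.ite (.add (.arr 3 (.arr 0 (.var (22 + 2 * j)))) (.arr 3 (.arr 1 (.var (22 + 2 * j)))))
        (.seq (.store 3 (.arr 0 (.var (22 + 2 * j))) (.const 1))
          (.store 3 (.arr 1 (.var (22 + 2 * j))) (.const 1)))
        .skip)

lemma not_writesVar_growCode (j y : ℕ) : ¬ (growCode j).WritesVar y := by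
  induction j with
  | zero => simp [growCode, WritesVar]
  | succ j ih => simp [growCode, WritesVar, ih]

lemma writesArr_growCode {j y : ℕ} (h : (growCode j).WritesArr y) : y = 3 := by
  induction j with
  | zero => exact h
  | succ j ih =>
    simp only [growCode, WritesArr, or_false, or_self] at h
    exact h.elim ih id

lemma run_growCode (h : I.IsStored s) (h₃ : s.arr 3 = ind ∅) (j : ℕ) :
    ((growCode j).run s).arr 3 = ind (growSet I (s.var 20) (fun j => s.var (22 + 2 * j)) j) := by
  induction j with
  | zero => simp [growCode, run, Expr.eval, h₃, update_ind, growSet]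
  | succ j ih =>
    have hv : ∀ y, ((growCode j).run s).var y = s.var y := fun y =>
      run_var _ (not_writesVar_growCode j y) s
    have hst : I.IsStored ((growCode j).run s) := h.run (fun y _ => not_writesVar_growCode j y)
      fun y hy hw => absurd (writesArr_growCode hw) (by omega)
    rw [growCode, run]
    set t := (growCode j).run s
    set X := growSet I (s.var 20) (fun j => s.var (22 + 2 * j)) j with hX
    have hcond : (Expr.add (.arr 3 (.arr 0 (.var (22 + 2 * j))))
        (.arr 3 (.arr 1 (.var (22 + 2 * j))))).eval t ≠ 0 ↔
        I.fst (s.var (22 + 2 * j)) ∈ X ∨ I.snd (s.var (22 + 2 * j)) ∈ X := by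
      simp only [Expr.eval, ih, hst.arr_zero, hst.arr_one, hv, ind]
      split_ifs <;> simp_all
    rw [run, growSet, ← hX]
    by_cases hc : I.fst (s.var (22 + 2 * j)) ∈ X ∨ I.snd (s.var (22 + 2 * j)) ∈ X
    · rw [if_pos (hcond.2 hc), if_pos hc]
      simp [run, Expr.eval, ih, hst.arr_zero, hst.arr_one, hv, update_ind]
    · rw [if_neg (fun h => hc (hcond.1 h)), if_neg hc, run, ih]

lemma growSet_subset {x : ℕ} (hx : x < I.n) (g : ℕ → ℕ) (j : ℕ) :
    growSet I x g j ⊆ Finset.range I.n := by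
  induction j with
  | zero => simpa [growSet] using hx
  | succ j ih =>
    have hn : 0 < I.n := by omega
    rw [growSet]
    split_ifs
    · refine Finset.insert_subset ?_ (Finset.insert_subset ?_ ih)
      · exact Finset.mem_range.2 (GraphInput.snd_lt hn)
      · exact Finset.mem_range.2 (GraphInput.fst_lt hn)
    · exact ih

/-- An edge number that is too large stands for the pair `(0, 0)`, which has no effect. -/
lemma growSet_succ_of_le {x : ℕ} {g : ℕ → ℕ} {j : ℕ} (h : I.m ≤ g j) :
    growSet I x g (j + 1) = growSet I x g j := by
  simp only [growSet, GraphInput.fst_of_le h, GraphInput.snd_of_le h, or_self]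
  split_ifs with h₀
  · rw [Finset.insert_eq_of_mem (Finset.mem_insert_self _ _), Finset.insert_eq_of_mem h₀]
  · rfl

lemma connOn_growSet (x : ℕ) (g : ℕ → ℕ) (j : ℕ) : ConnOn I.natGraph (growSet I x g j) := by
  induction j with
  | zero => exact connOn_singleton x
  | succ j ih =>
    rcases Nat.lt_or_ge (g j) I.m with hg | hg
    · have hadj : I.natGraph.Adj (I.fst (g j)) (I.snd (g j)) := ⟨g j, hg, .inl ⟨rfl, rfl⟩⟩
      rw [growSet]
      split_ifs with hc
      · rcases hc with hc | hc
        · rw [Finset.insert_eq_of_mem hc]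
          convert ih.insert_of_adj hc hadj
        · rw [Finset.insert_comm, Finset.insert_eq_of_mem hc]
          convert ih.insert_of_adj hc hadj.symm
      · exact ih
    · rwa [growSet_succ_of_le hg]

lemma growSet_congr {x : ℕ} {g g' : ℕ → ℕ} {j : ℕ} (h : ∀ i < j, g i = g' i) :
    growSet I x g j = growSet I x g' j := by
  induction j with
  | zero => rfl
  | succ j ih => simp only [growSet, ih fun i hi => h i (by omega), h j (by omega)]

/-- Every connected set of at most `M + 1` vertices is grown from some edges. -/
lemma exists_growSet_eq {X : Finset ℕ} (hX : ConnOn I.natGraph X) (hXn : X ⊆ Finset.range I.n)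
    {M : ℕ} (hM : X.card ≤ M + 1) :
    ∃ x < I.n, ∃ g : ℕ → ℕ, (∀ j, g j ≤ I.m) ∧ growSet I x g M = X := by
  obtain ⟨Z, hZ, -, hZc, x, hx, g, hg, h⟩ := hX.exists_subset_card (m := X.card)
    (p := fun Z => ∃ x < I.n, ∃ g : ℕ → ℕ, (∀ j, g j ≤ I.m) ∧
      ∀ j, Z.card ≤ j + 1 → growSet I x g j = Z)
    (fun x hx => ⟨x, Finset.mem_range.1 (hXn hx), fun _ => I.m, fun _ => le_rfl, fun j _ => by
      induction j with
      | zero => rfl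
      | succ j ih => rw [growSet_succ_of_le le_rfl, ih (by simp)]⟩)
    (by
      rintro Z - - ⟨x, hx, g, hg, h⟩ a ha b - hb ⟨e, he, hab⟩
      suffices h : ∃ x < I.n, ∃ g : ℕ → ℕ, (∀ j, g j ≤ I.m) ∧
          ∀ j, (insert b Z).card ≤ j + 1 → growSet I x g j = insert b Z by convert h
      have hZ : 0 < Z.card := Finset.card_pos.2 ⟨a, ha⟩
      refine ⟨x, hx, fun j => if j < Z.card - 1 then g j else if j = Z.card - 1 then e else I.m,
        fun j => ?_, fun j hj => ?_⟩
      · dsimp only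
        split_ifs
        · exact hg j
        · exact he.le
        · exact le_rfl
      · rw [Finset.card_insert_of_notMem hb] at hj
        obtain ⟨i, rfl⟩ : ∃ i, j = Z.card + i := ⟨j - Z.card, by omega⟩
        clear hj
        induction i with
        | zero =>
          obtain ⟨k, hk⟩ : ∃ k, Z.card = k + 1 := ⟨Z.card - 1, by omega⟩
          rw [hk, add_zero, growSet, growSet_congr (g' := g) (fun i hi => by simp [hi]),
            h k (by omega)]
          have hcond : I.fst e ∈ Z ∨ I.snd e ∈ Z := by
            rcases hab with ⟨h₁, -⟩ | ⟨-, h₁⟩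
            · exact .inl (h₁ ▸ ha)
            · exact .inr (h₁ ▸ ha)
          simp only [Nat.add_sub_cancel, lt_irrefl, if_false, if_true, if_pos hcond]
          rcases hab with ⟨h₁, h₂⟩ | ⟨h₁, h₂⟩
          · rw [h₁, h₂, Finset.insert_eq_of_mem ha]
          · rw [h₁, h₂, Finset.insert_comm, Finset.insert_eq_of_mem ha]
        | succ i ih =>
          rw [← add_assoc, growSet_succ_of_le, ih]
          rw [if_neg (by omega), if_neg (by omega)])
    (Finset.card_pos.2 hX.1) le_rfl
  obtain rfl := Finset.eq_of_subset_of_card_le hZ hZc.ge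
  exact ⟨x, hx, g, hg, h M hM⟩

/-! ### Breadth-first search on the machine -/

/-- The state of the breadth-first search from `y` in the graph without `X`, when the vertices of
level `k + 1` are being processed; the root has level `1`, and `d v = 0` means that `v` has not been
reached. All levels are at most `top`, and the pairs in `D` have been processed on this level. -/
structure IsSearch (I : GraphInput) (X : Finset ℕ) (y k top : ℕ) (D : ℕ → ℕ → Prop)
    (d par : ℕ → ℕ) : Prop where
  root : y ∉ X → d y = 1
  reached : ∀ v, d v ≠ 0 → v < I.n ∧ v ∉ X ∧
    (v = y ∧ d v = 1 ∨ d (par v) ≠ 0 ∧ d (par v) + 1 = d v ∧ I.natGraph.Adj (par v) v)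
  le_top : ∀ v, d v ≤ top
  closed : ∀ a b, I.natGraph.Adj a b → d a ≠ 0 → d a < k + 1 ∨ d a = k + 1 ∧ D a b → b ∉ X →
    d b ≠ 0 ∧ d b ≤ d a + 1

variable {X : Finset ℕ} {y k top : ℕ} {D D' : ℕ → ℕ → Prop} {d par : ℕ → ℕ} {a b : ℕ}

lemma IsSearch.mono (h : IsSearch I X y k top D d par) (hD : ∀ a b, D' a b → D a b) :
    IsSearch I X y k top D' d par :=
  ⟨h.root, h.reached, h.le_top,
    fun a b hab ha h' => h.closed a b hab ha (h'.imp_right fun h => ⟨h.1, hD a b h.2⟩)⟩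

/-- Nothing is to be done for an edge from `a` to `b`. -/
lemma IsSearch.pass (h : IsSearch I X y k (k + 2) D d par)
    (hc : ¬ (d a = k + 1 ∧ d b = 0 ∧ b ∉ X)) :
    IsSearch I X y k (k + 2) (fun a' b' => D a' b' ∨ a' = a ∧ b' = b) d par := by
  refine ⟨h.root, h.reached, h.le_top, fun a' b' hab ha h' hb => ?_⟩
  rcases h' with h' | ⟨h', hD | ⟨rfl, rfl⟩⟩
  · exact h.closed a' b' hab ha (.inl h') hb
  · exact h.closed a' b' hab ha (.inr ⟨h', hD⟩) hb
  · have := h.le_top b'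
    by_cases hd : d b' = 0
    · exact absurd ⟨h', hd, hb⟩ hc
    · exact ⟨hd, by omega⟩

/-- The vertex `b` is reached from `a`. -/
lemma IsSearch.reach (h : IsSearch I X y k (k + 2) D d par) (hab : I.natGraph.Adj a b)
    (hb : b < I.n) (hc : d a = k + 1 ∧ d b = 0 ∧ b ∉ X) :
    IsSearch I X y k (k + 2) (fun a' b' => D a' b' ∨ a' = a ∧ b' = b)
      (Function.update d b (k + 2)) (Function.update par b a) := by
  obtain ⟨hda, hdb, hbX⟩ := hc
  have hne : a ≠ b := hab.ne
  refine ⟨fun hy => ?_, fun v hv => ?_, fun v => ?_, fun a' b' hab' ha' h' hb' => ?_⟩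
  · have := h.root hy
    rw [Function.update_of_ne (by rintro rfl; omega), this]
  · by_cases hvb : v = b
    · subst hvb
      refine ⟨hb, hbX, .inr ?_⟩
      rw [Function.update_self, Function.update_self, Function.update_of_ne hne, hda]
      exact ⟨by omega, by omega, hab⟩
    · rw [Function.update_of_ne hvb] at hv ⊢
      obtain ⟨h₁, h₂, h₃⟩ := h.reached v hv
      refine ⟨h₁, h₂, h₃.imp_right fun ⟨h₄, h₅, h₆⟩ => ?_⟩
      rw [Function.update_of_ne hvb, Function.update_of_ne (fun h' => h₄ (by rw [h']; exact hdb))]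
      exact ⟨h₄, h₅, h₆⟩
  · by_cases hvb : v = b
    · subst hvb; simp
    · rw [Function.update_of_ne hvb]; exact h.le_top v
  · by_cases hab₁ : a' = b
    · subst hab₁
      rw [Function.update_self] at h'
      omega
    · rw [Function.update_of_ne hab₁] at ha' h' ⊢
      by_cases hb₁ : b' = b
      · subst hb₁
        rw [Function.update_self]
        refine ⟨by omega, ?_⟩
        rcases h' with h' | h'
        · exact absurd hdb (h.closed a' b' hab' ha' (.inl h') hb').1
        · omega
      · rw [Function.update_of_ne hb₁]
        refine h.closed a' b' hab' ha' (h'.imp_right fun ⟨h₁, h₂⟩ => ⟨h₁, ?_⟩) hb'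
        exact h₂.resolve_right fun h => hb₁ h.2

/-- Process the edge in register `5`, in the direction from the end in array `p` to the end in
array `q`: if the former has the level after the one in register `4`, and the latter has not been
reached and is not an element of the first side, then the latter is reached. The numbers `a` and `b`
are equal if and only if `(a - b) + (b - a)` is zero in truncated arithmetic. -/
def relaxCode (p q : ℕ) : Code :=
  .ite (.add (.sub (.arr 5 (.arr p (.var 5))) (.add (.var 4) (.const 1)))
      (.sub (.add (.var 4) (.const 1)) (.arr 5 (.arr p (.var 5)))))
    .skip
    (.ite (.add (.arr 5 (.arr q (.var 5))) (.arr 3 (.arr q (.var 5)))) .skip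
      (.seq (.store 5 (.arr q (.var 5)) (.add (.var 4) (.const 2)))
        (.store 6 (.arr q (.var 5)) (.arr p (.var 5)))))

lemma run_relaxCode {p q : ℕ} (hp : p < 2) (hq : q < 2) (h₃ : s.arr 3 = ind X)
    (hs : IsSearch I X y (s.var 4) (s.var 4 + 2) D (s.arr 5) (s.arr 6))
    (hab : I.natGraph.Adj (s.arr p (s.var 5)) (s.arr q (s.var 5)))
    (hb : s.arr q (s.var 5) < I.n) :
    IsSearch I X y (s.var 4) (s.var 4 + 2)
      (fun a' b' => D a' b' ∨ a' = s.arr p (s.var 5) ∧ b' = s.arr q (s.var 5))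
      (((relaxCode p q).run s).arr 5) (((relaxCode p q).run s).arr 6) := by
  have hp5 : p ≠ 5 := by omega
  have hq5 : q ≠ 5 := by omega
  by_cases h₁ : s.arr 5 (s.arr p (s.var 5)) = s.var 4 + 1
  · by_cases h₂ : s.arr 5 (s.arr q (s.var 5)) = 0 ∧ s.arr q (s.var 5) ∉ X
    · have := hs.reach hab hb ⟨h₁, h₂⟩
      simpa [relaxCode, run, Expr.eval, h₁, h₂, h₃, ind, hp5, hq5] using this
    · have hne : s.arr 5 (s.arr q (s.var 5)) + ind X (s.arr q (s.var 5)) ≠ 0 := by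
        by_cases hX : s.arr q (s.var 5) ∈ X
        · simp [ind, hX]
        · have : s.arr 5 (s.arr q (s.var 5)) ≠ 0 := fun h => h₂ ⟨h, hX⟩
          omega
      have := hs.pass (a := s.arr p (s.var 5)) (b := s.arr q (s.var 5)) (fun h => h₂ h.2)
      have hrun : (relaxCode p q).run s = s := by
        simp only [relaxCode, run, Expr.eval, h₁, h₃]
        rw [if_neg (by omega), if_pos hne]
      rwa [hrun]
  · have := hs.pass (a := s.arr p (s.var 5)) (b := s.arr q (s.var 5)) (fun h => h₁ h.1)
    have hrun : (relaxCode p q).run s = s := by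
      rw [relaxCode, run, if_pos (by simp only [Expr.eval]; omega), run]
    rwa [hrun]

/-- Breadth-first search from the vertex in register `21` in the graph without the first side; the
root is marked as an element of the second side. Nothing happens if the root is an element of the
first side. -/
def searchCode : Code :=
  .seq (.store 5 (.var 21) (.sub (.const 1) (.arr 3 (.var 21))))
    (.seq (.store 4 (.var 21) (.sub (.const 1) (.arr 3 (.var 21))))
      (.count 4 0 (.count 5 1 (.seq (relaxCode 0 1) (relaxCode 1 0)))))

lemma run_searchCode (h : I.IsStored s) (h₃ : s.arr 3 = ind X) (h₄ : s.arr 4 = ind ∅)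
    (h₅ : s.arr 5 = fun _ => 0) (hy : s.var 21 < I.n) :
    IsSearch I X (s.var 21) I.n (I.n + 1) (fun _ _ => False) ((searchCode.run s).arr 5)
      ((searchCode.run s).arr 6) ∧
    (searchCode.run s).arr 4 = ind (if s.var 21 ∈ X then ∅ else {s.var 21}) := by
  have hn : 0 < I.n := by omega
  set s₂ := (Code.store 4 (.var 21) (.sub (.const 1) (.arr 3 (.var 21)))).run
    ((Code.store 5 (.var 21) (.sub (.const 1) (.arr 3 (.var 21)))).run s) with hs₂
  have hrun : searchCode.run s =
    (Code.count 4 0 (.count 5 1 (.seq (relaxCode 0 1) (relaxCode 1 0)))).run s₂ := rfl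
  rw [hrun]
  have hst : I.IsStored s₂ := (h.setArr (by omega)).setArr (by omega)
  have hs₂₃ : s₂.arr 3 = ind X := by simp [hs₂, run, Expr.eval, h₃]
  have hs₂₄ : s₂.arr 4 = ind (if s.var 21 ∈ X then ∅ else {s.var 21}) := by
    by_cases hyX : s.var 21 ∈ X
    · simp only [hs₂, run, Expr.eval, State.setArr_arr, State.setArr_var, h₃, h₄, ind_empty, if_pos hyX]
      funext v
      by_cases hv : v = s.var 21 <;> simp [ind, hyX, Function.update_apply]
    · simp [hs₂, run, Expr.eval, h₃, h₄, ind, hyX, -Finset.insert_empty]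
      have := update_ind ∅ (s.var 21)
      simpa [ind] using this
  have hs₂₅ : s₂.arr 5 = Function.update (fun _ => 0) (s.var 21) (1 - ind X (s.var 21)) := by
    simp [hs₂, run, Expr.eval, h₃, h₅]
  constructor
  swap
  · rw [run_arr _ (y := 4) (by simp [WritesArr, relaxCode]), hs₂₄]
  have key := run_count_induction (x := 4) (b := 0) (s := s₂)
    (p := .count 5 1 (.seq (relaxCode 0 1) (relaxCode 1 0)))
    (fun k s' => I.IsStored s' ∧ s'.arr 3 = ind X ∧
      IsSearch I X (s.var 21) k (k + 1) (fun _ _ => False) (s'.arr 5) (s'.arr 6)) ?_ ?_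
  · rw [hst.var_zero] at key
    exact key.2.2
  · refine ⟨hst.setVar (by omega), hs₂₃, ⟨fun hyX => ?_, fun v hv => ?_, fun v => ?_,
      fun a b _ ha h' => ?_⟩⟩
    · simp [hs₂₅, ind, hyX]
    · by_cases hvy : v = s.var 21
      · subst hvy
        by_cases hyX : s.var 21 ∈ X
        · simp [hs₂₅, ind, hyX] at hv
        · exact ⟨hy, hyX, .inl ⟨rfl, by simp [hs₂₅, ind, hyX]⟩⟩
      · simp [hs₂₅, Function.update_of_ne hvy] at hv
    · by_cases hvy : v = s.var 21
      · subst hvy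
        simp [hs₂₅]
      · simp [hs₂₅, Function.update_of_ne hvy]
    · exact h'.elim (fun h' => absurd (Nat.lt_one_iff.1 h') ha) fun h' => h'.2.elim
  · rintro k - s₃ hk ⟨hst₃, hX₃, hse₃⟩
    have hinner := run_count_induction (x := 5) (b := 1) (s := s₃)
      (p := .seq (relaxCode 0 1) (relaxCode 1 0))
      (fun i s' => I.IsStored s' ∧ s'.arr 3 = ind X ∧ s'.var 4 = k ∧
        IsSearch I X (s.var 21) k (k + 2) (fun a b => ∃ e < i, I.Joins e a b)
          (s'.arr 5) (s'.arr 6)) ?_ ?_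
    · rw [hst₃.var_one] at hinner
      obtain ⟨e₁, e₂, -, e₄⟩ := hinner
      refine ⟨e₁.setVar (by omega), e₂, e₄.root, e₄.reached, e₄.le_top,
        fun a b hab ha h' hb => e₄.closed a b hab ha ?_ hb⟩
      rcases h' with h' | h'
      · rcases Nat.lt_succ_iff_lt_or_eq.1 h' with h' | h'
        · exact .inl h'
        · exact .inr ⟨h', hab⟩
      · exact h'.2.elim
    · refine ⟨hst₃.setVar (by omega), hX₃, by simpa using hk, hse₃.root, hse₃.reached,
        fun v => (hse₃.le_top v).trans (by omega), fun a b hab ha h' hb => ?_⟩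
      refine hse₃.closed a b hab ha (h'.imp_right fun ⟨_, e, he, _⟩ => ?_) hb
      omega
    · rintro i hi s₄ hs₄i ⟨hst₄, hX₄, hk₄, hse₄⟩
      rw [hst₃.var_one] at hi
      have hw : ∀ p q, ∀ y < 3, ¬ (relaxCode p q).WritesVar y := fun p q y _ => by
        simp [relaxCode, WritesVar]
      have hwa : ∀ p q, ∀ y < 4, ¬ (relaxCode p q).WritesArr y := fun p q y hy => by
        simp only [relaxCode, WritesArr, false_or, not_or]
        omega
      have hv : ∀ p q y, ∀ t, ((relaxCode p q).run t).var y = t.var y := fun p q y t =>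
        run_var _ (by simp [relaxCode, WritesVar]) t
      have hst₅ : I.IsStored ((relaxCode 0 1).run s₄) :=
        hst₄.run (hw 0 1) fun y hy => hwa 0 1 y (by omega)
      have hst₆ : I.IsStored ((relaxCode 1 0).run ((relaxCode 0 1).run s₄)) :=
        hst₅.run (hw 1 0) fun y hy => hwa 1 0 y (by omega)
      have hX₅ : ((relaxCode 0 1).run s₄).arr 3 = ind X := by
        rw [run_arr _ (hwa 0 1 3 (by omega)), hX₄]
      have hX₆ : ((relaxCode 1 0).run ((relaxCode 0 1).run s₄)).arr 3 = ind X := by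
        rw [run_arr _ (hwa 1 0 3 (by omega)), hX₅]
      have hadj : I.natGraph.Adj (I.fst i) (I.snd i) := ⟨i, hi, .inl ⟨rfl, rfl⟩⟩
      have e₁ := run_relaxCode (I := I) (p := 0) (q := 1) (s := s₄) (X := X) (y := s.var 21)
        (D := fun a b => ∃ e < i, I.Joins e a b) (by omega) (by omega) hX₄ (by rwa [hk₄])
        (by rw [hst₄.arr_zero, hst₄.arr_one, hs₄i]; exact hadj)
        (by rw [hst₄.arr_one]; exact GraphInput.snd_lt hn)
      have e₂ := run_relaxCode (I := I) (p := 1) (q := 0) (s := (relaxCode 0 1).run s₄) (X := X)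
        (y := s.var 21) (by omega) (by omega) hX₅ (by rw [hv]; exact e₁)
        (by rw [hst₅.arr_zero, hst₅.arr_one, hv, hs₄i]; exact hadj.symm)
        (by rw [hst₅.arr_zero]; exact GraphInput.fst_lt hn)
      refine ⟨hst₆.setVar (by omega), hX₆, ?_, ?_⟩
      · rw [State.setVar_var, if_neg (by omega), run, hv, hv, hk₄]
      · rw [hv, hk₄] at e₂
        refine e₂.mono fun a b ⟨e, he, hj⟩ => ?_
        rw [hv, hst₅.arr_zero, hst₅.arr_one, hst₄.arr_zero, hst₄.arr_one, hs₄i]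
        rcases Nat.lt_succ_iff_lt_or_eq.1 he with he | rfl
        · exact .inl (.inl ⟨e, he, hj⟩)
        · rcases hj with ⟨h₁, h₂⟩ | ⟨h₁, h₂⟩
          · exact .inl (.inr ⟨h₁.symm, h₂.symm⟩)
          · exact .inr ⟨h₂.symm, h₁.symm⟩

/-- The search reaches a connected set that contains the root and avoids `X`, within as many levels
as it has elements. -/
lemma IsSearch.reached_of_connOn (h : IsSearch I X y I.n top D d par) {Z : Finset ℕ}
    (hZ : ConnOn I.natGraph Z) (hZn : Z ⊆ Finset.range I.n) (hXZ : Disjoint X Z) (hy : y ∈ Z)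
    {v : ℕ} (hv : v ∈ Z) : d v ≠ 0 ∧ d v ≤ Z.card := by
  have hlevel : ∀ t, 1 ≤ t → t ≤ Z.card →
      t ≤ (Z.filter fun v => d v ≠ 0 ∧ d v ≤ t).card := by
    intro t ht
    induction t, ht using Nat.le_induction with
    | base =>
      intro _
      exact Finset.card_pos.2 ⟨y, Finset.mem_filter.2 ⟨hy, by
        rw [h.root (Finset.disjoint_right.1 hXZ hy)]; omega⟩⟩
    | succ t ht ih =>
      intro htZ
      have hmono : (Z.filter fun v => d v ≠ 0 ∧ d v ≤ t) ⊆
          Z.filter fun v => d v ≠ 0 ∧ d v ≤ t + 1 := fun v hv => by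
        simp only [Finset.mem_filter] at hv ⊢
        exact ⟨hv.1, hv.2.1, by omega⟩
      have ih := ih (by omega)
      by_cases heq : (Z.filter fun v => d v ≠ 0 ∧ d v ≤ t) = Z
      · rw [heq] at hmono
        exact htZ.trans (Finset.card_le_card hmono)
      · obtain ⟨a, ha, b, hb, hbt, hab⟩ := hZ.exists_adj_of_ssubset (Finset.card_pos.1 (by omega))
          (Finset.filter_subset _ _) heq
        obtain ⟨haZ, ha₀, hat⟩ := Finset.mem_filter.1 ha
        have hcard : Z.card ≤ I.n := by simpa using Finset.card_le_card hZn
        obtain ⟨hb₀, hbd⟩ := h.closed a b hab ha₀ (.inl (by omega)) (Finset.disjoint_right.1 hXZ hb)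
        have hlt := Finset.card_lt_card (Finset.ssubset_iff_of_subset hmono |>.2
          ⟨b, Finset.mem_filter.2 ⟨hb, hb₀, by omega⟩, hbt⟩)
        omega
  have hZpos : 0 < Z.card := Finset.card_pos.2 ⟨v, hv⟩
  have hall := Finset.eq_of_subset_of_card_le (Finset.filter_subset _ _) (hlevel Z.card hZpos le_rfl)
  rw [← hall] at hv
  exact (Finset.mem_filter.1 hv).2

end Stages

section Stages

open Code

variable {I : GraphInput} {s : State} {X Z : Finset ℕ} {y k top : ℕ} {D : ℕ → ℕ → Prop}
  {d par : ℕ → ℕ}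

/-! ### Collecting the second side -/

/-- `Z` is a subtree of the search tree that contains the root `y`, unless the root is an element of `X`,
in which case the search tree is empty. -/
structure IsSubtree (X : Finset ℕ) (y : ℕ) (d par : ℕ → ℕ) (Z : Finset ℕ) : Prop where
  root : y ∉ X → y ∈ Z
  reached : ∀ v ∈ Z, d v ≠ 0
  parent : ∀ v ∈ Z, v = y ∨ par v ∈ Z

lemma IsSearch.isSubtree_root (h : IsSearch I X y k top D d par) :
    IsSubtree X y d par (if y ∈ X then ∅ else {y}) where
  root := fun hy => by simp [hy]
  reached := fun v hv => by
    split_ifs at hv with hy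
    · simp at hv
    · rw [Finset.mem_singleton.1 hv, h.root hy]; omega
  parent := fun v hv => by
    split_ifs at hv with hy
    · simp at hv
    · exact .inl (Finset.mem_singleton.1 hv)

lemma IsSubtree.subset_range (hZ : IsSubtree X y d par Z) (h : IsSearch I X y k top D d par) :
    Z ⊆ Finset.range I.n :=
  fun v hv => Finset.mem_range.2 (h.reached v (hZ.reached v hv)).1

lemma IsSubtree.disjoint (hZ : IsSubtree X y d par Z) (h : IsSearch I X y k top D d par) :
    Disjoint X Z :=
  Finset.disjoint_right.2 fun v hv => (h.reached v (hZ.reached v hv)).2.1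

lemma IsSubtree.reach (hZ : IsSubtree X y d par Z) (h : IsSearch I X y k top D d par) {v : ℕ}
    (hv : v ∈ Z) : y ∈ Z ∧ Relation.ReflTransGen (AdjIn I.natGraph Z) y v := by
  obtain ⟨i, hi⟩ : ∃ i, d v = i := ⟨_, rfl⟩
  induction i using Nat.strong_induction_on generalizing v with
  | _ i ih =>
    by_cases hvy : v = y
    · subst hvy; exact ⟨hv, .refl⟩
    · obtain ⟨-, -, h₃⟩ := h.reached v (hZ.reached v hv)
      obtain ⟨-, h₄, h₅⟩ := h₃.resolve_left fun h => hvy h.1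
      have hp := (hZ.parent v hv).resolve_left hvy
      obtain ⟨hy, hr⟩ := ih (d (par v)) (by omega) hp rfl
      exact ⟨hy, hr.tail ⟨hp, hv, h₅⟩⟩

lemma IsSubtree.connOn (hZ : IsSubtree X y d par Z) (h : IsSearch I X y k top D d par)
    (hne : Z.Nonempty) : ConnOn I.natGraph Z := by
  obtain ⟨v, hv⟩ := hne
  exact connOn_of_root (hZ.reach h hv).1 fun w hw => (hZ.reach h hw).2

/-- Mark the path from the vertex in register `23 + 2 * j` to the root of the search tree. -/
def walkStep (j : ℕ) : Code :=
  .seq (.assign 6 (.var (23 + 2 * j)))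
    (.count 9 0 (.ite (.sub (.arr 5 (.var 6)) (.const 1))
      (.seq (.store 4 (.var 6) (.const 1)) (.assign 6 (.arr 6 (.var 6)))) .skip))

/-- Mark the paths from the vertices in the registers `23, 25, …` to the root of the search
tree. -/
def walkCode : ℕ → Code
  | 0 => .skip
  | j + 1 => .seq (walkCode j) (walkStep j)

lemma writesVar_walkCode {j x : ℕ} (h : (walkCode j).WritesVar x) : x = 6 ∨ x = 9 := by
  induction j with
  | zero => exact h.elim
  | succ j ih =>
    refine h.elim ih fun h => ?_
    simp only [walkStep, WritesVar] at h
    tauto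

lemma writesArr_walkCode {j a : ℕ} (h : (walkCode j).WritesArr a) : a = 4 := by
  induction j with
  | zero => exact h.elim
  | succ j ih =>
    refine h.elim ih fun h => ?_
    simp only [walkStep, WritesArr] at h
    tauto

lemma run_walkStep (h₀ : s.var 0 = I.n) (hse : IsSearch I X y I.n (I.n + 1) D d par)
    (h₅ : s.arr 5 = d) (h₆ : s.arr 6 = par) (h₄ : s.arr 4 = ind Z)
    (hZ : IsSubtree X y d par Z) (j : ℕ) :
    ∃ Z', ((walkStep j).run s).arr 4 = ind Z' ∧ IsSubtree X y d par Z' ∧ Z ⊆ Z' ∧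
      (d (s.var (23 + 2 * j)) ≠ 0 → s.var (23 + 2 * j) ∈ Z') ∧
      Z'.card ≤ Z.card + d (s.var (23 + 2 * j)) := by
  set z := s.var (23 + 2 * j) with hz
  set s₁ := s.setVar 6 z with hs₁
  have hrun : (walkStep j).run s =
    (Code.count 9 0 (.ite (.sub (.arr 5 (.var 6)) (.const 1))
      (.seq (.store 4 (.var 6) (.const 1)) (.assign 6 (.arr 6 (.var 6)))) .skip)).run s₁ := rfl
  have h₀' : s₁.var 0 = I.n := by rw [hs₁, State.setVar_var, if_neg (by omega), h₀]
  -- The current vertex is `s'.var 6`; it need not be marked, but the parents of all marked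
  -- vertices are marked or equal to it.
  have key := run_count_induction (x := 9) (b := 0) (s := s₁)
    (p := .ite (.sub (.arr 5 (.var 6)) (.const 1))
      (.seq (.store 4 (.var 6) (.const 1)) (.assign 6 (.arr 6 (.var 6)))) .skip)
    (fun i s' => s'.arr 5 = d ∧ s'.arr 6 = par ∧ ∃ Z', s'.arr 4 = ind Z' ∧ Z ⊆ Z' ∧
      (∀ v ∈ Z', d v ≠ 0) ∧ (∀ v ∈ Z', v = y ∨ par v ∈ Z' ∨ par v = s'.var 6) ∧
      Z'.card + d (s'.var 6) ≤ Z.card + d z ∧ (s'.var 6 = z ∨ z ∈ Z') ∧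
      (d z ≠ 0 → d (s'.var 6) ≠ 0) ∧ (d (s'.var 6) ≤ 1 ∨ d (s'.var 6) + i ≤ d z)) ?_ ?_
  · rw [h₀', ← hrun] at key
    obtain ⟨-, -, Z', h4, hsub, hr, hp, hc, hz', hne, hd⟩ := key
    set w := ((walkStep j).run s).var 6
    have hzn : d z ≤ I.n + 1 := hse.le_top z
    have hw : d w ≤ 1 := by omega
    have hmem : d w ≠ 0 → w ∈ Z' := fun hw0 => by
      obtain ⟨-, hX, h⟩ := hse.reached w hw0
      have hwy : w = y := by
        rcases h with h | h
        · exact h.1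
        · omega
      rw [hwy] at hX ⊢
      exact hsub (hZ.root hX)
    refine ⟨Z', h4, ⟨fun hy => hsub (hZ.root hy), hr, fun v hv => ?_⟩, hsub, fun hz0 => ?_,
      by omega⟩
    · rcases hp v hv with h | h | h
      · exact .inl h
      · exact .inr h
      · obtain ⟨-, -, h' | h'⟩ := hse.reached v (hr v hv)
        · exact .inl h'.1
        · right
          rw [h] at h' ⊢
          exact hmem h'.1
    · rcases hz' with h | h
      · rw [← h]
        exact hmem (hne hz0)
      · exact h
  · refine ⟨h₅, h₆, Z, h₄, subset_rfl, hZ.reached, fun v hv => ?_, ?_, ?_, ?_, ?_⟩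
    · exact (hZ.parent v hv).imp_right .inl
    all_goals simp [hs₁]
  · rintro i - s' - ⟨h5, h6, Z', h4, hsub, hr, hp, hc, hz', hne, hd⟩
    set w := s'.var 6 with hw
    have heval : (Expr.sub (.arr 5 (.var 6)) (.const 1)).eval s' = d w - 1 := by
      simp [Expr.eval, h5, hw]
    rw [run, heval]
    by_cases hd2 : d w - 1 = 0
    · rw [if_neg (not_not.2 hd2), run]
      refine ⟨h5, h6, Z', h4, hsub, hr, ?_, ?_, ?_, ?_, ?_⟩ <;>
        rw [State.setVar_var, if_neg (by omega)]
      · exact hp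
      · exact hc
      · exact hz'
      · exact hne
      · exact .inl (by rw [← hw]; omega)
    · rw [if_pos hd2]
      have h6' : ((((Code.store 4 (.var 6) (.const 1)).seq (.assign 6 (.arr 6 (.var 6)))).run
          s').setVar 9 (i + 1)).var 6 = par w := by
        simp [run, Expr.eval, h6, hw]
      obtain ⟨-, -, h'⟩ := hse.reached w (by omega)
      obtain ⟨h₁, h₂, -⟩ := h'.resolve_left fun h => hd2 (by rw [h.2])
      refine ⟨by simpa [run] using h5, by simpa [run] using h6, insert w Z', ?_,
        hsub.trans (Finset.subset_insert _ _), fun v hv => ?_, fun v hv => ?_, ?_, ?_, ?_, ?_⟩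
      · simp [run, Expr.eval, h4, ← hw, update_ind]
      · rcases Finset.mem_insert.1 hv with rfl | hv
        · omega
        · exact hr v hv
      · rw [h6']
        rcases Finset.mem_insert.1 hv with rfl | hv
        · exact .inr (.inr rfl)
        · rcases hp v hv with h | h | h
          · exact .inl h
          · exact .inr (.inl (Finset.mem_insert_of_mem h))
          · exact .inr (.inl (h ▸ Finset.mem_insert_self _ _))
      · rw [h6']
        have := Finset.card_insert_le w Z'
        omega
      · right
        rcases hz' with h | h
        · rw [← h]; exact Finset.mem_insert_self _ _
        · exact Finset.mem_insert_of_mem h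
      · rw [h6']; exact fun _ => h₁
      · rw [h6']; right; omega

lemma run_walkCode (h₀ : s.var 0 = I.n) (hse : IsSearch I X y I.n (I.n + 1) D d par)
    (h₅ : s.arr 5 = d) (h₆ : s.arr 6 = par) (h₄ : s.arr 4 = ind Z)
    (hZ : IsSubtree X y d par Z) (j : ℕ) :
    ∃ Z', ((walkCode j).run s).arr 4 = ind Z' ∧ IsSubtree X y d par Z' ∧ Z ⊆ Z' ∧
      (∀ i < j, d (s.var (23 + 2 * i)) ≠ 0 → s.var (23 + 2 * i) ∈ Z') ∧
      Z'.card ≤ Z.card + ∑ i ∈ Finset.range j, d (s.var (23 + 2 * i)) := by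
  induction j with
  | zero => exact ⟨Z, h₄, hZ, subset_rfl, fun i hi => by omega, by simp⟩
  | succ j ih =>
    obtain ⟨Z₁, h4, hZ₁, hsub, hmem, hcard⟩ := ih
    have hv : ∀ x, x ≠ 6 → x ≠ 9 → ((walkCode j).run s).var x = s.var x := fun x h6 h9 =>
      run_var _ (fun h => (writesVar_walkCode h).elim h6 h9) s
    have ha : ∀ a, a ≠ 4 → ((walkCode j).run s).arr a = s.arr a := fun a h4 =>
      run_arr _ (fun h => h4 (writesArr_walkCode h)) s
    obtain ⟨Z₂, h4₂, hZ₂, hsub₂, hmem₂, hcard₂⟩ := run_walkStep (s := (walkCode j).run s)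
      (by rw [hv 0 (by omega) (by omega), h₀]) hse (by rw [ha 5 (by omega), h₅])
      (by rw [ha 6 (by omega), h₆]) h4 hZ₁ j
    rw [hv (23 + 2 * j) (by omega) (by omega)] at hmem₂ hcard₂
    refine ⟨Z₂, h4₂, hZ₂, hsub.trans hsub₂, fun i hi hd => ?_, ?_⟩
    · rcases Nat.lt_succ_iff_lt_or_eq.1 hi with hi | rfl
      · exact hsub₂ (hmem i hi hd)
      · exact hmem₂ hd
    · rw [Finset.sum_range_succ]
      omega

/-! ### Checking and recording a candidate -/

/-- The edges with one end in `X` and the other end in `Z`. -/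
def crossing (I : GraphInput) (X Z : Finset ℕ) : Finset ℕ :=
  (Finset.range I.m).filter fun e => I.fst e ∈ X ∧ I.snd e ∈ Z ∨ I.snd e ∈ X ∧ I.fst e ∈ Z

/-- Count the edges between the two sides in register `7`. As the sides are disjoint, the truncated
difference `(a + b) - 1` of marks is `1` if both marks are set and zero otherwise. -/
def edgeCode : Code :=
  .seq (.assign 7 (.const 0)) (.count 5 1 (.assign 7 (.add (.var 7) (.add
    (.sub (.add (.arr 3 (.arr 0 (.var 5))) (.arr 4 (.arr 1 (.var 5)))) (.const 1))
    (.sub (.add (.arr 3 (.arr 1 (.var 5))) (.arr 4 (.arr 0 (.var 5)))) (.const 1))))))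

lemma run_edgeCode (h : I.IsStored s) (h₃ : s.arr 3 = ind X) (h₄ : s.arr 4 = ind Z)
    (hXZ : Disjoint X Z) : (edgeCode.run s).var 7 = (crossing I X Z).card := by
  have hcr : ∀ i, ((Finset.range i).filter fun e =>
      I.fst e ∈ X ∧ I.snd e ∈ Z ∨ I.snd e ∈ X ∧ I.fst e ∈ Z).card =
      ∑ e ∈ Finset.range i,
        if I.fst e ∈ X ∧ I.snd e ∈ Z ∨ I.snd e ∈ X ∧ I.fst e ∈ Z then 1 else 0 :=
    fun i => Finset.card_filter _ _
  have key := run_count_induction (x := 5) (b := 1) (s := s.setVar 7 0)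
    (p := .assign 7 (.add (.var 7) (.add
      (.sub (.add (.arr 3 (.arr 0 (.var 5))) (.arr 4 (.arr 1 (.var 5)))) (.const 1))
      (.sub (.add (.arr 3 (.arr 1 (.var 5))) (.arr 4 (.arr 0 (.var 5)))) (.const 1)))))
    (fun i s' => s'.arr = s.arr ∧ s'.var 7 = ∑ e ∈ Finset.range i,
        if I.fst e ∈ X ∧ I.snd e ∈ Z ∨ I.snd e ∈ X ∧ I.fst e ∈ Z then 1 else 0)
    ⟨rfl, by simp⟩ ?_
  · rw [State.setVar_var, if_neg (by omega), h.var_one, ← hcr] at key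
    exact key.2
  · rintro i - s' hi ⟨harr, hs'⟩
    refine ⟨harr, ?_⟩
    rw [Finset.sum_range_succ, ← hs']
    simp only [run, Expr.eval, State.setVar_var, harr, h.arr_zero, h.arr_one, h₃, h₄, hi, ind]
    have hX : ∀ v, v ∈ X → v ∉ Z := fun v hv => Finset.disjoint_left.1 hXZ hv
    have h1 := hX (I.fst i)
    have h2 := hX (I.snd i)
    by_cases e1 : I.fst i ∈ X <;> by_cases e2 : I.snd i ∈ X <;> by_cases e3 : I.fst i ∈ Z <;>
      by_cases e4 : I.snd i ∈ Z <;> simp_all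

/-- Count the vertices of the two sides in register `8`. -/
def sizeCode : Code :=
  .seq (.assign 8 (.const 0)) (.count 9 0
    (.assign 8 (.add (.var 8) (.add (.arr 3 (.var 9)) (.arr 4 (.var 9))))))

lemma run_sizeCode (h : I.IsStored s) (h₃ : s.arr 3 = ind X) (h₄ : s.arr 4 = ind Z)
    (hX : X ⊆ Finset.range I.n) (hZ : Z ⊆ Finset.range I.n) :
    (sizeCode.run s).var 8 = X.card + Z.card := by
  have key := run_count_induction (x := 9) (b := 0) (s := s.setVar 8 0)
    (p := .assign 8 (.add (.var 8) (.add (.arr 3 (.var 9)) (.arr 4 (.var 9)))))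
    (fun i s' => s'.arr = s.arr ∧ s'.var 8 = ∑ v ∈ Finset.range i, (ind X v + ind Z v))
    ⟨rfl, by simp⟩ ?_
  · rw [State.setVar_var, if_neg (by omega), h.var_zero, Finset.sum_add_distrib] at key
    have hsum : ∀ Y ⊆ Finset.range I.n, ∑ v ∈ Finset.range I.n, ind Y v = Y.card := by
      intro Y hY
      simp only [ind, Finset.sum_boole, Finset.filter_mem_eq_inter, Nat.cast_id,
        Finset.inter_eq_right.2 hY]
    rw [hsum X hX, hsum Z hZ] at key
    exact key.2
  · rintro i - s' hi ⟨harr, hs'⟩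
    refine ⟨harr, ?_⟩
    rw [Finset.sum_range_succ, ← hs']
    simp [run, Expr.eval, harr, h₃, h₄, hi]

/-- Record the candidate if it is a model that is smaller than the best one so far; its size is
kept in register `3`. The second side need not be tested for connectedness: it is connected if it
is not empty, which holds if there are edges between the two sides. -/
def recordCode (c : ℕ) : Code :=
  .ite (.sub (.const c) (.var 7)) .skip
    (.ite (.sub (.var 3) (.var 8))
      (.seq (.assign 3 (.var 8)) (.count 9 0 (.store 2 (.var 9)
        (.add (.arr 3 (.var 9)) (.add (.arr 4 (.var 9)) (.arr 4 (.var 9)))))))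
      .skip)

/-- A pumpkin-model of the input graph is recorded in array `2`. -/
def IsRecorded (c : ℕ) (I : GraphInput) (s : State) : Prop :=
  ∃ X Z : Finset ℕ, X ⊆ Finset.range I.n ∧ Z ⊆ Finset.range I.n ∧ Disjoint X Z ∧
    ConnOn I.natGraph X ∧ ConnOn I.natGraph Z ∧ c ≤ (crossing I X Z).card ∧
    X.card + Z.card = s.var 3 ∧ ∀ v < I.n, s.arr 2 v = ind X v + 2 * ind Z v

/-- The invariant of the outer loops: unless register `3` exceeds the number of vertices, it holds
the size of the recorded model. -/
structure IsValid (c : ℕ) (I : GraphInput) (s : State) : Prop where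
  isStored : I.IsStored s
  arr_eq_zero : ∀ v, I.n ≤ v → s.arr 3 v = 0 ∧ s.arr 4 v = 0 ∧ s.arr 5 v = 0
  var_three : s.var 3 ≤ I.n + 1
  isRecorded : s.var 3 ≤ I.n → IsRecorded c I s

lemma run_recordCode {c : ℕ} (h : I.IsStored s) (h₃ : s.arr 3 = ind X) (h₄ : s.arr 4 = ind Z)
    (h₇ : s.var 7 = (crossing I X Z).card) (h₈ : s.var 8 = X.card + Z.card)
    (hXn : X ⊆ Finset.range I.n) (hZn : Z ⊆ Finset.range I.n) (hXZ : Disjoint X Z)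
    (hX : ConnOn I.natGraph X) (hZ : c ≤ (crossing I X Z).card → ConnOn I.natGraph Z)
    (hs : s.var 3 ≤ I.n → IsRecorded c I s) :
    ((recordCode c).run s).var 3 ≤ s.var 3 ∧
      (((recordCode c).run s).var 3 ≤ I.n → IsRecorded c I ((recordCode c).run s)) ∧
      (c ≤ (crossing I X Z).card → ((recordCode c).run s).var 3 ≤ X.card + Z.card) := by
  by_cases hc : c ≤ (crossing I X Z).card
  · by_cases hlt : X.card + Z.card < s.var 3
    · set p : Code := .count 9 0 (.store 2 (.var 9)
        (.add (.arr 3 (.var 9)) (.add (.arr 4 (.var 9)) (.arr 4 (.var 9))))) with hp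
      have hrun : (recordCode c).run s = p.run (s.setVar 3 (X.card + Z.card)) := by
        rw [recordCode, run, if_neg (by simp only [Expr.eval]; omega), run,
          if_pos (by simp only [Expr.eval]; omega), run, run]
        simp only [Expr.eval, h₈, hp]
      have h3 : ((recordCode c).run s).var 3 = X.card + Z.card := by
        rw [hrun, run_var p (by simp [hp, WritesVar])]
        simp
      rw [h3]
      refine ⟨hlt.le, fun _ => ⟨X, Z, hXn, hZn, hXZ, hX, hZ hc, hc, h3.symm, ?_⟩, fun _ => le_rfl⟩
      have key := run_count_induction (x := 9) (b := 0) (s := s.setVar 3 (X.card + Z.card))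
        (p := .store 2 (.var 9)
          (.add (.arr 3 (.var 9)) (.add (.arr 4 (.var 9)) (.arr 4 (.var 9)))))
        (fun i s' => s'.arr 3 = ind X ∧ s'.arr 4 = ind Z ∧
          ∀ v < i, s'.arr 2 v = ind X v + 2 * ind Z v)
        ⟨h₃, h₄, fun v hv => by omega⟩ ?_
      · rw [State.setVar_var, if_neg (by omega), h.var_zero] at key
        rw [hrun]
        exact key.2.2
      · rintro i - s' hi ⟨h3', h4', h2'⟩
        refine ⟨by simpa [run] using h3', by simpa [run] using h4', fun v hv => ?_⟩
        by_cases hvi : v = i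
        · simp [run, Expr.eval, h3', h4', hi, hvi, two_mul]
        · simpa [run, Expr.eval, hi, Function.update_of_ne hvi] using h2' v (by omega)
    · have hrun : (recordCode c).run s = s := by
        rw [recordCode, run, if_neg (by simp only [Expr.eval]; omega), run,
          if_neg (by simp only [Expr.eval]; omega), run]
      rw [hrun]
      exact ⟨le_rfl, hs, fun _ => by omega⟩
  · have hrun : (recordCode c).run s = s := by
      rw [recordCode, run, if_pos (by simp only [Expr.eval]; omega), run]
    rw [hrun]
    exact ⟨le_rfl, hs, fun h => absurd h hc⟩

/-! ### One candidate -/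

/-- Construct and check the candidate given by the registers `20, 21, …`: the first side is grown
from `M` edges, the second side is a tree that joins `c` vertices to the root by shortest paths. -/
def candidateCode (M c : ℕ) : Code :=
  .seq clearCode (.seq (growCode M) (.seq searchCode (.seq (walkCode c)
    (.seq edgeCode (.seq sizeCode (recordCode c))))))

lemma writesVar_candidateCode {M c x : ℕ} (h : (candidateCode M c).WritesVar x) :
    3 ≤ x ∧ x < 10 := by
  simp only [candidateCode, clearCode, searchCode, edgeCode, sizeCode, recordCode, relaxCode,
    WritesVar, not_writesVar_growCode, or_false, false_or] at h
  by_cases hw : (walkCode c).WritesVar x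
  · have := writesVar_walkCode hw
    omega
  · simp only [hw, false_or] at h
    omega

lemma isSafe_candidateCode (M c : ℕ) : (candidateCode M c).IsSafe := by
  have h₁ : ∀ j, (growCode j).IsSafe := fun j => by
    induction j with
    | zero => trivial
    | succ j ih => simp [growCode, IsSafe, ih]
  have h₂ : ∀ j, (walkCode j).IsSafe := fun j => by
    induction j with
    | zero => trivial
    | succ j ih => simp [walkCode, walkStep, IsSafe, WritesVar, ih]
  simp [candidateCode, clearCode, searchCode, edgeCode, sizeCode, recordCode, relaxCode,
    IsSafe, WritesVar, h₁, h₂]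

/-- Let `X` be the first side of the candidate, and suppose that every set that contains the `c`
given vertices has at least `c` edges to `X`. Then the candidate is at least as good, up to a factor
`c` for the second side, as any model whose first side is `X` and whose second side contains the
root and the `c` given vertices: such a second side connects each of these vertices to the root by
a path that is no shorter than the one in the search tree. -/
lemma run_candidateCode {M c : ℕ} (hc : 1 ≤ c) (h : IsValid c I s) (hx : s.var 20 < I.n)
    (hy : s.var 21 < I.n) :
    IsValid c I ((candidateCode M c).run s) ∧ ((candidateCode M c).run s).var 3 ≤ s.var 3 ∧
    ∀ Z : Finset ℕ, ConnOn I.natGraph Z → Z ⊆ Finset.range I.n →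
      Disjoint (growSet I (s.var 20) (fun j => s.var (22 + 2 * j)) M) Z → s.var 21 ∈ Z →
      (∀ j < c, s.var (23 + 2 * j) ∈ Z) →
      (∀ Z' : Finset ℕ, (∀ j < c, s.var (23 + 2 * j) ∈ Z') → c ≤
        (crossing I (growSet I (s.var 20) (fun j => s.var (22 + 2 * j)) M) Z').card) →
      ((candidateCode M c).run s).var 3 ≤ I.n ∧ ((candidateCode M c).run s).var 3 ≤
        (growSet I (s.var 20) (fun j => s.var (22 + 2 * j)) M).card + 1 + c * Z.card := by
  set X := growSet I (s.var 20) (fun j => s.var (22 + 2 * j)) M with hX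
  have hXn : X ⊆ Finset.range I.n := growSet_subset hx _ _
  set s₁ := clearCode.run s with hs₁
  set s₂ := (growCode M).run s₁ with hs₂
  set s₃ := searchCode.run s₂ with hs₃
  set s₄ := (walkCode c).run s₃ with hs₄
  set s₅ := edgeCode.run s₄ with hs₅
  set s₆ := sizeCode.run s₅ with hs₆
  have hrun : (candidateCode M c).run s = (recordCode c).run s₆ := rfl
  have v₁ : ∀ x, x ≠ 9 → s₁.var x = s.var x := fun x hx =>
    run_var _ (by simp [clearCode, WritesVar, hx]) s
  have v₂ : ∀ x, s₂.var x = s₁.var x := fun x => run_var _ (not_writesVar_growCode M x) s₁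
  have v₃ : ∀ x, x ≠ 4 → x ≠ 5 → s₃.var x = s₂.var x := fun x h4 h5 =>
    run_var _ (by simp [searchCode, relaxCode, WritesVar, h4, h5]) s₂
  have v₄ : ∀ x, x ≠ 6 → x ≠ 9 → s₄.var x = s₃.var x := fun x h6 h9 =>
    run_var _ (fun h => (writesVar_walkCode h).elim h6 h9) s₃
  have v₅ : ∀ x, x ≠ 7 → x ≠ 5 → s₅.var x = s₄.var x := fun x h7 h5 =>
    run_var _ (by simp [edgeCode, WritesVar, h7, h5]) s₄
  have v₆ : ∀ x, x ≠ 8 → x ≠ 9 → s₆.var x = s₅.var x := fun x h8 h9 =>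
    run_var _ (by simp [sizeCode, WritesVar, h8, h9]) s₅
  have a₂ : ∀ a, a ≠ 3 → s₂.arr a = s₁.arr a := fun a ha =>
    run_arr _ (fun h => ha (writesArr_growCode h)) s₁
  have a₃ : ∀ a, a ≠ 4 → a ≠ 5 → a ≠ 6 → s₃.arr a = s₂.arr a := fun a h4 h5 h6 =>
    run_arr _ (by simp [searchCode, relaxCode, WritesArr, h4, h5, h6]) s₂
  have a₄ : ∀ a, a ≠ 4 → s₄.arr a = s₃.arr a := fun a ha =>
    run_arr _ (fun h => ha (writesArr_walkCode h)) s₃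
  have a₅ : ∀ a, s₅.arr a = s₄.arr a := fun a => run_arr _ (by simp [edgeCode, WritesArr]) s₄
  have a₆ : ∀ a, s₆.arr a = s₅.arr a := fun a => run_arr _ (by simp [sizeCode, WritesArr]) s₅
  have t₁ : I.IsStored s₁ := h.isStored.run (fun y hy => by simp [clearCode, WritesVar]; omega)
    fun y hy => by simp [clearCode, WritesArr]; omega
  have t₂ : I.IsStored s₂ := t₁.run (fun y _ => not_writesVar_growCode M y)
    fun y hy hw => absurd (writesArr_growCode hw) (by omega)
  have t₃ : I.IsStored s₃ := t₂.run
    (fun y hy => by simp [searchCode, relaxCode, WritesVar]; omega)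
    fun y hy => by simp [searchCode, relaxCode, WritesArr]; omega
  have t₄ : I.IsStored s₄ := t₃.run
    (fun y hy hw => absurd (writesVar_walkCode hw) (by omega))
    fun y hy hw => absurd (writesArr_walkCode hw) (by omega)
  have t₅ : I.IsStored s₅ := t₄.run (fun y hy => by simp [edgeCode, WritesVar]; omega)
    fun y hy => by simp [edgeCode, WritesArr]
  have t₆ : I.IsStored s₆ := t₅.run (fun y hy => by simp [sizeCode, WritesVar]; omega)
    fun y hy => by simp [sizeCode, WritesArr]
  obtain ⟨c₃, c₄, c₅⟩ := run_clearCode h.isStored h.arr_eq_zero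
  have g₃ : s₂.arr 3 = ind X := by
    rw [hs₂, run_growCode t₁ c₃ M, v₁ 20 (by omega), hX,
      growSet_congr fun i _ => v₁ (22 + 2 * i) (by omega)]
  obtain ⟨hse, b₄⟩ := run_searchCode t₂ g₃ (by rw [a₂ 4 (by omega), c₄])
    (by rw [a₂ 5 (by omega), c₅]) (by rwa [v₂, v₁ 21 (by omega)])
  have hv21 : s₂.var 21 = s.var 21 := by rw [v₂, v₁ 21 (by omega)]
  rw [hv21, ← hs₃] at hse b₄
  obtain ⟨Z, w₄, hZ, -, hmem, hcard⟩ := run_walkCode (s := s₃) t₃.var_zero hse rfl rfl b₄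
    hse.isSubtree_root c
  have hv23 : ∀ j, s₃.var (23 + 2 * j) = s.var (23 + 2 * j) := fun j => by
    rw [v₃ _ (by omega) (by omega), v₂, v₁ _ (by omega)]
  simp only [hv23] at hmem hcard
  have e₃ : s₄.arr 3 = ind X := by
    rw [a₄ 3 (by omega), a₃ 3 (by omega) (by omega) (by omega), g₃]
  have hZn := hZ.subset_range hse
  have hXZ := hZ.disjoint hse
  have f₇ : s₅.var 7 = (crossing I X Z).card := run_edgeCode t₄ e₃ w₄ hXZ
  have f₈ : s₆.var 8 = X.card + Z.card :=
    run_sizeCode t₅ (by rw [a₅, e₃]) (by rw [a₅, w₄]) hXn hZn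
  have v3 : s₆.var 3 = s.var 3 := by
    rw [v₆ 3 (by omega) (by omega), v₅ 3 (by omega) (by omega), v₄ 3 (by omega) (by omega),
      v₃ 3 (by omega) (by omega), v₂, v₁ 3 (by omega)]
  have a2 : s₆.arr 2 = s.arr 2 := by
    rw [a₆, a₅, a₄ 2 (by omega), a₃ 2 (by omega) (by omega) (by omega), a₂ 2 (by omega)]
    exact run_arr _ (by simp [clearCode, WritesArr]) s
  obtain ⟨r₁, r₂, r₃⟩ := run_recordCode (c := c) t₆ (by rw [a₆, a₅, e₃]) (by rw [a₆, a₅, w₄])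
    (by rw [v₆ 7 (by omega) (by omega), f₇]) f₈ hXn hZn hXZ (connOn_growSet _ _ _)
    (fun hcr => by
      obtain ⟨e, he⟩ := Finset.card_pos.1 (by omega : 0 < (crossing I X Z).card)
      refine hZ.connOn hse ?_
      rcases (Finset.mem_filter.1 he).2 with h | h
      · exact ⟨_, h.2⟩
      · exact ⟨_, h.2⟩)
    (by
      rw [v3]
      intro h3
      obtain ⟨A, B, hA, hB, hAB, hcA, hcB, hcr, hsz, h2⟩ := h.isRecorded h3
      exact ⟨A, B, hA, hB, hAB, hcA, hcB, hcr, by rw [v3, hsz], by rw [a2]; exact h2⟩)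
  rw [← hrun] at r₁ r₂ r₃
  have a₇ : ∀ a, a ≠ 2 → ((candidateCode M c).run s).arr a = s₆.arr a := fun a ha => by
    rw [hrun]
    exact run_arr _ (by simp [recordCode, WritesArr, ha]) s₆
  refine ⟨⟨?_, fun v hv => ?_, ?_, r₂⟩, ?_, fun Z₀ hZ₀ hZ₀n hXZ₀ hyZ₀ htZ₀ hcr => ?_⟩
  · rw [hrun]
    exact t₆.run (fun y hy => by simp [recordCode, WritesVar]; omega)
      fun y hy => by simp [recordCode, WritesArr]; omega
  · have hout : ∀ Y ⊆ Finset.range I.n, ind Y v = 0 := fun Y hY =>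
      if_neg fun hv' => by have := Finset.mem_range.1 (hY hv'); omega
    rw [a₇ 3 (by omega), a₇ 4 (by omega), a₇ 5 (by omega), a₆, a₅, e₃, a₆, a₅, w₄, a₆, a₅,
      a₄ 5 (by omega)]
    refine ⟨hout X hXn, hout Z hZn, ?_⟩
    by_contra hd
    have := (hse.reached v hd).1
    omega
  · rw [v3] at r₁
    exact r₁.trans h.var_three
  · rwa [v3] at r₁
  · have hyX : s.var 21 ∉ X := Finset.disjoint_right.1 hXZ₀ hyZ₀
    have hreach : ∀ j < c, s₃.arr 5 (s.var (23 + 2 * j)) ≠ 0 ∧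
        s₃.arr 5 (s.var (23 + 2 * j)) ≤ Z₀.card := fun j hj =>
      hse.reached_of_connOn hZ₀ hZ₀n hXZ₀ hyZ₀ (htZ₀ j hj)
    have hsum : ∑ i ∈ Finset.range c, s₃.arr 5 (s.var (23 + 2 * i)) ≤ c * Z₀.card := by
      refine (Finset.sum_le_card_nsmul _ _ _ fun i hi =>
        (hreach i (Finset.mem_range.1 hi)).2).trans ?_
      simp
    have h3 := r₃ (hcr Z fun j hj => hmem j hj (hreach j hj).1)
    rw [if_neg hyX, Finset.card_singleton] at hcard
    have hle := Finset.card_le_card (Finset.union_subset hXn hZn)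
    rw [Finset.card_union_of_disjoint hXZ, Finset.card_range] at hle
    omega

end Stages

/-! ### Vertex sets of the input graph -/

section Lift

variable {I : GraphInput} {c : ℕ} {X Z : Finset ℕ}

lemma encard_preimage_val {n : ℕ} (hX : X ⊆ Finset.range n) :
    {i : Fin n | (i : ℕ) ∈ X}.encard = X.card := by
  rw [← Set.encard_coe_eq_coe_finsetCard, ← Fin.val_injective.encard_image]
  congr 1
  ext v
  exact ⟨fun ⟨i, hi, h⟩ => h ▸ hi, fun h => ⟨⟨v, Finset.mem_range.1 (hX h)⟩, h, rfl⟩⟩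

lemma GraphInput.natGraph_adj {a b : Fin I.n} : I.natGraph.Adj a b ↔ I.toGraph.Adj a b := by
  constructor
  · rintro ⟨e, he, h⟩
    refine ⟨⟨e, he⟩, ?_⟩
    rw [GraphInput.Joins, GraphInput.fst_of_lt he, GraphInput.snd_of_lt he] at h
    rcases h with ⟨h₁, h₂⟩ | ⟨h₁, h₂⟩
    · exact .inl (Prod.ext (Fin.ext h₁) (Fin.ext h₂))
    · exact .inr (Prod.ext (Fin.ext h₁) (Fin.ext h₂))
  · rintro ⟨⟨e, he⟩, h⟩
    refine ⟨e, he, ?_⟩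
    rw [GraphInput.Joins, GraphInput.fst_of_lt he, GraphInput.snd_of_lt he]
    rcases h with h | h <;> rw [h]
    · exact .inl ⟨rfl, rfl⟩
    · exact .inr ⟨rfl, rfl⟩

lemma connected_induce_preimage_iff (hX : X ⊆ Finset.range I.n) :
    Connected (I.toGraph.induce {i | (i : ℕ) ∈ X}) ↔ ConnOn I.natGraph X := by
  constructor
  · rintro ⟨⟨x, hx⟩, h⟩
    refine connOn_of_root hx fun y hy => ?_
    obtain ⟨y, rfl⟩ : ∃ y' : Fin I.n, (y' : ℕ) = y := ⟨⟨y, Finset.mem_range.1 (hX hy)⟩, rfl⟩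
    have hxy := h x hx y hy
    clear hy
    induction hxy with
    | refl => exact .refl
    | tail _ hbc ih =>
      obtain ⟨hb, hc, hadj⟩ := induce_adj.1 hbc
      exact ih.tail ⟨hb, hc, GraphInput.natGraph_adj.2 hadj⟩
  · rintro ⟨⟨x, hx⟩, h⟩
    refine ⟨⟨⟨x, Finset.mem_range.1 (hX hx)⟩, hx⟩, fun a ha b hb => ?_⟩
    have hab := h a ha b hb
    generalize hw : (b : ℕ) = w at hab
    clear hb
    induction hab generalizing b with
    | refl => rw [Fin.ext hw]
    | @tail v w _ hvw ih =>
      subst hw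
      exact (ih ⟨v, Finset.mem_range.1 (hX hvw.1)⟩ rfl).tail
        (induce_adj.2 ⟨hvw.1, hvw.2.1, GraphInput.natGraph_adj.1 hvw.2.2⟩)

lemma edgesBetween_preimage :
    edgesBetween I.toGraph {i | (i : ℕ) ∈ X} {i | (i : ℕ) ∈ Z} =
      {e : Fin I.m | (e : ℕ) ∈ crossing I X Z} := by
  ext ⟨e, he⟩
  simp only [crossing, Set.mem_ofPred_eq, Finset.mem_filter, Finset.mem_range, he, true_and,
    GraphInput.fst_of_lt he, GraphInput.snd_of_lt he]
  constructor
  · rintro ⟨a, ha, b, hb, h | h⟩ <;> rw [h]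
    · exact .inl ⟨ha, hb⟩
    · exact .inr ⟨ha, hb⟩
  · rintro (⟨h₁, h₂⟩ | ⟨h₁, h₂⟩)
    · exact ⟨_, h₁, _, h₂, .inl rfl⟩
    · exact ⟨_, h₁, _, h₂, .inr rfl⟩

lemma isPumpkinModel_preimage_iff (hX : X ⊆ Finset.range I.n) (hZ : Z ⊆ Finset.range I.n) :
    IsPumpkinModel c I.toGraph {i | (i : ℕ) ∈ X} {i | (i : ℕ) ∈ Z} ↔
      Disjoint X Z ∧ ConnOn I.natGraph X ∧ ConnOn I.natGraph Z ∧ c ≤ (crossing I X Z).card := by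
  have hcr : crossing I X Z ⊆ Finset.range I.m := Finset.filter_subset _ _
  have hcard : (c : ℕ∞) ≤
      (edgesBetween I.toGraph {i | (i : ℕ) ∈ X} {i | (i : ℕ) ∈ Z}).encard ↔
      c ≤ (crossing I X Z).card := by
    rw [edgesBetween_preimage, encard_preimage_val hcr, Nat.cast_le]
  constructor
  · rintro ⟨-, -, h₁, h₂, h₃, h₄⟩
    refine ⟨Finset.disjoint_left.2 fun v hv hv' => ?_, (connected_induce_preimage_iff hX).1 h₂,
      (connected_induce_preimage_iff hZ).1 h₃, hcard.1 h₄⟩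
    have hvX : (⟨v, Finset.mem_range.1 (hX hv)⟩ : Fin I.n) ∈ {i : Fin I.n | (i : ℕ) ∈ X} := hv
    exact Set.disjoint_left.1 h₁ hvX hv'
  · rintro ⟨h₁, h₂, h₃, h₄⟩
    exact ⟨fun _ _ => trivial, fun _ _ => trivial,
      Set.disjoint_left.2 fun i hi hi' => Finset.disjoint_left.1 h₁ hi hi',
      (connected_induce_preimage_iff hX).2 h₂, (connected_induce_preimage_iff hZ).2 h₃,
      hcard.2 h₄⟩

lemma exists_preimage_eq (A : Set (Fin I.n)) :
    ∃ X ⊆ Finset.range I.n, A = {i : Fin I.n | (i : ℕ) ∈ X} ∧ A.ncard = X.card := by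
  classical
  have hX : (A.toFinset.map Fin.valEmbedding) ⊆ Finset.range I.n := fun v hv => by
    obtain ⟨i, -, rfl⟩ := Finset.mem_map.1 hv
    exact Finset.mem_range.2 i.2
  refine ⟨A.toFinset.map Fin.valEmbedding, hX, ?_, ?_⟩
  · ext i
    simp [Fin.val_inj]
  · rw [Finset.card_map, Set.ncard_eq_toFinset_card']

/-- A set with `c` edges to `Z` has them to any set that contains `c` suitable elements of `Z`. -/
lemma exists_targets (hXZ : Disjoint X Z) (hc : c ≤ (crossing I X Z).card) :
    ∃ z : ℕ → ℕ, (∀ j < c, z j ∈ Z) ∧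
      ∀ Z' : Finset ℕ, (∀ j < c, z j ∈ Z') → c ≤ (crossing I X Z').card := by
  obtain ⟨T, hT, hTc⟩ := Finset.exists_subset_card_eq hc
  set w : ℕ → ℕ := fun e => if I.fst e ∈ X then I.snd e else I.fst e with hw
  have hwZ : ∀ e ∈ T, w e ∈ Z := fun e he => by
    rcases (Finset.mem_filter.1 (hT he)).2 with ⟨h₁, h₂⟩ | ⟨h₁, h₂⟩
    · simpa [hw, h₁] using h₂
    · have h₃ : I.fst e ∉ X := Finset.disjoint_right.1 hXZ h₂
      simpa [hw, h₃] using h₂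
  refine ⟨fun j => if h : j < c then w (T.orderEmbOfFin hTc ⟨j, h⟩) else 0, fun j hj => ?_,
    fun Z' hZ' => ?_⟩
  · simpa [hj] using hwZ _ (Finset.orderEmbOfFin_mem T hTc _)
  · rw [← hTc]
    refine Finset.card_le_card fun e he => Finset.mem_filter.2 ⟨(Finset.mem_filter.1 (hT he)).1, ?_⟩
    obtain ⟨⟨j, hj⟩, rfl⟩ : e ∈ Set.range (T.orderEmbOfFin hTc) := by
      rw [Finset.range_orderEmbOfFin]; exact he
    have hmem := hZ' j hj
    simp only [dif_pos hj] at hmem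
    by_cases hf : I.fst (T.orderEmbOfFin hTc ⟨j, hj⟩) ∈ X
    · exact .inl ⟨hf, by simpa [hw, hf] using hmem⟩
    · refine .inr ⟨?_, by simpa [hw, hf] using hmem⟩
      exact ((Finset.mem_filter.1 (hT he)).2.resolve_left fun h => hf h.1).1

end Lift

/-! ### The exhaustive search over all candidates -/

section Main

open Code

variable {I : GraphInput} {s : State} {M c : ℕ}

/-- The registers of the outer loops, together with the registers that bound them: a start vertex
and `M` edges for the first side, a root and `c` further vertices for the second side. -/
def loops (M c : ℕ) : List (ℕ × ℕ) :=
  (20, 0) :: (21, 0) :: ((List.range M).map (fun j => (22 + 2 * j, 2)) ++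
    (List.range c).map fun j => (23 + 2 * j, 0))

lemma mem_loops {a : ℕ × ℕ} : a ∈ loops M c ↔ a = (20, 0) ∨ a = (21, 0) ∨
    (∃ j < M, (22 + 2 * j, 2) = a) ∨ ∃ j < c, (23 + 2 * j, 0) = a := by
  simp [loops]

lemma twenty_le_of_mem_loops {a : ℕ × ℕ} (ha : a ∈ loops M c) : 20 ≤ a.1 ∧ (a.2 = 0 ∨ a.2 = 2) := by
  rcases mem_loops.1 ha with rfl | rfl | ⟨j, -, rfl⟩ | ⟨j, -, rfl⟩ <;> simp <;> omega

lemma nodup_loops : ((loops M c).map Prod.fst).Nodup := by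
  have h : (loops M c).map Prod.fst = 20 :: 21 :: ((List.range M).map (fun j => 22 + 2 * j) ++
      (List.range c).map fun j => 23 + 2 * j) := by
    simp [loops, Function.comp_def]
  rw [h, List.nodup_cons, List.nodup_cons, List.nodup_append']
  refine ⟨?_, ?_, ?_, ?_, ?_⟩
  · simp only [List.mem_cons, List.mem_append, List.mem_map]; grind
  · simp only [List.mem_append, List.mem_map]; grind
  · exact List.nodup_range.map fun a b (h : 22 + 2 * a = 22 + 2 * b) => by omega
  · exact List.nodup_range.map fun a b (h : 23 + 2 * a = 23 + 2 * b) => by omega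
  · rw [List.disjoint_left]
    simp
    omega

/-- Try all candidates and record the best model. -/
def searchAllCode (M c : ℕ) : Code := nest (loops M c) (candidateCode M c)

lemma isSafe_searchAllCode : (searchAllCode M c).IsSafe := by
  refine isSafe_nest (isSafe_candidateCode M c) (fun a ha => ?_) nodup_loops fun a ha h => ?_
  · have := twenty_le_of_mem_loops ha
    omega
  · have := twenty_le_of_mem_loops ha
    have := writesVar_candidateCode h
    omega

lemma IsValid.setVar (h : IsValid c I s) {x k : ℕ} (hx : 20 ≤ x) : IsValid c I (s.setVar x k) := by
  have h3 : (s.setVar x k).var 3 = s.var 3 := by rw [State.setVar_var, if_neg (by omega)]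
  refine ⟨h.isStored.setVar (by omega), h.arr_eq_zero, h3 ▸ h.var_three, fun h' => ?_⟩
  obtain ⟨A, B, hA, hB, hAB, hcA, hcB, hcr, hsz, h2⟩ := h.isRecorded (h3 ▸ h')
  exact ⟨A, B, hA, hB, hAB, hcA, hcB, hcr, by rw [h3, hsz], h2⟩

/-- The exhaustive search finds a model that is not much larger than a given one, if the first side
of the latter has at most `M + 1` elements. -/
lemma run_searchAllCode (hc : 1 ≤ c) (h : IsValid c I s) {X Z : Finset ℕ}
    (hX : ConnOn I.natGraph X) (hXn : X ⊆ Finset.range I.n) (hM : X.card ≤ M + 1)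
    (hZ : ConnOn I.natGraph Z) (hZn : Z ⊆ Finset.range I.n) (hXZ : Disjoint X Z)
    (hcr : c ≤ (crossing I X Z).card) :
    IsRecorded c I ((searchAllCode M c).run s) ∧
      ((searchAllCode M c).run s).var 3 ≤ X.card + 1 + c * Z.card := by
  obtain ⟨x, hx, g, hg, rfl⟩ := exists_growSet_eq hX hXn hM
  obtain ⟨z, hz, hzcr⟩ := exists_targets hXZ hcr
  obtain ⟨y, hy⟩ := hZ.1
  obtain ⟨h₁, -, h₂⟩ := run_nest (L := loops M c) (p := candidateCode M c) (I := IsValid c I)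
    (Q := fun f s => ∀ Z : Finset ℕ, ConnOn I.natGraph Z → Z ⊆ Finset.range I.n →
      Disjoint (growSet I (f 20) (fun j => f (22 + 2 * j)) M) Z → f 21 ∈ Z →
      (∀ j < c, f (23 + 2 * j) ∈ Z) →
      (∀ Z' : Finset ℕ, (∀ j < c, f (23 + 2 * j) ∈ Z') → c ≤
        (crossing I (growSet I (f 20) (fun j => f (22 + 2 * j)) M) Z').card) →
      s.var 3 ≤ I.n ∧
        s.var 3 ≤ (growSet I (f 20) (fun j => f (22 + 2 * j)) M).card + 1 + c * Z.card)
    (bound := fun b => if b = 2 then I.m + 1 else I.n)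
    (fun s hs a ha => by
      rcases (twenty_le_of_mem_loops ha).2 with h | h <;> rw [h]
      · exact hs.isStored.var_zero
      · exact hs.isStored.var_two)
    (fun s k hs a ha => hs.setVar (twenty_le_of_mem_loops ha).1)
    (fun f s k hf a ha => by
      have := (twenty_le_of_mem_loops ha).1
      rwa [State.setVar_var, if_neg (by omega)])
    (fun f g s hf hfg => by
      have h20 : f 20 = g 20 := hfg _ (mem_loops.2 (.inl rfl))
      have h21 : f 21 = g 21 := hfg _ (mem_loops.2 (.inr (.inl rfl)))
      have h22 : ∀ j < M, f (22 + 2 * j) = g (22 + 2 * j) := fun j hj =>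
        hfg _ (mem_loops.2 (.inr (.inr (.inl ⟨j, hj, rfl⟩))))
      have h23 : ∀ j < c, f (23 + 2 * j) = g (23 + 2 * j) := fun j hj =>
        hfg _ (mem_loops.2 (.inr (.inr (.inr ⟨j, hj, rfl⟩))))
      rw [h20, h21, growSet_congr h22] at hf
      intro Z a₁ a₂ a₃ a₄ a₅ a₆
      exact hf Z a₁ a₂ a₃ a₄ (fun j hj => h23 j hj ▸ a₅ j hj)
        fun Z' hZ' => a₆ Z' fun j hj => h23 j hj ▸ hZ' j hj)
    (fun a ha hw => by
      have := twenty_le_of_mem_loops ha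
      have := writesVar_candidateCode hw
      omega)
    (fun s hs hb => by
      obtain ⟨r₁, r₂, r₃⟩ := run_candidateCode (M := M) hc hs
        (by simpa using hb _ (mem_loops.2 (.inl rfl)))
        (by simpa using hb _ (mem_loops.2 (.inr (.inl rfl))))
      refine ⟨r₁, fun f hf Z a₁ a₂ a₃ a₄ a₅ a₆ => ?_, r₃⟩
      obtain ⟨e₁, e₂⟩ := hf Z a₁ a₂ a₃ a₄ a₅ a₆
      exact ⟨r₂.trans e₁, r₂.trans e₂⟩)
    (loops M c) [] (fun a ha => .inr ha) (by simp) (fun a ha => ha) nodup_loops (by simp) s h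
    (by simp)
  set f : ℕ → ℕ := fun r => if r = 20 then x else if r = 21 then y else
    if r % 2 = 0 then g ((r - 22) / 2) else z ((r - 23) / 2) with hf
  have f20 : f 20 = x := rfl
  have f21 : f 21 = y := rfl
  have f22 : (fun j => f (22 + 2 * j)) = g := funext fun j => by
    simp only [hf]
    rw [if_neg (by omega), if_neg (by omega), if_pos (by omega)]
    congr 1
    omega
  have f23 : ∀ j, f (23 + 2 * j) = z j := fun j => by
    simp only [hf]
    rw [if_neg (by omega), if_neg (by omega), if_neg (by omega)]
    congr 1
    omega
  have h₃ := h₂ f (by simp) (fun a ha => by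
    rcases mem_loops.1 ha with rfl | rfl | ⟨j, hj, rfl⟩ | ⟨j, hj, rfl⟩
    · simpa [f20] using hx
    · simpa [f21] using hZn hy
    · have := congrFun f22 j
      simp only [this, if_true]
      exact Nat.lt_succ_of_le (hg j)
    · simpa [f23] using hZn (hz j hj)) Z hZ hZn
  simp only [f20, f21, f22, f23] at h₃
  obtain ⟨h₄, h₅⟩ := h₃ hXZ hy hz hzcr
  exact ⟨h₁.isRecorded h₄, h₅⟩

/-- The program that finds a small `c`-pumpkin-model: register `3` initially exceeds the size of every
model. -/
def mainProgram (M c : ℕ) : Program :=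
  .seq (.assign 2 (.add (.var 1) (.const 1)))
    (.seq (.assign 3 (.add (.var 0) (.const 1))) (searchAllCode M c).toProgram)

lemma isValid_initialState :
    IsValid c I ((I.initialState.setVar 2 (I.m + 1)).setVar 3 (I.n + 1)) := by
  have hfst : I.initialState.arr 0 = I.fst := funext fun e => by
    simp [GraphInput.initialState, GraphInput.fst]
  have hsnd : I.initialState.arr 1 = I.snd := funext fun e => by
    simp [GraphInput.initialState, GraphInput.snd]
  refine ⟨⟨rfl, rfl, rfl, hfst, hsnd⟩, fun v _ => ?_, le_rfl, fun h => ?_⟩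
  · simp [GraphInput.initialState]
  · simp at h

lemma IsRecorded.isPumpkinModel (h : IsRecorded c I s) :
    IsPumpkinModel c I.toGraph (I.markedSet s 1) (I.markedSet s 2) ∧
      (I.markedSet s 1).ncard + (I.markedSet s 2).ncard = s.var 3 := by
  obtain ⟨X, Z, hX, hZ, hXZ, hcX, hcZ, hcr, hsz, h2⟩ := h
  have h1 : I.markedSet s 1 = {i : Fin I.n | (i : ℕ) ∈ X} := by
    ext i
    have hi : (i : ℕ) ∈ X → (i : ℕ) ∉ Z := fun h => Finset.disjoint_left.1 hXZ h
    rw [GraphInput.markedSet, Set.mem_ofPred_eq, Set.mem_ofPred_eq, h2 i i.2, ind, ind]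
    split_ifs <;> simp_all
  have h2 : I.markedSet s 2 = {i : Fin I.n | (i : ℕ) ∈ Z} := by
    ext i
    have hi : (i : ℕ) ∈ X → (i : ℕ) ∉ Z := fun h => Finset.disjoint_left.1 hXZ h
    rw [GraphInput.markedSet, Set.mem_ofPred_eq, Set.mem_ofPred_eq, h2 i i.2, ind, ind]
    split_ifs <;> simp_all
  rw [h1, h2, isPumpkinModel_preimage_iff hX hZ, ← hsz, Set.ncard_def, Set.ncard_def,
    encard_preimage_val hX, encard_preimage_val hZ]
  exact ⟨⟨hXZ, hcX, hcZ, hcr⟩, rfl⟩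

/-- For fixed `M` and `c`, a program finds in polynomial time a model that is not much larger than
any given one whose first side has at most `M + 1` elements. -/
theorem exists_program (M : ℕ) (hc : 1 ≤ c) : ∃ (P : Program) (p : Polynomial ℕ), ∀ I : GraphInput,
    ∀ A B, IsPumpkinModel c I.toGraph A B → A.ncard ≤ M + 1 → ∃ (t : ℕ) (s : State),
      Runs P I.initialState t s ∧ t ≤ p.eval (I.n + I.m) ∧
      IsPumpkinModel c I.toGraph (I.markedSet s 1) (I.markedSet s 2) ∧
      (I.markedSet s 1).ncard + (I.markedSet s 2).ncard ≤ A.ncard + 1 + c * B.ncard := by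
  obtain ⟨p, hp⟩ := exists_runs (isSafe_searchAllCode (M := M) (c := c))
  refine ⟨mainProgram M c, 8 + p.comp (.X + 1), fun I A B hAB hA => ?_⟩
  obtain ⟨X, hX, rfl, hXc⟩ := exists_preimage_eq A
  obtain ⟨Z, hZ, rfl, hZc⟩ := exists_preimage_eq B
  obtain ⟨h₁, h₂, h₃, h₄⟩ := (isPumpkinModel_preimage_iff hX hZ).1 hAB
  have hvalid := isValid_initialState (c := c) (I := I)
  set s₀ := (I.initialState.setVar 2 (I.m + 1)).setVar 3 (I.n + 1) with hs₀
  obtain ⟨t, ht, hr⟩ := hp (I.n + I.m + 1) s₀ fun b hb => by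
    have := hvalid.isStored.var_zero
    have := hvalid.isStored.var_one
    have := hvalid.isStored.var_two
    interval_cases b <;> omega
  obtain ⟨h₅, h₆⟩ := run_searchAllCode (M := M) hc hvalid h₂ hX (hXc ▸ hA) h₃ hZ h₁ h₄
  obtain ⟨h₇, h₈⟩ := h₅.isPumpkinModel
  have hassign : Runs (.assign 3 (.add (.var 0) (.const 1))) (I.initialState.setVar 2 (I.m + 1)) 4
      s₀ := .assign 3 (.add (.var 0) (.const 1)) _
  refine ⟨4 + (4 + t), (searchAllCode M c).run s₀,
    .seq (.assign 2 (.add (.var 1) (.const 1)) _) (.seq hassign hr), ?_, h₇, ?_⟩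
  · rw [Polynomial.eval_add, Polynomial.eval_comp]
    simp only [Polynomial.eval_ofNat, Polynomial.eval_add, Polynomial.eval_X, Polynomial.eval_one]
    omega
  · rw [h₈, hXc, hZc]
    exact h₆

lemma natLog_add_one_le {n : ℕ} (hn : 2 ≤ n) :
    (Nat.log 2 n + 1 : ℝ) ≤ 2 / Real.log 2 * Real.log n := by
  have h₁ : (1 : ℝ) ≤ Nat.log 2 n := by
    exact_mod_cast Nat.log_pos (by omega) hn
  have h₂ : (Nat.log 2 n : ℝ) ≤ Real.logb 2 n := by
    exact_mod_cast Real.natLog_le_logb n 2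
  rw [Real.logb] at h₂
  rw [div_mul_eq_mul_div, mul_div_assoc]
  linarith

lemma IsPumpkinModel.two_le_ncard {α : Type u} {β : Type v} {G : Graph α β} {A B : Set α}
    (h : IsPumpkinModel c G A B) (hV : V(G).Finite) : 2 ≤ V(G).ncard := by
  have hA := hV.subset h.left_subset
  have hB := hV.subset h.right_subset
  have h₁ : 0 < A.ncard := (Set.ncard_pos hA).2 h.left_connected.1
  have h₂ : 0 < B.ncard := (Set.ncard_pos hB).2 h.right_connected.1
  have h₃ := Set.ncard_union_eq h.disjoint hA hB
  have h₄ := Set.ncard_le_ncard (Set.union_subset h.left_subset h.right_subset) hV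
  omega

/-- Sides of bounded and of logarithmic size give a model of logarithmic size, also after the second
side has been enlarged by a factor `c`. -/
lemma add_one_add_mul_le {n S a b k : ℕ} (hn : 2 ≤ n) (ha : a ≤ S)
    (hb : b ≤ S * (Nat.log 2 n + 1)) (hk : k ≤ a + 1 + c * b) :
    (k : ℝ) ≤ (S + 1 + c * S : ℕ) * (2 / Real.log 2) * Real.log n := by
  have h₁ : k ≤ (S + 1 + c * S) * (Nat.log 2 n + 1) := by
    have h₂ : c * b ≤ c * (S * (Nat.log 2 n + 1)) := Nat.mul_le_mul_left c hb
    calc k ≤ (S + 1) * 1 + c * (S * (Nat.log 2 n + 1)) := by omega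
      _ ≤ (S + 1) * (Nat.log 2 n + 1) + c * (S * (Nat.log 2 n + 1)) := by gcongr; omega
      _ = (S + 1 + c * S) * (Nat.log 2 n + 1) := by ring
  calc (k : ℝ) ≤ (S + 1 + c * S : ℕ) * (Nat.log 2 n + 1 : ℝ) := by exact_mod_cast h₁
    _ ≤ (S + 1 + c * S : ℕ) * (2 / Real.log 2 * Real.log n) := by
      gcongr
      exact natLog_add_one_le hn
    _ = _ := by ring

end Main

end Pumpkin

theorem lemma4p9 :
    ∃ f : ℕ → ℝ, ∀ c : ℕ, 1 ≤ c →
      -- every non-empty finite loopless `c`-reduced multigraph has a small `c`-pumpkin-model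
      (∀ (α : Type u) (β : Type v) (G : Graph α β), V(G).Finite → E(G).Finite → G.Loopless →
        V(G).Nonempty → Pumpkin.IsReduced c G →
        ∃ A B : Set α, Pumpkin.IsPumpkinModel c G A B ∧
          (A.ncard + B.ncard : ℝ) ≤ f c * Real.log V(G).ncard) ∧
      -- and, for fixed `c`, a program finds one in time polynomial in the size of the graph
      (∃ (P : Pumpkin.Program) (p : Polynomial ℕ), ∀ I : Pumpkin.GraphInput,
        0 < I.n → Pumpkin.IsReduced c I.toGraph →
        ∃ (t : ℕ) (s : Pumpkin.State),
          Pumpkin.Runs P I.initialState t s ∧ t ≤ p.eval (I.n + I.m) ∧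
          Pumpkin.IsPumpkinModel c I.toGraph (I.markedSet s 1) (I.markedSet s 2) ∧
          ((I.markedSet s 1).ncard + (I.markedSet s 2).ncard : ℝ) ≤ f c * Real.log I.n) := by
  refine ⟨fun c => (Pumpkin.sizeBound c + 1 + c * Pumpkin.sizeBound c : ℕ) * (2 / Real.log 2),
    fun c hc => ⟨fun α β G hV _ hl hne hG => ?_, ?_⟩⟩
  · obtain ⟨A, B, h, hA, hB⟩ := hG.exists_small_model hc hV hl hne
    refine ⟨A, B, h, ?_⟩
    have := Pumpkin.add_one_add_mul_le (c := c) (k := A.ncard + B.ncard) (h.two_le_ncard hV) hA hB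
      (by have := Nat.le_mul_of_pos_left B.ncard hc; omega)
    exact_mod_cast this
  · obtain ⟨P, p, hP⟩ := Pumpkin.exists_program (Pumpkin.sizeBound c) hc
    refine ⟨P, p, fun I hn hG => ?_⟩
    have hcard : V(I.toGraph).ncard = I.n := by
      rw [show V(I.toGraph) = Set.univ from rfl, Set.ncard_univ, Nat.card_fin]
    have hl : I.toGraph.Loopless := by
      refine ⟨fun e x h => ?_⟩
      rcases h with h | h <;> exact I.loopless e (by rw [h])
    obtain ⟨A, B, h, hA, hB⟩ := hG.exists_small_model hc (Set.toFinite _) hl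
      ⟨⟨0, hn⟩, trivial⟩
    have h2 := h.two_le_ncard (Set.toFinite _)
    rw [hcard] at hB h2
    obtain ⟨t, s, hr, ht, hs, hk⟩ := hP I A B h (by omega)
    refine ⟨t, s, hr, ht, hs, ?_⟩
    have := Pumpkin.add_one_add_mul_le h2 hA hB hk
    exact_mod_cast this
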